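/- Let $E$ be a real $d\times d$ matrix all of whose (complex) eigenvalues have positive real part, let $0<a_1<\dots<a_p$ be the distinct real parts of the eigenvalues, $q=\operatorname{trace}(E)$, and $c^E=\exp(E\log c)$ for $c>0$. Let $\mathbb R^d=V_1\oplus\dots\oplus V_p$ be the spectral decomposition with respect to $E$, where $V_i$ consists of the real vectors in the sum of the generalized eigenspaces (in $\mathbb C^d$) of the eigenvalues with real part $a_i$; put $W_i=V_1\oplus\dots\oplus V_i$ and $W_0=\{0\}$. Let $\|x\|_0=\int_0^1\|t^Ex\|\,\frac{dt}{t}$, and for $x\neq0$ let $\tau(x)>0$ be the unique number such that $\|\tau(x)^{-E}x\|_0=1$; put $\tau(0)=0$. A function $\varphi:\mathbb R^d\to[0,\infty)$ is $E$-homogeneous if $\varphi(c^Ex)=c\,\varphi(x)$ for all $c>0$ and $x\ne0$. It is $(\beta,E)$-admissible if it is continuous, positive on $\mathbb R^d\setminus\{0\}$, and for all $0<A<B$ there is $C>0$ such that $|\varphi(x+y)-\varphi(y)|\le C\tau(x)^\beta$ whenever $A\le\|y\|\le B$ and $\tau(x)\le1$. Moving average field: let $\beta>0$, let $\varphi$ be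 $E$-homogeneous and $(\beta,E)$-admissible, let $0<H<\beta$ with $H\neq q/2$, let $Z$ be an independently scattered real centred Gaussian random measure on $\mathbb R^d$ whose control measure is Lebesgue measure (up to a fixed positive normalization constant), and let $$X_\varphi(x)=\int_{\mathbb R^d}\bigl(\varphi(x-y)^{H-q/2}-\varphi(-y)^{H-q/2}\bigr)\,Z(dy),\qquad x\in\mathbb R^d.$$ Harmonizable field: let $\psi:\mathbb R^d\to[0,\infty)$ be continuous, $E^t$-homogeneous (where $E^t$ is the transpose of $E$) and positive on $\mathbb R^d\setminus\{0\}$, let $0<H<a_1$, let $W$ be a complex isotropic Gaussian random measure on $\mathbb R^d$ whose control measure is Lebesgue measure (up to a fixed positive normalization constant), and let $$X_\psi(x)=\operatorname{Re}\int_{\mathbb R^d}\bigl(e^{i\langle x,\xi\rangle}-1\bigr)\psi(\xi)^{-H-q/2}\,W(d\xi),\qquad x\in\mathbb R^d.$$ Let $X$ be either of these two fields. Then for every $i=1,\dots,p$ and every $u\in W_i\setminus W_{i-1}$, the process $\{X(tu)\}_{t\in[0,1]}$ has a continuous version, and for every continuous version $\{Y(t)\}_{t\in[0,1]}$ of it,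 almost surely $$\dim_{\mathcal H}\{(t,Y(t)) : t\in[0,1]\}=2-\frac{H}{a_i}.$$ -/

import Mathlib

open MeasureTheory ProbabilityTheory Filter Topology

namespace OSSRF

/-! ### Matrix powers, the real spectrum and the spectral decomposition -/

/-- `c ^ E` acting on `x ∈ ℝ^d`, where `c ^ E = exp (log c • E)` for `c > 0`. -/
noncomputable def powAct {d : ℕ} (E : Matrix (Fin d) (Fin d) ℝ) (c : ℝ)
    (x : EuclideanSpace ℝ (Fin d)) : EuclideanSpace ℝ (Fin d) :=
  Matrix.toEuclideanLin (NormedSpace.exp (Real.log c • E)) x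

/-- The real matrix `E` regarded as a complex matrix. -/
noncomputable def complexMatrix {d : ℕ} (E : Matrix (Fin d) (Fin d) ℝ) : Matrix (Fin d) (Fin d) ℂ :=
  E.map (algebraMap ℝ ℂ)

/-- The set of real parts of the (complex) eigenvalues of `E`. -/
def realSpectrum {d : ℕ} (E : Matrix (Fin d) (Fin d) ℝ) : Set ℝ :=
  Complex.re '' spectrum ℂ (complexMatrix E)

/-- The inclusion of `ℝ^d` into `ℂ^d`. -/
noncomputable def complexify (d : ℕ) : EuclideanSpace ℝ (Fin d) →ₗ[ℝ] (Fin d → ℂ) where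
  toFun x j := (x j : ℂ)
  map_add' x y := by ext j; simp
  map_smul' c x := by ext j; simp

/-- The component of the spectral decomposition of `ℝ^d` with respect to `E` that belongs to the
real part `r`: the real vectors in the sum of the generalized eigenspaces of all complex
eigenvalues with real part `r`. (It is `ker f(E)`, where `f` is the factor of the minimal polynomial
of `E` that collects the roots with real part `r`.) -/
noncomputable def spectralSubspace {d : ℕ} (E : Matrix (Fin d) (Fin d) ℝ) (r : ℝ) :
    Submodule ℝ (EuclideanSpace ℝ (Fin d)) :=
  ((⨆ μ : ℂ, ⨆ _ : μ.re = r,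
      Module.End.maxGenEigenspace (Matrix.toLin' (complexMatrix E)) μ).restrictScalars ℝ).comap
    (complexify d)

/-- `W_k = V_1 ⊕ ⋯ ⊕ V_k`, the sum of the first `k` spectral components; `W_0 = {0}`.
Here `V_{j+1}` belongs to `a j`, with `j` counted from `0`. -/
noncomputable def spectralFlag {d p : ℕ} (E : Matrix (Fin d) (Fin d) ℝ) (a : Fin p → ℝ) (k : ℕ) :
    Submodule ℝ (EuclideanSpace ℝ (Fin d)) :=
  ⨆ j : Fin p, ⨆ _ : (j : ℕ) < k, spectralSubspace E (a j)

/-! ### Polar coordinates, homogeneous and admissible functions -/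

/-- The norm `‖x‖₀ = ∫_0^1 ‖t ^ E x‖ dt / t` adapted to `E`. If all eigenvalues of `E` have positive
real part, then `t ↦ ‖t ^ E x‖₀` is strictly increasing for `x ≠ 0`, and `(r, θ) ↦ r ^ E θ` is a
homeomorphism from `(0, ∞) × {‖θ‖₀ = 1}` onto `ℝ^d \ {0}`. -/
noncomputable def adaptedNorm {d : ℕ} (E : Matrix (Fin d) (Fin d) ℝ)
    (x : EuclideanSpace ℝ (Fin d)) : ℝ :=
  ∫ t in Set.Ioc (0 : ℝ) 1, ‖powAct E t x‖ / t

/-- The radial part `τ(x)`. For `x ≠ 0` it is the unique `r > 0` with `x = r ^ E θ` for some `θ`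
with `‖θ‖₀ = 1`, that is, with `‖r ^ (-E) x‖₀ = 1`, and `r ↦ ‖r ^ (-E) x‖₀` is strictly decreasing;
moreover `τ(0) = 0`. -/
noncomputable def radialPart {d : ℕ} (E : Matrix (Fin d) (Fin d) ℝ)
    (x : EuclideanSpace ℝ (Fin d)) : ℝ :=
  sInf {r : ℝ | 0 < r ∧ adaptedNorm E (powAct E r⁻¹ x) ≤ 1}

/-- `φ` is `E`-homogeneous: `φ (c ^ E x) = c φ x` for all `c > 0` and `x ≠ 0`. -/
def IsHomogeneous {d : ℕ} (E : Matrix (Fin d) (Fin d) ℝ)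
    (φ : EuclideanSpace ℝ (Fin d) → ℝ) : Prop :=
  ∀ c : ℝ, 0 < c → ∀ x : EuclideanSpace ℝ (Fin d), x ≠ 0 → φ (powAct E c x) = c * φ x

/-- `φ` is `(β, E)`-admissible. -/
structure IsAdmissible {d : ℕ} (β : ℝ) (E : Matrix (Fin d) (Fin d) ℝ)
    (φ : EuclideanSpace ℝ (Fin d) → ℝ) : Prop where
  continuous : Continuous φ
  nonneg : ∀ x, 0 ≤ φ x
  pos : ∀ x, x ≠ 0 → 0 < φ x
  bound : ∀ A B : ℝ, 0 < A → A < B → ∃ C : ℝ, 0 < C ∧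
    ∀ x y : EuclideanSpace ℝ (Fin d), A ≤ ‖y‖ → ‖y‖ ≤ B → radialPart E x ≤ 1 →
      |φ (x + y) - φ y| ≤ C * radialPart E x ^ β

/-! ### Gaussian random measures with Lebesgue control measure and their integrals -/

/-- `Z` is an independently scattered random measure on the Borel sets of finite Lebesgue
measure of `ℝ^d` (its values on other sets are irrelevant). -/
structure IsIndependentlyScattered {d : ℕ} {Ω 𝕜 : Type*} [MeasurableSpace Ω] [RCLike 𝕜]
    [MeasurableSpace 𝕜] (P : Measure Ω) (Z : Set (EuclideanSpace ℝ (Fin d)) → Ω → 𝕜) : Prop where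
  measurable : ∀ A, MeasurableSet A → volume A ≠ ⊤ → Measurable (Z A)
  indep : ∀ (n : ℕ) (A : Fin n → Set (EuclideanSpace ℝ (Fin d))),
    (∀ k, MeasurableSet (A k)) → (∀ k, volume (A k) ≠ ⊤) → Pairwise (Function.onFun Disjoint A) →
    iIndepFun (fun k => Z (A k)) P
  sigma_additive : ∀ A : ℕ → Set (EuclideanSpace ℝ (Fin d)),
    (∀ n, MeasurableSet (A n)) → volume (⋃ n, A n) ≠ ⊤ → Pairwise (Function.onFun Disjoint A) →
    ∀ᵐ ω ∂P, Tendsto (fun N => ∑ n ∈ Finset.range N, Z (A n) ω) atTop (𝓝 (Z (⋃ n, A n) ω))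

/-- `Z` is a real centred Gaussian random measure with Lebesgue control measure:
`Z A ~ N(0, v |A|)`. The constant `v` only fixes the normalization. -/
structure IsGaussianRandomMeasure {d : ℕ} {Ω : Type*} [MeasurableSpace Ω]
    (P : Measure Ω) (v : NNReal) (Z : Set (EuclideanSpace ℝ (Fin d)) → Ω → ℝ) : Prop
    extends IsIndependentlyScattered P Z where
  law : ∀ A, MeasurableSet A → volume A ≠ ⊤ →
    HasLaw (Z A) (gaussianReal 0 (v * (volume A).toNNReal)) P

/-- `W` is a complex isotropic Gaussian random measure with Lebesgue control measure: the law of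
`W A` is rotation invariant, that is, its real and imaginary parts are independent with the same
law `N(0, v |A|)`. The constant `v` only fixes the normalization. -/
structure IsIsotropicGaussianRandomMeasure {d : ℕ} {Ω : Type*} [MeasurableSpace Ω]
    (P : Measure Ω) (v : NNReal) (W : Set (EuclideanSpace ℝ (Fin d)) → Ω → ℂ) : Prop
    extends IsIndependentlyScattered P W where
  law : ∀ A, MeasurableSet A → volume A ≠ ⊤ →
    HasLaw (fun ω => ((W A ω).re, (W A ω).im))
      ((gaussianReal 0 (v * (volume A).toNNReal)).prod
        (gaussianReal 0 (v * (volume A).toNNReal))) P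

/-- The integral `∑ c, c Z(s = c)` of a simple function `s` (all of whose nonzero values are
attained on sets of finite measure). -/
noncomputable def simpleIntegral {d : ℕ} {Ω 𝕜 : Type*} [RCLike 𝕜]
    (Z : Set (EuclideanSpace ℝ (Fin d)) → Ω → 𝕜)
    (s : SimpleFunc (EuclideanSpace ℝ (Fin d)) 𝕜) (ω : Ω) : 𝕜 :=
  ∑ c ∈ s.range, c * Z (s ⁻¹' {c}) ω

/-- `Y` is (a version of) the integral of `f` with respect to `Z`: `f` is square integrable and `Y`
is the limit in probability of the integrals of simple functions that converge to `f` in `L²`. -/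
def IsStochasticIntegral {d : ℕ} {Ω 𝕜 : Type*} [MeasurableSpace Ω] [RCLike 𝕜]
    (P : Measure Ω) (Z : Set (EuclideanSpace ℝ (Fin d)) → Ω → 𝕜)
    (f : EuclideanSpace ℝ (Fin d) → 𝕜) (Y : Ω → 𝕜) : Prop :=
  MemLp f 2 volume ∧ AEStronglyMeasurable Y P ∧
  ∃ s : ℕ → SimpleFunc (EuclideanSpace ℝ (Fin d)) 𝕜,
    (∀ n, MemLp (s n) 2 volume) ∧
    Tendsto (fun n => eLpNorm (f - ⇑(s n)) 2 volume) atTop (𝓝 0) ∧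
    TendstoInMeasure P (fun n => simpleIntegral Z (s n)) atTop Y

open Classical in
/-- The stochastic integral `∫ f dZ`, a random variable determined up to a null event (and `0` if
the integral does not exist). -/
noncomputable def stochasticIntegral {d : ℕ} {Ω 𝕜 : Type*} [MeasurableSpace Ω] [RCLike 𝕜]
    (P : Measure Ω) (Z : Set (EuclideanSpace ℝ (Fin d)) → Ω → 𝕜)
    (f : EuclideanSpace ℝ (Fin d) → 𝕜) : Ω → 𝕜 :=
  if h : ∃ Y, IsStochasticIntegral P Z f Y then h.choose else 0

/-! ### The two Gaussian operator scaling random fields -/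

/-- The moving average field
`X_φ(x) = ∫ (φ(x - y) ^ (H - q/2) - φ(-y) ^ (H - q/2)) Z(dy)`, where `q = trace E`. -/
noncomputable def movingAverageField {d : ℕ} {Ω : Type*} [MeasurableSpace Ω] (P : Measure Ω)
    (Z : Set (EuclideanSpace ℝ (Fin d)) → Ω → ℝ) (E : Matrix (Fin d) (Fin d) ℝ)
    (φ : EuclideanSpace ℝ (Fin d) → ℝ) (H : ℝ) (x : EuclideanSpace ℝ (Fin d)) : Ω → ℝ :=
  stochasticIntegral P Z
    (fun y => φ (x - y) ^ (H - E.trace / 2) - φ (-y) ^ (H - E.trace / 2))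

/-- The harmonizable field
`X_ψ(x) = Re ∫ (e ^ (i⟨x, ξ⟩) - 1) ψ(ξ) ^ (- H - q/2) W(dξ)`, where `q = trace E`. -/
noncomputable def harmonizableField {d : ℕ} {Ω : Type*} [MeasurableSpace Ω] (P : Measure Ω)
    (W : Set (EuclideanSpace ℝ (Fin d)) → Ω → ℂ) (E : Matrix (Fin d) (Fin d) ℝ)
    (ψ : EuclideanSpace ℝ (Fin d) → ℝ) (H : ℝ) (x : EuclideanSpace ℝ (Fin d)) (ω : Ω) : ℝ :=
  (stochasticIntegral P W
    (fun ξ => (Complex.exp (Complex.I * ((inner ℝ x ξ : ℝ) : ℂ)) - 1) *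
      ((ψ ξ ^ (-H - E.trace / 2) : ℝ) : ℂ)) ω).re

/-- `Y` is a continuous version on `[0, 1]` of the process `X`: `Y t = X t` almost surely for every
`t ∈ [0, 1]`, and almost all paths of `Y` are continuous on `[0, 1]`. -/
def IsContinuousVersion {Ω : Type*} [MeasurableSpace Ω] (P : Measure Ω)
    (X Y : ℝ → Ω → ℝ) : Prop :=
  (∀ t ∈ Set.Icc (0 : ℝ) 1, Y t =ᵐ[P] X t) ∧
  ∀ᵐ ω ∂P, ContinuousOn (fun t => Y t ω) (Set.Icc 0 1)

/-- The path `t ↦ X t` almost surely has a graph over `[0, 1]` of Hausdorff dimension `D`: the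
process has a continuous version, and the graph `{(t, Y t) : t ∈ [0, 1]} ⊆ ℝ × ℝ` of every
continuous version `Y` almost surely has Hausdorff dimension `D`. (The maximum metric of `ℝ × ℝ`
and the Euclidean one are equivalent and give the same dimension.) -/
def GraphHasDimension {Ω : Type*} [MeasurableSpace Ω] (P : Measure Ω)
    (X : ℝ → Ω → ℝ) (D : ℝ) : Prop :=
  (∃ Y : ℝ → Ω → ℝ, IsContinuousVersion P X Y) ∧
  ∀ Y : ℝ → Ω → ℝ, IsContinuousVersion P X Y →
    ∀ᵐ ω ∂P, dimH ((fun t : ℝ => (t, Y t ω)) '' Set.Icc (0 : ℝ) 1) = ENNReal.ofReal D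

end OSSRF

namespace OSSRF
open scoped ENNReal NNReal

/-! Both fields are Gaussian integrals of kernels k_x, and the laws of their increments are governed
by N(x) = ‖k_x‖ in L². A translation (moving average) or a factor of modulus one (harmonizable)
shows that X(su) - X(tu) is centred Gaussian with variance v N((s - t)u)². Homogeneity and the
Jacobian c^q of c^E give N(c^E x) = c^H N(x). Moreover N is even, subadditive, lower semicontinuous
by Fatou's lemma, and positive off the origin. `IsScalingKernel` collects what the two kernels
share, and from there on both fields are treated at once.

For u in W_i but not in W_{i-1} and c ≥ 1, the norm of c^E u lies between multiples of c^(a_i - δ)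
and c^(a_i + δ) for every δ > 0 (`exists_le_norm_powAct`, `exists_norm_powAct_le`). Taking c close
to |t|^(-1/a_i) brings c^E(tu) to unit size, so N(tu) = c^(-H) N(c^E(tu)) behaves like |t|^(H/a_i)
up to arbitrarily small powers of |t|. This uses that N is bounded on bounded sets (Baire category)
and bounded below on annuli (semicontinuity and compactness). Subadditivity of N also forces H/a_i ≤
1.

What remains is a statement on processes whose Gaussian increments have variance |s - t|^(2h) up to
small powers, `graphHasDimension_of_gaussian_increments`. Kolmogorov's theorem gives paths that are
Hölder of every order α < h, and counting squares bounds the dimension by 2 - α. Conversely, for 1 <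
γ < 2 - h Lebesgue measure lifted to the graph has finite expected γ-energy: the mean of max(|s -
t|, |Y_s - Y_t|)^(-γ) is at most of order |s - t|^(1 - γ - α) with α slightly above h, which is
integrable. Frostman's criterion (`le_dimH_of_energy`) then bounds the dimension from below by γ. -/

/-! ### Hausdorff dimension: covers, energies and a Gaussian kernel estimate -/

theorem ediam_prod_Icc_le (a b r : ℝ) :
    Metric.ediam (Set.Icc a (a + r) ×ˢ Set.Icc b (b + r)) ≤ ENNReal.ofReal r := by
  refine Metric.ediam_le fun x hx y hy => ?_
  rw [Prod.edist_eq, edist_dist, edist_dist]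
  obtain ⟨⟨h1, h2⟩, ⟨h3, h4⟩⟩ := hx
  obtain ⟨⟨h5, h6⟩, ⟨h7, h8⟩⟩ := hy
  refine max_le (ENNReal.ofReal_le_ofReal ?_) (ENNReal.ofReal_le_ofReal ?_) <;>
  · rw [Real.dist_eq, abs_le]; constructor <;> linarith

/-- The graph over `[0, 1]` of an `α`-Hölder function has dimension at most `2 - α`. -/
theorem dimH_graph_le_of_holder {f : ℝ → ℝ} {α C : ℝ} (hα0 : 0 < α) (hα1 : α ≤ 1) (hC : 0 ≤ C)
    (hf : ∀ s ∈ Set.Icc (0 : ℝ) 1, ∀ t ∈ Set.Icc (0 : ℝ) 1, |f s - f t| ≤ C * |s - t| ^ α) :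
    dimH ((fun t : ℝ => (t, f t)) '' Set.Icc (0 : ℝ) 1) ≤ ENNReal.ofReal (2 - α) := by
  set S := (fun t : ℝ => (t, f t)) '' Set.Icc (0 : ℝ) 1 with hS
  have hμ : μH[2 - α] S ≤ ENNReal.ofReal (4 * C + 4) := by
    let N : ℕ → ℝ := fun n => (n : ℝ) + 1
    have hN : ∀ n, 1 ≤ N n := fun n => by simp [N]
    -- Over a column of width 1/N the function stays within C N^(-α) of its value at the left end,
    -- so a stack of K + 1 squares of side 1/N covers that piece of the graph.
    let K : ℕ → ℕ := fun n => ⌊2 * C * N n ^ (1 - α)⌋₊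
    -- There are N + 1 = n + 2 columns, because x = 1 falls into the column with index N.
    let T : ∀ n : ℕ, Fin (n + 2) × Fin (K n + 1) → Set (ℝ × ℝ) := fun n ij =>
      Set.Icc (ij.1 / N n) (ij.1 / N n + 1 / N n) ×ˢ
        Set.Icc (f (ij.1 / N n) - C * (1 / N n) ^ α + ij.2 / N n)
          (f (ij.1 / N n) - C * (1 / N n) ^ α + ij.2 / N n + 1 / N n)
    have hT : ∀ n i, Metric.ediam (T n i) ≤ ENNReal.ofReal (1 / N n) := fun n i =>
      ediam_prod_Icc_le _ _ _
    have hcov : ∀ n, S ⊆ ⋃ i, T n i := by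
      rintro n _ ⟨x, ⟨hx0, hx1⟩, rfl⟩
      have hNp : 0 < N n := lt_of_lt_of_le one_pos (hN n)
      set i := ⌊x * N n⌋₊ with hi
      have hi1 : (i : ℝ) ≤ x * N n := Nat.floor_le (by positivity)
      have hi2 : x * N n < i + 1 := Nat.lt_floor_add_one _
      have hiN : i < n + 2 := by
        have : (i : ℝ) ≤ n + 1 := by
          have : x * N n ≤ N n := by nlinarith
          simpa [N] using hi1.trans this
        have : i ≤ n + 1 := by exact_mod_cast this
        omega
      have hix : (i : ℝ) / N n ≤ x := by rwa [div_le_iff₀ hNp]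
      have hxi : x ≤ i / N n + 1 / N n := by
        rw [← add_div, le_div_iff₀ hNp]; exact hi2.le
      have hosc := hf x ⟨hx0, hx1⟩ (i / N n) ⟨by positivity, hix.trans hx1⟩
      have hle : C * |x - i / N n| ^ α ≤ C * (1 / N n) ^ α := by
        gcongr
        rw [abs_le]; constructor
        · have : 0 ≤ 1 / N n := by positivity
          linarith
        · linarith
      have hosc' := abs_le.1 (hosc.trans hle)
      set b := f (i / N n) - C * (1 / N n) ^ α with hb
      set j := ⌊(f x - b) * N n⌋₊ with hj
      have hfb : 0 ≤ f x - b := by rw [hb]; linarith [hosc'.1]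
      have hj1 : (j : ℝ) ≤ (f x - b) * N n := Nat.floor_le (by positivity)
      have hj2 : (f x - b) * N n < j + 1 := Nat.lt_floor_add_one _
      have hjK : j ≤ K n := by
        apply Nat.floor_le_floor
        have h1 : f x - b ≤ 2 * (C * (1 / N n) ^ α) := by rw [hb]; linarith [hosc'.2]
        calc (f x - b) * N n ≤ 2 * (C * (1 / N n) ^ α) * N n := by gcongr
          _ = 2 * C * N n ^ (1 - α) := by
            rw [Real.rpow_sub hNp, Real.rpow_one, Real.div_rpow zero_le_one hNp.le, Real.one_rpow]
            ring
      refine Set.mem_iUnion.2 ⟨(⟨i, hiN⟩, ⟨j, by omega⟩), ⟨⟨hix, hxi⟩, ?_, ?_⟩⟩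
      · change b + j / N n ≤ f x
        have : (j : ℝ) / N n ≤ f x - b := by rwa [div_le_iff₀ hNp]
        linarith
      · change f x ≤ b + j / N n + 1 / N n
        have : f x - b ≤ j / N n + 1 / N n := by
          rw [← add_div, le_div_iff₀ hNp]; exact hj2.le
        linarith
    have hr : Tendsto (fun n => ENNReal.ofReal (1 / N n)) atTop (𝓝 0) := by
      rw [← ENNReal.ofReal_zero]
      exact ENNReal.tendsto_ofReal tendsto_one_div_add_atTop_nhds_zero_nat
    refine (Measure.hausdorffMeasure_le_liminf_sum (2 - α) S _ hr T
      (Eventually.of_forall hT) (Eventually.of_forall hcov)).trans ?_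
    refine liminf_le_of_le (by isBoundedDefault) fun b hb => ?_
    obtain ⟨n, hn⟩ := hb.exists
    refine hn.trans ?_
    have hNp : 0 < N n := lt_of_lt_of_le one_pos (hN n)
    calc ∑ i, Metric.ediam (T n i) ^ (2 - α)
        ≤ ∑ i : Fin (n + 2) × Fin (K n + 1), ENNReal.ofReal ((1 / N n) ^ (2 - α)) := by
          refine Finset.sum_le_sum fun i _ => ?_
          rw [← ENNReal.ofReal_rpow_of_pos (by positivity)]
          exact ENNReal.rpow_le_rpow (hT n i) (by linarith)
      _ = ENNReal.ofReal ((n + 2) * (K n + 1) * (1 / N n) ^ (2 - α)) := by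
          rw [Finset.sum_const, nsmul_eq_mul, ← ENNReal.ofReal_natCast,
            ← ENNReal.ofReal_mul (by positivity)]
          simp
      _ ≤ ENNReal.ofReal (4 * C + 4) := by
          apply ENNReal.ofReal_le_ofReal
          have h1 : (K n : ℝ) ≤ 2 * C * N n ^ (1 - α) := Nat.floor_le (by positivity)
          have h2 : (n : ℝ) + 2 ≤ 2 * N n := by simp [N]; linarith [n.cast_nonneg (α := ℝ)]
          have h3 : 1 ≤ N n ^ (1 - α) := Real.one_le_rpow (hN n) (by linarith)
          have h4 : (1 / N n) ^ (2 - α) = 1 / (N n * N n ^ (1 - α)) := by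
            rw [Real.div_rpow zero_le_one hNp.le, Real.one_rpow,
              show 2 - α = 1 + (1 - α) by ring, Real.rpow_add hNp, Real.rpow_one]
          rw [h4, mul_one_div, div_le_iff₀ (by positivity)]
          calc ((n : ℝ) + 2) * (K n + 1) ≤ (2 * N n) * (2 * C * N n ^ (1 - α) + N n ^ (1 - α)) := by
                gcongr
            _ ≤ (4 * C + 4) * (N n * N n ^ (1 - α)) := by
                have : 0 ≤ N n * N n ^ (1 - α) := by positivity
                nlinarith
  have := dimH_le_of_hausdorffMeasure_ne_top (d := (2 - α).toNNReal) (s := S) (by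
    rw [Real.coe_toNNReal _ (by linarith)]
    exact (hμ.trans_lt ENNReal.ofReal_lt_top).ne)
  exact this

/-- **Frostman's energy criterion.** A set that carries a measure of finite `γ`-energy has
Hausdorff dimension at least `γ`. -/
theorem le_dimH_of_energy {X : Type*} [MetricSpace X] [SecondCountableTopology X]
    [MeasurableSpace X] [BorelSpace X]
    (ν : Measure X) [IsFiniteMeasure ν] {S : Set X} (hνS : ν Sᶜ = 0) (hν : ν ≠ 0) {γ : ℝ≥0}
    (hγ : 0 < γ) (hE : ∫⁻ x, ∫⁻ y, edist x y ^ (-(γ : ℝ)) ∂ν ∂ν ≠ ∞) : (γ : ℝ≥0∞) ≤ dimH S := by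
  set φ : X → ℝ≥0∞ := fun x => ∫⁻ y, edist x y ^ (-(γ : ℝ)) ∂ν with hφ
  have hφm : Measurable φ := by
    apply Measurable.lintegral_prod_right
    exact (measurable_edist.pow_const _)
  have hfin : ∀ᵐ x ∂ν, φ x < ∞ := ae_lt_top hφm hE
  -- The potential `φ` is finite almost everywhere, so one of its sublevel sets has positive mass.
  -- The mass distribution principle is applied to `ν` restricted to that set.
  obtain ⟨M, hM⟩ : ∃ M : ℕ, ν {x | φ x ≤ M} ≠ 0 := by
    by_contra! hcon
    have h0 : ν (⋃ M : ℕ, {x | φ x ≤ M}) = 0 := measure_iUnion_null hcon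
    have h1 : ∀ᵐ x ∂ν, False := by
      have h2 : ∀ᵐ x ∂ν, x ∉ ⋃ M : ℕ, {x | φ x ≤ M} := measure_eq_zero_iff_ae_notMem.1 h0
      filter_upwards [hfin, h2] with x hx hx2
      obtain ⟨n, hn⟩ := ENNReal.exists_nat_gt hx.ne
      exact hx2 (Set.mem_iUnion.2 ⟨n, hn.le⟩)
    exact hν (by simpa [ae_iff, Measure.measure_univ_eq_zero] using h1)
  have hAm : MeasurableSet {x | φ x ≤ M} := measurableSet_le hφm measurable_const
  set A := {x | φ x ≤ M} with hA
  -- The kernel is positive because distances are finite, so the potential of a nonzero measure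
  -- vanishes nowhere.
  have hM0 : (M : ℝ≥0∞) ≠ 0 := by
    intro h0
    apply hM
    have : A ⊆ {x | φ x = 0} := fun x hx => by
      have hx' : φ x ≤ M := hx
      rw [h0] at hx'
      exact le_antisymm hx' zero_le
    refine measure_mono_null this ?_
    by_contra hne
    obtain ⟨x, hx⟩ := nonempty_of_measure_ne_zero hne
    have hx : φ x = 0 := hx
    rw [hφ] at hx
    rw [lintegral_eq_zero_iff (by exact (measurable_edist_right.pow_const _))] at hx
    apply hν
    have : ∀ᵐ y ∂ν, False := by
      filter_upwards [hx] with y hy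
      simp only [Pi.zero_apply, ENNReal.rpow_eq_zero_iff] at hy
      rcases hy with ⟨_, h⟩ | ⟨h, _⟩
      · have : (0 : ℝ) < γ := by exact_mod_cast hγ
        linarith
      · exact edist_ne_top _ _ h
    simpa [ae_iff, Measure.measure_univ_eq_zero] using this
  -- If x lies in s ∩ A, the kernel is at least diam(s)^(-γ) on s, so ν(s ∩ A) diam(s)^(-γ) ≤ φ(x) ≤
  -- M.
  have key : (M : ℝ≥0∞)⁻¹ • ν.restrict A ≤ μH[γ] := by
    refine Measure.le_hausdorffMeasure _ _ 1 one_pos fun s hs => ?_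
    rw [Measure.smul_apply, smul_eq_mul, Measure.restrict_apply' hAm]
    rcases (s ∩ A).eq_empty_or_nonempty with h | ⟨x, hxs, hxA⟩
    · simp [h]
    have h1 : ν (s ∩ A) * Metric.ediam s ^ (-(γ : ℝ)) ≤ M := by
      calc ν (s ∩ A) * Metric.ediam s ^ (-(γ : ℝ))
          ≤ Metric.ediam s ^ (-(γ : ℝ)) * ν {y | Metric.ediam s ^ (-(γ : ℝ)) ≤
              edist x y ^ (-(γ : ℝ))} := by
            rw [mul_comm]
            gcongr
            intro y hy
            have := Metric.edist_le_ediam_of_mem hxs hy.1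
            simp only [Set.mem_ofPred_eq, ENNReal.rpow_neg]
            gcongr
        _ ≤ φ x := mul_meas_ge_le_lintegral (measurable_edist_right.pow_const _) _
        _ ≤ M := hxA
    rw [ENNReal.rpow_neg] at h1
    rw [ENNReal.inv_mul_le_iff hM0 (ENNReal.natCast_ne_top M)]
    rw [← div_eq_mul_inv] at h1
    have htop : Metric.ediam s ^ (γ : ℝ) ≠ ∞ :=
      ENNReal.rpow_ne_top_of_nonneg γ.2 (hs.trans_lt ENNReal.one_lt_top).ne
    -- For a set of diameter zero the quotient in `h1` is infinite unless the mass is zero; this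
    -- excludes atoms in `A`.
    by_cases h0 : Metric.ediam s ^ (γ : ℝ) = 0
    · rw [h0] at h1 ⊢
      by_contra! hlt
      rw [mul_zero] at hlt
      rw [ENNReal.div_zero hlt.ne'] at h1
      exact (ENNReal.natCast_ne_top M) (top_le_iff.1 h1)
    · exact (ENNReal.div_le_iff h0 htop).1 h1
  refine le_dimH_of_hausdorffMeasure_ne_zero fun h0 => hM ?_
  have h2 := key S
  rw [h0, Measure.smul_apply, Measure.restrict_apply' hAm, smul_eq_mul, nonpos_iff_eq_zero,
    mul_eq_zero] at h2
  rcases h2 with h2 | h2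
  · simp at h2
  · refine measure_mono_null (t := (S ∩ A) ∪ Sᶜ) (fun x hx => ?_) (measure_union_null h2 hνS)
    by_cases hxS : x ∈ S
    · exact Or.inl ⟨hxS, hx⟩
    · exact Or.inr hxS

/-- Expected energy kernel of a centred Gaussian variable. -/
theorem exists_lintegral_max_rpow_gaussianReal_le {γ : ℝ} (hγ : 1 < γ) :
    ∃ K : ℝ≥0, ∀ (w : ℝ≥0) (h : ℝ), w ≠ 0 → 0 < h →
      ∫⁻ x, ENNReal.ofReal (max h |x| ^ (-γ)) ∂(gaussianReal 0 w) ≤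
        ENNReal.ofReal (K * h ^ (1 - γ) / Real.sqrt w) := by
  have hfin : ∫⁻ x : ℝ, ENNReal.ofReal ((1 + ‖x‖) ^ (-γ)) < ∞ :=
    finite_integral_one_add_norm (by simpa using hγ)
  set I := ∫⁻ x : ℝ, ENNReal.ofReal ((1 + ‖x‖) ^ (-γ)) with hI
  refine ⟨(2 ^ γ * I.toNNReal), fun w h hw hh => ?_⟩
  have hw' : (0 : ℝ) < w := by positivity
  rw [gaussianReal_of_var_ne_zero _ hw,
    lintegral_withDensity_eq_lintegral_mul _ (measurable_gaussianPDF _ _) (by fun_prop)]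
  have hpdf : ∀ x, gaussianPDF 0 w x ≤ ENNReal.ofReal (1 / Real.sqrt w) := fun x => by
    apply ENNReal.ofReal_le_ofReal
    rw [gaussianPDFReal]
    have h1 : Real.exp (-(x - 0) ^ 2 / (2 * w)) ≤ 1 := by
      rw [Real.exp_le_one_iff]
      apply div_nonpos_of_nonpos_of_nonneg
      · nlinarith [sq_nonneg (x - 0)]
      · positivity
    have h2 : (Real.sqrt (2 * Real.pi * w))⁻¹ ≤ 1 / Real.sqrt w := by
      rw [one_div]
      gcongr
      nlinarith [Real.pi_gt_three]
    calc _ ≤ (Real.sqrt (2 * Real.pi * w))⁻¹ * 1 := by gcongr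
      _ ≤ _ := by simpa using h2
  -- Since max(h, |x|) ≥ (h + |x|)/2, the kernel is dominated by an integrable profile in x/h. The
  -- substitution x = hy contributes one factor h, whence h^(1 - γ); the Gaussian density only
  -- enters through its bound 1/√w.
  have hker : ∀ x, max h |x| ^ (-γ) ≤ 2 ^ γ * h ^ (-γ) * (1 + ‖h⁻¹ * x‖) ^ (-γ) := fun x => by
    have h1 : (1 + ‖h⁻¹ * x‖) * h = h + |x| := by
      rw [norm_mul, Real.norm_eq_abs, Real.norm_eq_abs, abs_inv, abs_of_pos hh]; field_simp
    have hp : 0 < 1 + ‖h⁻¹ * x‖ := by positivity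
    rw [mul_assoc, ← Real.mul_rpow hh.le hp.le, mul_comm h, h1,
      show (2 : ℝ) ^ γ = (2⁻¹) ^ (-γ) by rw [Real.rpow_neg (by norm_num), Real.inv_rpow (by norm_num), inv_inv],
      ← Real.mul_rpow (by norm_num) (by positivity)]
    apply Real.rpow_le_rpow_of_nonpos (by positivity) _ (by linarith)
    have := le_max_left h |x|
    have := le_max_right h |x|
    linarith
  calc ∫⁻ x, (gaussianPDF 0 w * fun x => ENNReal.ofReal (max h |x| ^ (-γ))) x
      ≤ ∫⁻ x : ℝ, ENNReal.ofReal (1 / Real.sqrt w * (2 ^ γ * h ^ (-γ))) *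
          ENNReal.ofReal ((1 + ‖h⁻¹ * x‖) ^ (-γ)) := by
        refine lintegral_mono fun x => ?_
        rw [Pi.mul_apply, ENNReal.ofReal_mul (by positivity), mul_assoc,
          ← ENNReal.ofReal_mul (by positivity)]
        exact mul_le_mul' (hpdf x) (ENNReal.ofReal_le_ofReal (hker x))
    _ = ENNReal.ofReal (1 / Real.sqrt w * (2 ^ γ * h ^ (-γ))) * (ENNReal.ofReal h * I) := by
        rw [lintegral_const_mul _ (by fun_prop)]
        congr 1
        have h1 := Real.map_volume_mul_left (inv_ne_zero hh.ne')
        rw [inv_inv, abs_of_pos hh] at h1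
        rw [hI, ← smul_eq_mul (ENNReal.ofReal h), ← lintegral_smul_measure, ← h1,
          lintegral_map (by fun_prop) (by fun_prop)]
    _ = _ := by
        have hIe : I = ENNReal.ofReal I.toReal := (ENNReal.ofReal_toReal hfin.ne).symm
        nth_rewrite 1 [hIe]
        rw [← ENNReal.ofReal_mul hh.le, ← ENNReal.ofReal_mul (by positivity)]
        congr 1
        rw [Real.rpow_sub hh, Real.rpow_one, Real.rpow_neg hh.le]
        push_cast
        change _ = 2 ^ γ * I.toReal * _ / _
        field_simp


/-! ### Dyadic chaining and Kolmogorov's continuity theorem -/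

/-- The point `⌊2 ^ n t⌋ / 2 ^ n` of the dyadic grid of level `n` just below `t`. -/
noncomputable def dyadicFloor (n : ℕ) (t : ℝ) : ℝ := ⌊2 ^ n * t⌋₊ / 2 ^ n

theorem dyadicFloor_mem {n : ℕ} {t : ℝ} (ht : t ∈ Set.Icc (0 : ℝ) 1) :
    dyadicFloor n t ∈ Set.Icc (0 : ℝ) 1 := by
  have h1 : (⌊2 ^ n * t⌋₊ : ℝ) ≤ 2 ^ n * t := Nat.floor_le (mul_nonneg (by positivity) ht.1)
  refine ⟨by unfold dyadicFloor; positivity, ?_⟩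
  rw [dyadicFloor, div_le_one (by positivity)]
  have : (0 : ℝ) < 2 ^ n := by positivity
  nlinarith [ht.2]

theorem abs_dyadicFloor_sub_le {n : ℕ} {t : ℝ} (ht : t ∈ Set.Icc (0 : ℝ) 1) :
    |dyadicFloor n t - t| ≤ (1 / 2) ^ n := by
  have h1 : (⌊2 ^ n * t⌋₊ : ℝ) ≤ 2 ^ n * t := Nat.floor_le (mul_nonneg (by positivity) ht.1)
  have h2 : 2 ^ n * t < ⌊2 ^ n * t⌋₊ + 1 := Nat.lt_floor_add_one _
  have hp : (0 : ℝ) < 2 ^ n := by positivity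
  have h3 : dyadicFloor n t ≤ t := by
    rw [dyadicFloor, div_le_iff₀ hp]; linarith
  rw [abs_sub_comm, abs_of_nonneg (by linarith), dyadicFloor, one_div_pow,
    sub_le_iff_le_add, ← add_div, le_div_iff₀ hp]
  linarith

/-- Increments of `x` over neighbouring dyadic points control `x` along dyadic approximations. -/
theorem abs_sub_le_of_floor_le_succ {x : ℝ → ℝ} {K ρ : ℝ} (hK : 0 ≤ K) (hρ0 : 0 ≤ ρ)
    (hx : ∀ n k : ℕ, k < 2 ^ n → |x ((k + 1) / 2 ^ n) - x (k / 2 ^ n)| ≤ K * ρ ^ n)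
    {n i j : ℕ} (hij : i ≤ j) (hji : j ≤ i + 1) (hj : j ≤ 2 ^ n) :
    |x (j / 2 ^ n) - x (i / 2 ^ n)| ≤ K * ρ ^ n := by
  rcases Nat.eq_or_lt_of_le hij with rfl | h
  · simp; positivity
  · obtain rfl : j = i + 1 := by omega
    simpa using hx n i (by omega)

theorem floor_two_pow_le {n : ℕ} {t : ℝ} (ht : t ∈ Set.Icc (0 : ℝ) 1) :
    ⌊2 ^ n * t⌋₊ ≤ 2 ^ n := by
  apply Nat.floor_le_of_le
  push_cast
  have : (0 : ℝ) < 2 ^ n := by positivity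
  nlinarith [ht.2]

/-- The approximation of level n is also a grid point of level n + 1, with index 2⌊2^n t⌋, and
⌊2^(n+1) t⌋ exceeds this index by at most one. -/
theorem dist_dyadicFloor_succ_le {x : ℝ → ℝ} {K ρ : ℝ} (hK : 0 ≤ K) (hρ0 : 0 ≤ ρ) (hρ1 : ρ ≤ 1)
    (hx : ∀ n k : ℕ, k < 2 ^ n → |x ((k + 1) / 2 ^ n) - x (k / 2 ^ n)| ≤ K * ρ ^ n)
    {t : ℝ} (ht : t ∈ Set.Icc (0 : ℝ) 1) (n : ℕ) :
    dist (x (dyadicFloor n t)) (x (dyadicFloor (n + 1) t)) ≤ K * ρ ^ n := by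
  have ht0 := ht.1
  have h1 : (⌊2 ^ n * t⌋₊ : ℝ) ≤ 2 ^ n * t := Nat.floor_le (by positivity)
  have h2 : 2 ^ n * t < ⌊2 ^ n * t⌋₊ + 1 := Nat.lt_floor_add_one _
  have e : dyadicFloor n t = ((2 * ⌊2 ^ n * t⌋₊ : ℕ) : ℝ) / 2 ^ (n + 1) := by
    rw [dyadicFloor, pow_succ]; push_cast; field_simp
  rw [dist_comm, Real.dist_eq, e, dyadicFloor]
  refine (abs_sub_le_of_floor_le_succ hK hρ0 hx ?_ ?_ (floor_two_pow_le ht)).trans ?_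
  · apply Nat.le_floor
    push_cast
    rw [pow_succ]; linarith
  · rw [← Nat.lt_succ_iff, Nat.floor_lt (by positivity)]
    push_cast
    rw [pow_succ]; linarith
  · gcongr K * ?_
    exact pow_le_pow_of_le_one hρ0 hρ1 (by omega)

/-- **Chaining.** If the increments of `x` over neighbouring dyadic points of level `n` are at most
`K 2 ^ (-nα)`, then the limit along dyadic approximations is `α`-Hölder on `[0, 1]`. -/
theorem exists_holder_of_dyadic_increments {x : ℝ → ℝ} {K α : ℝ} (hK : 0 ≤ K) (hα : 0 < α)
    (hx : ∀ n k : ℕ, k < 2 ^ n →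
      |x ((k + 1) / 2 ^ n) - x (k / 2 ^ n)| ≤ K * ((1 / 2) ^ α) ^ n) :
    ∃ y : ℝ → ℝ, (∀ t ∈ Set.Icc (0 : ℝ) 1,
        Tendsto (fun n => x (dyadicFloor n t)) atTop (𝓝 (y t))) ∧
      ∃ C, 0 ≤ C ∧ ∀ s ∈ Set.Icc (0 : ℝ) 1, ∀ t ∈ Set.Icc (0 : ℝ) 1,
        |y s - y t| ≤ C * |s - t| ^ α := by
  set ρ : ℝ := (1 / 2) ^ α with hρ
  have hρ0 : 0 < ρ := by positivity
  have hρ1 : ρ < 1 := Real.rpow_lt_one (by norm_num) (by norm_num) hα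
  have hlim : ∀ t : ℝ, ∃ y, t ∈ Set.Icc (0 : ℝ) 1 →
      Tendsto (fun n => x (dyadicFloor n t)) atTop (𝓝 y) := fun t => by
    by_cases ht : t ∈ Set.Icc (0 : ℝ) 1
    · obtain ⟨y, hy⟩ := cauchySeq_tendsto_of_complete (cauchySeq_of_le_geometric ρ K hρ1
        (dist_dyadicFloor_succ_le hK hρ0.le hρ1.le hx ht))
      exact ⟨y, fun _ => hy⟩
    · exact ⟨0, fun h => absurd h ht⟩
  choose y hy using hlim
  -- Two geometric tails, from s and t to their dyadic floors, and one increment between these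
  -- floors; 2^α pays for replacing 2^(-n) by t - s.
  refine ⟨y, hy, (2 * (K / (1 - ρ)) + K) * 2 ^ α, ?_, ?_⟩
  · have : 0 < 1 - ρ := by linarith
    positivity
  have happ : ∀ t ∈ Set.Icc (0 : ℝ) 1, ∀ n,
      |x (dyadicFloor n t) - y t| ≤ K * ρ ^ n / (1 - ρ) := fun t ht n =>
    dist_le_of_le_geometric_of_tendsto ρ K hρ1
      (dist_dyadicFloor_succ_le hK hρ0.le hρ1.le hx ht) (hy t ht) n
  have main : ∀ s ∈ Set.Icc (0 : ℝ) 1, ∀ t ∈ Set.Icc (0 : ℝ) 1, s < t →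
      |y s - y t| ≤ (2 * (K / (1 - ρ)) + K) * 2 ^ α * |s - t| ^ α := by
    intro s hs t ht hst
    -- With 2^(-(n+1)) < t - s ≤ 2^(-n), the dyadic floors of s and t at level n coincide or are
    -- neighbours.
    obtain ⟨n, hn1, hn2⟩ := exists_nat_pow_near_of_lt_one (x := t - s) (y := (1 / 2 : ℝ))
      (by linarith) (by linarith [hs.1, ht.2]) (by norm_num) (by norm_num)
    have hp : (0 : ℝ) < 2 ^ n := by positivity
    have hn3 : 2 ^ n * (t - s) ≤ 1 := by
      rw [one_div_pow, le_div_iff₀ hp] at hn2; linarith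
    have hmid : |x (dyadicFloor n t) - x (dyadicFloor n s)| ≤ K * ρ ^ n := by
      have hs0 := hs.1
      refine abs_sub_le_of_floor_le_succ hK hρ0.le hx ?_ ?_ (floor_two_pow_le ht)
      · exact Nat.floor_le_floor (by gcongr)
      · have h2 : 2 ^ n * s < ⌊2 ^ n * s⌋₊ + 1 := Nat.lt_floor_add_one _
        rw [← Nat.lt_succ_iff, Nat.floor_lt (mul_nonneg hp.le ht.1)]
        push_cast
        linarith
    have h1 := abs_le.1 (happ s hs n)
    have h2 := abs_le.1 (happ t ht n)
    have h3 := abs_le.1 hmid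
    have h4 : |y s - y t| ≤ (2 * (K / (1 - ρ)) + K) * ρ ^ n := by
      have e : (2 * (K / (1 - ρ)) + K) * ρ ^ n = 2 * (K * ρ ^ n / (1 - ρ)) + K * ρ ^ n := by ring
      rw [e, abs_le]; constructor <;> linarith [h1.1, h1.2, h2.1, h2.2, h3.1, h3.2]
    refine h4.trans ?_
    rw [mul_assoc]
    have : 0 < 1 - ρ := by linarith
    gcongr
    rw [abs_sub_comm, abs_of_pos (by linarith : (0 : ℝ) < t - s), hρ,
      ← Real.mul_rpow (by norm_num) (by linarith), ← Real.rpow_natCast, ← Real.rpow_mul (by norm_num),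
      mul_comm α, Real.rpow_mul (by norm_num), Real.rpow_natCast]
    apply Real.rpow_le_rpow (by positivity) _ hα.le
    rw [pow_succ] at hn1
    linarith
  intro s hs t ht
  rcases lt_trichotomy s t with h | rfl | h
  · exact main s hs t ht h
  · simp [Real.zero_rpow hα.ne']
  · rw [abs_sub_comm, abs_sub_comm s]; exact main t ht s hs h

/-- Even moments of a centred Gaussian variable. -/
theorem exists_lintegral_enorm_pow_gaussianReal (k : ℕ) :
    ∃ c : ℝ≥0, ∀ {Ω : Type*} [MeasurableSpace Ω] (P : Measure Ω) (X : Ω → ℝ) (w : ℝ≥0),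
      HasLaw X (gaussianReal 0 w) P → ∫⁻ ω, ‖X ω‖ₑ ^ (2 * k) ∂P = c * w ^ k := by
  have hfin : ∫⁻ x, ‖x‖ₑ ^ (2 * k) ∂(gaussianReal 0 1) < ∞ := by
    have := (memLp_id_gaussianReal (μ := 0) (v := 1) (2 * k : ℕ)).2
    rcases Nat.eq_zero_or_pos k with rfl | hk
    · simp
    have h2 := lintegral_rpow_enorm_lt_top_of_eLpNorm_lt_top (by simp; omega)
      ENNReal.coe_ne_top this
    simpa [← ENNReal.rpow_natCast] using h2
  refine ⟨(∫⁻ x, ‖x‖ₑ ^ (2 * k) ∂(gaussianReal 0 1)).toNNReal, fun P X w hX => ?_⟩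
  rw [ENNReal.coe_toNNReal hfin.ne]
  have h1 : ∫⁻ ω, ‖X ω‖ₑ ^ (2 * k) ∂P = ∫⁻ x, ‖x‖ₑ ^ (2 * k) ∂(gaussianReal 0 w) := by
    rw [← hX.map_eq, lintegral_map' (by fun_prop) hX.aemeasurable]
  -- By scaling from the standard Gaussian, the constant does not depend on w.
  have h2 : gaussianReal 0 w = (gaussianReal 0 1).map (Real.sqrt w * ·) := by
    rw [gaussianReal_map_const_mul]
    congr 1
    · simp
    · ext; simp
  rw [h1, h2, lintegral_map (by fun_prop) (by fun_prop)]
  simp only [enorm_mul, mul_pow]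
  rw [lintegral_const_mul _ (by fun_prop), mul_comm]
  congr 1
  rw [pow_mul, ← enorm_pow, Real.sq_sqrt w.coe_nonneg]
  simp


/-- Convergence in probability of a sequence whose distances to the limit are centred Gaussian with
variances tending to zero. -/
theorem tendstoInMeasure_of_gaussian_sub {Ω : Type*} [MeasurableSpace Ω] {P : Measure Ω}
    {X : ℕ → Ω → ℝ} {Y : Ω → ℝ} {w : ℕ → ℝ≥0}
    (h : ∀ n, HasLaw (fun ω => X n ω - Y ω) (gaussianReal 0 (w n)) P)
    (hw : Tendsto w atTop (𝓝 0)) : TendstoInMeasure P X atTop Y := by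
  obtain ⟨c, hc⟩ := exists_lintegral_enorm_pow_gaussianReal 1
  have h1 : ∀ n, ∫⁻ ω, ‖X n ω - Y ω‖ₑ ^ (2 * 1) ∂P = c * w n ^ 1 := fun n => hc P _ _ (h n)
  refine tendstoInMeasure_of_ne_top fun ε hε hεt => ?_
  have hε2 : ε ^ 2 ≠ 0 := by simp [hε.ne']
  have hle : ∀ n, P {ω | ε ≤ edist (X n ω) (Y ω)} ≤ c * w n / ε ^ 2 := fun n => by
    rw [ENNReal.le_div_iff_mul_le (Or.inl hε2) (Or.inl (by simp [hεt]))]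
    have := h1 n
    rw [mul_one, pow_one] at this
    rw [← this, mul_comm]
    refine le_trans ?_ (mul_meas_ge_le_lintegral₀ ?_ (ε ^ 2))
    · refine mul_le_mul' le_rfl (measure_mono fun ω hω => ?_)
      have hω : ε ≤ edist (X n ω) (Y ω) := hω
      rw [edist_eq_enorm_sub] at hω
      exact pow_le_pow_left' hω 2
    · exact ((h n).aemeasurable.enorm.pow_const 2)
  refine tendsto_of_tendsto_of_tendsto_of_le_of_le tendsto_const_nhds ?_ (fun _ => zero_le) hle
  have : Tendsto (fun n => (c : ℝ≥0∞) * w n / ε ^ 2) atTop (𝓝 (c * (0 : ℝ≥0) / ε ^ 2)) := by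
    apply ENNReal.Tendsto.div_const _ (Or.inr hε2)
    apply ENNReal.Tendsto.const_mul _ (Or.inr (by simp))
    exact ENNReal.tendsto_coe.2 hw
  simpa using this

/-- **Kolmogorov's continuity theorem** for a process on `[0, 1]` with centred Gaussian increments. -/
theorem exists_holder_version {Ω : Type*} [MeasurableSpace Ω] {P : Measure Ω}
    {X : ℝ → Ω → ℝ} {w : ℝ → ℝ → ℝ≥0}
    (hX : ∀ t ∈ Set.Icc (0 : ℝ) 1, AEMeasurable (X t) P)
    (hlaw : ∀ s ∈ Set.Icc (0 : ℝ) 1, ∀ t ∈ Set.Icc (0 : ℝ) 1,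
      HasLaw (fun ω => X s ω - X t ω) (gaussianReal 0 (w s t)) P)
    {α α' C : ℝ} (hα : 0 < α) (hαα' : α < α') (hC : 0 ≤ C)
    (hw : ∀ s ∈ Set.Icc (0 : ℝ) 1, ∀ t ∈ Set.Icc (0 : ℝ) 1, (w s t : ℝ) ≤ C * |s - t| ^ (2 * α')) :
    ∃ Y : ℝ → Ω → ℝ, (∀ t, Measurable (Y t)) ∧ (∀ ω, Continuous fun t => Y t ω) ∧
      (∀ t ∈ Set.Icc (0 : ℝ) 1, Y t =ᵐ[P] X t) ∧
      ∀ ω, ∃ K, 0 ≤ K ∧ ∀ s ∈ Set.Icc (0 : ℝ) 1, ∀ t ∈ Set.Icc (0 : ℝ) 1,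
        |Y s ω - Y t ω| ≤ K * |s - t| ^ α := by
  classical
  -- a measurable modification of `X` at the points of `[0, 1]`
  let X' : ℝ → Ω → ℝ := fun t =>
    if ht : t ∈ Set.Icc (0 : ℝ) 1 then (hX t ht).mk (X t) else 0
  have hX'm : ∀ t, Measurable (X' t) := fun t => by
    by_cases ht : t ∈ Set.Icc (0 : ℝ) 1
    · simp only [X', dif_pos ht]; exact (hX t ht).measurable_mk
    · simp only [X', dif_neg ht]; exact measurable_const
  have hX'X : ∀ t ∈ Set.Icc (0 : ℝ) 1, X' t =ᵐ[P] X t := fun t ht => by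
    simp only [X', dif_pos ht]; exact (hX t ht).ae_eq_mk.symm
  have hlaw' : ∀ s ∈ Set.Icc (0 : ℝ) 1, ∀ t ∈ Set.Icc (0 : ℝ) 1,
      HasLaw (fun ω => X' s ω - X' t ω) (gaussianReal 0 (w s t)) P := fun s hs t ht =>
    (hlaw s hs t ht).congr (by
      filter_upwards [hX'X s hs, hX'X t ht] with ω h1 h2
      rw [h1, h2])
  -- the sum of the weighted moments of the dyadic increments
  obtain ⟨k, hk⟩ := exists_nat_gt (1 / (α' - α))
  -- With this k each weighted increment of level n has 2k-th moment of order at most 4^(-n), so the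
  -- 2^n increments of that level contribute 2^(-n), which is summable.
  have hk1 : 1 < k * (α' - α) := by
    rwa [div_lt_iff₀ (by linarith)] at hk
  have hk0 : 0 < k := by
    rcases Nat.eq_zero_or_pos k with rfl | h
    · simp at hk1; linarith
    · exact h
  obtain ⟨c, hc⟩ := exists_lintegral_enorm_pow_gaussianReal k
  set ρ : ℝ := (1 / 2) ^ α with hρ
  have hρ0 : 0 < ρ := by positivity
  let D : ℕ → ℕ → Ω → ℝ := fun n j ω => X' ((j + 1) / 2 ^ n) ω - X' (j / 2 ^ n) ω
  have hDm : ∀ n j, Measurable (D n j) := fun n j => (hX'm _).sub (hX'm _)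
  -- A single integrable variable dominates all weighted increments at once; where it is finite,
  -- chaining applies.
  let V : Ω → ℝ≥0∞ := fun ω => ∑' n, ∑ j ∈ Finset.range (2 ^ n),
    ‖D n j ω‖ₑ ^ (2 * k) * ENNReal.ofReal ((ρ⁻¹ ^ n) ^ (2 * k))
  have hVm : Measurable V := by
    refine Measurable.tsum fun n => Finset.measurable_sum _ fun j _ => ?_
    exact ((hDm n j).enorm.pow_const _).mul_const _
  have hgrid : ∀ n j : ℕ, j ≤ 2 ^ n → ((j : ℝ) / 2 ^ n) ∈ Set.Icc (0 : ℝ) 1 := fun n j hj => by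
    refine ⟨by positivity, ?_⟩
    rw [div_le_one (by positivity)]
    exact_mod_cast hj
  have hVint : ∫⁻ ω, V ω ∂P ≠ ∞ := by
    have hterm : ∀ n, ∀ j ∈ Finset.range (2 ^ n),
        ∫⁻ ω, ‖D n j ω‖ₑ ^ (2 * k) * ENNReal.ofReal ((ρ⁻¹ ^ n) ^ (2 * k)) ∂P ≤
          ENNReal.ofReal (c * C ^ k * (1 / 4) ^ n) := by
      intro n j hj
      have hj : j < 2 ^ n := Finset.mem_range.1 hj
      have hm1 := hgrid n (j + 1) hj
      have hm2 := hgrid n j hj.le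
      push_cast at hm1
      rw [lintegral_mul_const _ ((hDm n j).enorm.pow_const _), hc P _ _ (hlaw' _ hm1 _ hm2)]
      have hwle : (w ((j + 1) / 2 ^ n) (j / 2 ^ n) : ℝ) ≤ C * ((1 / 2) ^ n) ^ (2 * α') := by
        refine (hw _ hm1 _ hm2).trans_eq ?_
        congr 2
        rw [← sub_div, add_sub_cancel_left, one_div_pow, abs_of_pos (by positivity)]
      rw [← ENNReal.coe_pow, ← ENNReal.coe_mul, ← ENNReal.ofReal_coe_nnreal,
        ← ENNReal.ofReal_mul (by positivity)]
      apply ENNReal.ofReal_le_ofReal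
      push_cast
      calc (c : ℝ) * (w ((j + 1) / 2 ^ n) (j / 2 ^ n) : ℝ) ^ k * (ρ⁻¹ ^ n) ^ (2 * k)
          ≤ c * (C * ((1 / 2) ^ n) ^ (2 * α')) ^ k * (ρ⁻¹ ^ n) ^ (2 * k) := by gcongr
        _ = c * C ^ k * ((1 / 2) ^ n) ^ (2 * k * (α' - α)) := by
            have h2 : (0 : ℝ) < (1 / 2) ^ n := by positivity
            have e1 : ρ⁻¹ ^ n = ((1 / 2) ^ n) ^ (-α) := by
              rw [hρ, ← Real.rpow_neg (by norm_num), ← Real.rpow_natCast, ← Real.rpow_natCast,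
                ← Real.rpow_mul (by norm_num), ← Real.rpow_mul (by norm_num), mul_comm]
            rw [e1, mul_pow, ← Real.rpow_natCast (((1 / 2) ^ n) ^ (2 * α')) k,
              ← Real.rpow_natCast _ (2 * k), ← Real.rpow_mul h2.le, ← Real.rpow_mul h2.le,
              show (2 * k * (α' - α) : ℝ) = 2 * α' * k + -α * ((2 * k : ℕ) : ℝ) by push_cast; ring,
              Real.rpow_add h2]
            ring
        _ ≤ c * C ^ k * ((1 / 2) ^ n) ^ (2 : ℝ) := by
            gcongr c * C ^ k * ?_
            apply Real.rpow_le_rpow_of_exponent_ge (by positivity)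
            · exact pow_le_one₀ (by norm_num) (by norm_num)
            · linarith
        _ = c * C ^ k * (1 / 4) ^ n := by
            rw [Real.rpow_two, ← pow_mul, mul_comm n, pow_mul]; norm_num
    have hsum : Summable fun n : ℕ => c * C ^ k * (1 / 2 : ℝ) ^ n :=
      (summable_geometric_of_lt_one (by norm_num) (by norm_num)).mul_left _
    have hle : ∫⁻ ω, V ω ∂P ≤ ENNReal.ofReal (∑' n : ℕ, c * C ^ k * (1 / 2 : ℝ) ^ n) := by
      rw [lintegral_tsum fun n => by
        refine (Finset.measurable_sum _ fun j _ => ?_).aemeasurable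
        exact ((hDm n j).enorm.pow_const _).mul_const _,
        ENNReal.ofReal_tsum_of_nonneg (fun n => by positivity) hsum]
      refine ENNReal.tsum_le_tsum fun n => ?_
      rw [lintegral_finsetSum _ fun j _ => ((hDm n j).enorm.pow_const _).mul_const _]
      refine (Finset.sum_le_sum (hterm n)).trans_eq ?_
      rw [Finset.sum_const, Finset.card_range, nsmul_eq_mul, ← ENNReal.ofReal_natCast,
        ← ENNReal.ofReal_mul (by positivity)]
      congr 1
      push_cast
      rw [mul_left_comm, ← mul_pow]
      norm_num
    exact (hle.trans_lt ENNReal.ofReal_lt_top).ne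
  let G : Set Ω := {ω | V ω < ∞}
  have hGm : MeasurableSet G := measurableSet_lt hVm measurable_const
  have hGae : ∀ᵐ ω ∂P, ω ∈ G := ae_lt_top hVm hVint
  have hinc : ∀ ω ∈ G, ∃ K, 0 ≤ K ∧ ∀ n j : ℕ, j < 2 ^ n →
      |X' ((j + 1) / 2 ^ n) ω - X' (j / 2 ^ n) ω| ≤ K * ρ ^ n := by
    intro ω hω
    have hω : V ω < ∞ := hω
    -- The maximum with 1 avoids taking a root: a number that is at least 1 is bounded by its 2k-th
    -- power.
    refine ⟨max 1 (V ω).toReal, by positivity, fun n j hj => ?_⟩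
    have h1 : ‖D n j ω‖ₑ ^ (2 * k) * ENNReal.ofReal ((ρ⁻¹ ^ n) ^ (2 * k)) ≤ V ω :=
      (Finset.single_le_sum (f := fun j => ‖D n j ω‖ₑ ^ (2 * k) *
        ENNReal.ofReal ((ρ⁻¹ ^ n) ^ (2 * k))) (fun _ _ => zero_le)
        (Finset.mem_range.2 hj)).trans (ENNReal.le_tsum n)
    have h2 : (|D n j ω| * ρ⁻¹ ^ n) ^ (2 * k) ≤ (V ω).toReal := by
      have := ENNReal.toReal_mono hω.ne h1
      rwa [ENNReal.toReal_mul, ENNReal.toReal_ofReal (by positivity), ENNReal.toReal_pow,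
        toReal_enorm, Real.norm_eq_abs, ← mul_pow] at this
    have h3 : |D n j ω| * ρ⁻¹ ^ n ≤ max 1 (V ω).toReal := by
      by_contra! hlt
      have h4 : 1 ≤ |D n j ω| * ρ⁻¹ ^ n := (le_max_left _ _).trans hlt.le
      have h5 := le_self_pow₀ h4 (n := 2 * k) (by omega)
      exact absurd ((le_max_right 1 (V ω).toReal).trans_lt hlt) (not_lt.2 (h5.trans h2))
    rw [inv_pow, ← div_eq_mul_inv, div_le_iff₀ (by positivity)] at h3
    exact h3
  -- Outside `G` the path is replaced by zero, so that regularity holds for every ω and the limit is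
  -- measurable.
  have hy : ∀ ω, ∃ y : ℝ → ℝ, (∀ t ∈ Set.Icc (0 : ℝ) 1,
        Tendsto (fun n => G.indicator (X' (dyadicFloor n t)) ω) atTop (𝓝 (y t))) ∧
      ∃ C, 0 ≤ C ∧ ∀ s ∈ Set.Icc (0 : ℝ) 1, ∀ t ∈ Set.Icc (0 : ℝ) 1,
        |y s - y t| ≤ C * |s - t| ^ α := fun ω => by
    by_cases hω : ω ∈ G
    · obtain ⟨K, hK, hK'⟩ := hinc ω hω
      simpa only [Set.indicator_of_mem hω] using
        exists_holder_of_dyadic_increments (x := fun t => X' t ω) hK hα hK'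
    · refine ⟨0, fun t _ => ?_, 0, le_rfl, by simp⟩
      simp [Set.indicator_of_notMem hω]
  choose y hylim hyhol using hy
  have hproj : ∀ t : ℝ, (Set.projIcc (0 : ℝ) 1 zero_le_one t : ℝ) ∈ Set.Icc (0 : ℝ) 1 :=
    fun t => Subtype.coe_prop _
  -- Projecting the time to [0, 1] extends the paths continuously to the whole line.
  refine ⟨fun t ω => y ω (Set.projIcc 0 1 zero_le_one t), fun t => ?_, fun ω => ?_,
    fun t ht => ?_, fun ω => ?_⟩
  · refine measurable_of_tendsto_metrizable
      (f := fun n => G.indicator (X' (dyadicFloor n (Set.projIcc 0 1 zero_le_one t))))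
      (fun n => (hX'm _).indicator hGm) ?_
    rw [tendsto_pi_nhds]
    exact fun ω => hylim ω _ (hproj t)
  · obtain ⟨K, hK, hK'⟩ := hyhol ω
    have hcont : ContinuousOn (y ω) (Set.Icc 0 1) := by
      intro s hs
      rw [ContinuousWithinAt, tendsto_iff_dist_tendsto_zero]
      have hz : Tendsto (fun t => K * |t - s| ^ α) (𝓝[Set.Icc 0 1] s) (𝓝 0) := by
        have : Continuous fun t : ℝ => K * |t - s| ^ α := by
          refine continuous_const.mul (Continuous.rpow_const (by fun_prop) fun _ => Or.inr hα.le)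
        have := (this.tendsto s).mono_left (nhdsWithin_le_nhds (s := Set.Icc 0 1))
        simpa [Real.zero_rpow hα.ne'] using this
      refine squeeze_zero' (Eventually.of_forall fun _ => dist_nonneg) ?_ hz
      filter_upwards [self_mem_nhdsWithin] with t ht
      exact hK' t ht s hs
    exact hcont.comp_continuous (continuous_subtype_val.comp continuous_projIcc) hproj
  · have hpt : (Set.projIcc (0 : ℝ) 1 zero_le_one t : ℝ) = t := by
      rw [Set.projIcc_of_mem zero_le_one ht]
    simp only [hpt]
    -- The values at the dyadic approximations converge to y almost surely and to X'(t) in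
    -- probability; along a subsequence the two limits are identified.
    have hm : TendstoInMeasure P (fun n => X' (dyadicFloor n t)) atTop (X' t) := by
      refine tendstoInMeasure_of_gaussian_sub (w := fun n => w (dyadicFloor n t) t)
        (fun n => hlaw' _ (dyadicFloor_mem ht) _ ht) ?_
      rw [← NNReal.tendsto_coe]
      have hle : ∀ n, (w (dyadicFloor n t) t : ℝ) ≤ C * ((1 / 2) ^ (2 * α')) ^ n := fun n => by
        refine (hw _ (dyadicFloor_mem ht) _ ht).trans ?_
        rw [Real.rpow_pow_comm (by norm_num)]
        gcongr
        · linarith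
        · exact abs_dyadicFloor_sub_le ht
      refine squeeze_zero (fun n => NNReal.coe_nonneg _) hle ?_
      have := tendsto_pow_atTop_nhds_zero_of_lt_one (r := ((1 / 2 : ℝ) ^ (2 * α')))
        (by positivity) (Real.rpow_lt_one (by norm_num) (by norm_num) (by linarith))
      simpa using this.const_mul C
    obtain ⟨ns, hns, hns'⟩ := hm.exists_seq_tendsto_ae
    filter_upwards [hns', hGae, hX'X t ht] with ω h1 h2 h3
    have h4 := (hylim ω t ht).comp hns.tendsto_atTop
    simp only [Set.indicator_of_mem h2] at h4
    rw [← h3]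
    exact tendsto_nhds_unique h4 h1
  · obtain ⟨K, hK, hK'⟩ := hyhol ω
    refine ⟨K, hK, fun s hs t ht => ?_⟩
    have e : ∀ t ∈ Set.Icc (0 : ℝ) 1, (Set.projIcc (0 : ℝ) 1 zero_le_one t : ℝ) = t :=
      fun t ht => by rw [Set.projIcc_of_mem zero_le_one ht]
    simp only [e s hs, e t ht]
    exact hK' s hs t ht

/-- Two continuous versions agree almost surely at all times. -/
theorem ae_forall_eq_of_continuousVersion {Ω : Type*} [MeasurableSpace Ω] {P : Measure Ω}
    {X Y Y' : ℝ → Ω → ℝ} (hY : IsContinuousVersion P X Y) (hY' : IsContinuousVersion P X Y') :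
    ∀ᵐ ω ∂P, ∀ t ∈ Set.Icc (0 : ℝ) 1, Y t ω = Y' t ω := by
  have h1 : ∀ᵐ ω ∂P, ∀ n : ℕ, ∀ k : Fin (2 ^ n + 1),
      Y ((k : ℕ) / 2 ^ n) ω = Y' ((k : ℕ) / 2 ^ n) ω := by
    rw [ae_all_iff]; intro n
    rw [ae_all_iff]; intro k
    have hk : ((k : ℕ) / 2 ^ n : ℝ) ∈ Set.Icc (0 : ℝ) 1 := by
      refine ⟨by positivity, ?_⟩
      rw [div_le_one (by positivity)]
      exact_mod_cast Nat.lt_succ_iff.1 k.2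
    exact (hY.1 _ hk).trans (hY'.1 _ hk).symm
  filter_upwards [h1, hY.2, hY'.2] with ω h2 h3 h4 t ht
  have hlim : Tendsto (fun n => dyadicFloor n t) atTop (𝓝[Set.Icc 0 1] t) := by
    rw [tendsto_nhdsWithin_iff]
    refine ⟨?_, Eventually.of_forall fun n => dyadicFloor_mem ht⟩
    rw [tendsto_iff_dist_tendsto_zero]
    exact squeeze_zero (fun _ => dist_nonneg) (fun n => abs_dyadicFloor_sub_le ht)
      (tendsto_pow_atTop_nhds_zero_of_lt_one (by norm_num) (by norm_num))
  have h5 := (h3 t ht).tendsto.comp hlim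
  have h6 := (h4 t ht).tendsto.comp hlim
  refine tendsto_nhds_unique h5 (h6.congr fun n => ?_)
  exact (h2 n ⟨_, Nat.lt_succ_iff.2 (floor_two_pow_le ht)⟩).symm


/-! ### Dimension of the graph of a process with Gaussian increments -/

theorem lintegral_Icc_abs_rpow_lt_top {κ : ℝ} (hκ : κ < 1) :
    ∫⁻ x in Set.Icc (-1 : ℝ) 1, ENNReal.ofReal (|x| ^ (-κ)) < ∞ := by
  have h1 : ∫⁻ x in Set.Ioc (0 : ℝ) 1, ENNReal.ofReal (|x| ^ (-κ)) < ∞ := by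
    have h := (intervalIntegral.intervalIntegrable_rpow' (a := 0) (b := 1) (r := -κ)
      (by linarith)).1
    have h2 := h.lintegral_lt_top
    refine lt_of_le_of_lt (setLIntegral_mono_ae' measurableSet_Ioc ?_) h2
    refine Eventually.of_forall fun x hx => ?_
    rw [abs_of_pos hx.1]
  have h2 : ∫⁻ x in Neg.neg ⁻¹' (Set.Ioc (0 : ℝ) 1), ENNReal.ofReal (|x| ^ (-κ)) < ∞ := by
    have := (Measure.measurePreserving_neg (volume : Measure ℝ)).setLIntegral_comp_preimage
      (s := Set.Ioc 0 1) measurableSet_Ioc (f := fun x => ENNReal.ofReal (|x| ^ (-κ)))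
      (by fun_prop)
    simp only [abs_neg] at this
    rwa [this]
  have h3 : ∫⁻ x in ({0} : Set ℝ), ENNReal.ofReal (|x| ^ (-κ)) = 0 := by
    rw [setLIntegral_measure_zero]; simp
  have hsub : Set.Icc (-1 : ℝ) 1 ⊆ (Set.Ioc 0 1 ∪ Neg.neg ⁻¹' (Set.Ioc (0 : ℝ) 1)) ∪ {0} := by
    intro x hx
    rcases lt_trichotomy x 0 with h | h | h
    · exact Or.inl (Or.inr ⟨by linarith, by linarith [hx.1]⟩)
    · exact Or.inr h
    · exact Or.inl (Or.inl ⟨h, hx.2⟩)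
  calc _ ≤ ∫⁻ x in (Set.Ioc 0 1 ∪ Neg.neg ⁻¹' (Set.Ioc (0 : ℝ) 1)) ∪ {0},
        ENNReal.ofReal (|x| ^ (-κ)) := lintegral_mono_set hsub
    _ ≤ _ := (lintegral_union_le _ _ _).trans (add_le_add_left (lintegral_union_le _ _ _) _)
    _ < ∞ := by
      rw [h3, add_zero]; exact ENNReal.add_lt_top.2 ⟨h1, h2⟩

theorem lintegral_Icc_lintegral_Icc_abs_sub_rpow_lt_top {κ : ℝ} (hκ : κ < 1) :
    ∫⁻ s in Set.Icc (0 : ℝ) 1, ∫⁻ t in Set.Icc (0 : ℝ) 1, ENNReal.ofReal (|s - t| ^ (-κ)) < ∞ := by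
  set M := ∫⁻ x in Set.Icc (-1 : ℝ) 1, ENNReal.ofReal (|x| ^ (-κ)) with hM
  have h1 : ∀ s ∈ Set.Icc (0 : ℝ) 1,
      ∫⁻ t in Set.Icc (0 : ℝ) 1, ENNReal.ofReal (|s - t| ^ (-κ)) ≤ M := by
    intro s hs
    have := (Measure.measurePreserving_sub_left (volume : Measure ℝ) s).setLIntegral_comp_preimage
      (s := Set.Icc (-1) 1) measurableSet_Icc (f := fun x => ENNReal.ofReal (|x| ^ (-κ)))
      (by fun_prop)
    rw [hM, ← this]
    apply lintegral_mono_set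
    intro t ht
    exact ⟨by linarith [hs.1, ht.2], by linarith [hs.2, ht.1]⟩
  calc _ ≤ ∫⁻ _ in Set.Icc (0 : ℝ) 1, M := setLIntegral_mono' measurableSet_Icc h1
    _ = M := by simp
    _ < ∞ := lintegral_Icc_abs_rpow_lt_top hκ

/-- The lower bound for the dimension of the graph of a continuous process with centred Gaussian
increments. -/
theorem ae_le_dimH_graph {Ω : Type*} [MeasurableSpace Ω] {P : Measure Ω} [IsProbabilityMeasure P]
    {Y : ℝ → Ω → ℝ} (hYm : ∀ t, Measurable (Y t)) (hYc : ∀ ω, Continuous fun t => Y t ω)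
    {w : ℝ → ℝ → ℝ≥0}
    (hlaw : ∀ s ∈ Set.Icc (0 : ℝ) 1, ∀ t ∈ Set.Icc (0 : ℝ) 1,
      HasLaw (fun ω => Y s ω - Y t ω) (gaussianReal 0 (w s t)) P)
    {α c : ℝ} (hc : 0 < c)
    (hw : ∀ s ∈ Set.Icc (0 : ℝ) 1, ∀ t ∈ Set.Icc (0 : ℝ) 1, c * |s - t| ^ (2 * α) ≤ (w s t : ℝ))
    {γ : ℝ≥0} (hγ : 1 < γ) (hγα : γ < 2 - α) :
    ∀ᵐ ω ∂P, (γ : ℝ≥0∞) ≤ dimH ((fun t : ℝ => (t, Y t ω)) '' Set.Icc (0 : ℝ) 1) := by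
  have hγ1 : (1 : ℝ) < γ := by exact_mod_cast hγ
  set m : Measure ℝ := volume.restrict (Set.Icc 0 1) with hm
  let G : Ω → ℝ × ℝ → ℝ≥0∞ := fun ω z => edist (z.1, Y z.1 ω) (z.2, Y z.2 ω) ^ (-(γ : ℝ))
  have hYu : Measurable (Function.uncurry Y) := measurable_uncurry_of_continuous_of_measurable hYc hYm
  have hGm : Measurable (Function.uncurry G) := by
    have h1 : Measurable fun p : Ω × (ℝ × ℝ) => Y p.2.1 p.1 :=
      hYu.comp (measurable_snd.fst.prodMk measurable_fst)
    have h2 : Measurable fun p : Ω × (ℝ × ℝ) => Y p.2.2 p.1 :=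
      hYu.comp (measurable_snd.snd.prodMk measurable_fst)
    exact ((measurable_snd.fst.prodMk h1).edist (measurable_snd.snd.prodMk h2)).pow_const _
  obtain ⟨K, hK⟩ := exists_lintegral_max_rpow_gaussianReal_le hγ1
  -- The kernel estimate with h = |s - t| and standard deviation at least √c |s - t|^α. The
  -- resulting exponent γ + α - 1 is below 1 because γ < 2 - α.
  have hpair : ∀ s ∈ Set.Icc (0 : ℝ) 1, ∀ t ∈ Set.Icc (0 : ℝ) 1, s ≠ t →
      ∫⁻ ω, G ω (s, t) ∂P ≤ ENNReal.ofReal (K / Real.sqrt c) *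
        ENNReal.ofReal (|s - t| ^ (-(γ + α - 1))) := by
    intro s hs t ht hst
    have hd : 0 < |s - t| := abs_pos.2 (sub_ne_zero.2 hst)
    have hwpos : 0 < c * |s - t| ^ (2 * α) := by positivity
    have hw0 : w s t ≠ 0 := by
      intro h0
      have := hw s hs t ht
      rw [h0] at this
      exact absurd this (not_le.2 hwpos)
    have e : ∀ ω, G ω (s, t) = ENNReal.ofReal (max |s - t| |Y s ω - Y t ω| ^ (-(γ : ℝ))) := by
      intro ω
      rw [← ENNReal.ofReal_rpow_of_pos (lt_max_of_lt_left hd)]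
      simp only [G, edist_dist]
      rfl
    calc ∫⁻ ω, G ω (s, t) ∂P
        = ∫⁻ x, ENNReal.ofReal (max |s - t| |x| ^ (-(γ : ℝ))) ∂(gaussianReal 0 (w s t)) := by
          simp_rw [e]
          rw [← (hlaw s hs t ht).map_eq,
            lintegral_map' (by fun_prop) (hlaw s hs t ht).aemeasurable]
      _ ≤ ENNReal.ofReal (K * |s - t| ^ (1 - (γ : ℝ)) / Real.sqrt (w s t)) := hK _ _ hw0 hd
      _ ≤ _ := by
          rw [← ENNReal.ofReal_mul (by positivity)]
          apply ENNReal.ofReal_le_ofReal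
          have h1 : Real.sqrt c * |s - t| ^ α ≤ Real.sqrt (w s t) := by
            apply Real.le_sqrt_of_sq_le
            rw [mul_pow, Real.sq_sqrt hc.le, ← Real.rpow_natCast, ← Real.rpow_mul hd.le, mul_comm α]
            exact_mod_cast hw s hs t ht
          calc _ ≤ K * |s - t| ^ (1 - (γ : ℝ)) / (Real.sqrt c * |s - t| ^ α) := by gcongr
            _ = _ := by
              rw [show -((γ : ℝ) + α - 1) = 1 - γ - α by ring, Real.rpow_sub hd (1 - γ)]
              field_simp
  have hfin : ∫⁻ ω, ∫⁻ z, G ω z ∂(m.prod m) ∂P ≠ ∞ := by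
    rw [lintegral_lintegral_swap hGm.aemeasurable]
    rw [lintegral_prod (fun z => ∫⁻ ω, G ω z ∂P) (hGm.lintegral_prod_left').aemeasurable]
    have hle : ∫⁻ s, ∫⁻ t, ∫⁻ ω, G ω (s, t) ∂P ∂m ∂m ≤
        ∫⁻ s, ∫⁻ t, ENNReal.ofReal (K / Real.sqrt c) *
          ENNReal.ofReal (|s - t| ^ (-(γ + α - 1))) ∂m ∂m := by
      refine setLIntegral_mono' measurableSet_Icc fun s hs => ?_
      refine setLIntegral_mono_ae' measurableSet_Icc ?_
      -- The diagonal, where the energy kernel is infinite, is a null set.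
      have : ∀ᵐ t : ℝ, t ≠ s := by simp [ae_iff]
      filter_upwards [this] with t ht hti
      exact hpair s hs t hti ht.symm
    refine (hle.trans_lt ?_).ne
    have hmeas : Measurable fun z : ℝ × ℝ => ENNReal.ofReal (|z.1 - z.2| ^ (-((γ : ℝ) + α - 1))) := by
      fun_prop
    simp_rw [lintegral_const_mul' _ _ ENNReal.ofReal_ne_top]
    exact ENNReal.mul_lt_top ENNReal.ofReal_lt_top
      (lintegral_Icc_lintegral_Icc_abs_sub_rpow_lt_top (by linarith))
  have hae := ae_lt_top hGm.lintegral_prod_right' hfin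
  filter_upwards [hae] with ω hω
  have hgm : Measurable fun t : ℝ => (t, Y t ω) := measurable_id.prodMk (hYc ω).measurable
  set g : ℝ → ℝ × ℝ := fun t : ℝ => (t, Y t ω) with hg
  have hScl : IsCompact (g '' Set.Icc 0 1) :=
    isCompact_Icc.image (continuous_id.prodMk (hYc ω))
  -- The measure of finite energy is the image of Lebesgue measure on [0, 1] under the graph map.
  refine le_dimH_of_energy (m.map g) ?_ ?_ (zero_lt_one.trans hγ) ?_
  · rw [Measure.map_apply hgm hScl.measurableSet.compl, hm,
      Measure.restrict_apply (hgm hScl.measurableSet.compl)]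
    have : g ⁻¹' (g '' Set.Icc 0 1)ᶜ ∩ Set.Icc 0 1 = ∅ := by
      ext t
      simp only [Set.mem_inter_iff, Set.mem_preimage, Set.mem_compl_iff, Set.mem_empty_iff_false,
        iff_false, not_and]
      intro h1 h2
      exact h1 ⟨t, h2, rfl⟩
    rw [this, measure_empty]
  · intro h0
    have h1 : m.map g Set.univ = 0 := by rw [h0]; simp
    rw [Measure.map_apply hgm MeasurableSet.univ] at h1
    simp [hm] at h1
  · have h2 : Measurable fun z : (ℝ × ℝ) × (ℝ × ℝ) => edist z.1 z.2 ^ (-(γ : ℝ)) :=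
      measurable_edist.pow_const _
    have h3 : ∫⁻ x, ∫⁻ y, edist x y ^ (-(γ : ℝ)) ∂(m.map g) ∂(m.map g) =
        ∫⁻ z, G ω z ∂(m.prod m) := by
      rw [lintegral_map h2.lintegral_prod_right' hgm, lintegral_prod]
      · refine lintegral_congr fun s => ?_
        rw [lintegral_map (measurable_edist_right.pow_const _) hgm]
      · exact (hGm.comp (measurable_const.prodMk measurable_id)).aemeasurable
    rw [h3]
    exact hω.ne

/-- The projection to the time axis is Lipschitz and maps the graph onto [0, 1]. This covers the
case h = 1, where the energy method leaves no admissible γ > 1. -/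
theorem one_le_dimH_graph (f : ℝ → ℝ) :
    1 ≤ dimH ((fun t : ℝ => (t, f t)) '' Set.Icc (0 : ℝ) 1) := by
  have h1 := LipschitzWith.prod_fst.dimH_image_le
    ((fun t : ℝ => (t, f t)) '' Set.Icc (0 : ℝ) 1)
  rw [Set.image_image] at h1
  have h2 : dimH (Set.Icc (0 : ℝ) 1) = 1 := by
    have := Real.dimH_of_nonempty_interior (E := ℝ) (s := Set.Icc (0 : ℝ) 1) (by simp)
    simpa using this
  simpa [h2] using h1

/-- **The graph of a process with centred Gaussian increments** whose variances behave like
`|t - s| ^ (2 h)` up to arbitrarily small powers has dimension `2 - h`. -/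
theorem graphHasDimension_of_gaussian_increments {Ω : Type*} [MeasurableSpace Ω] {P : Measure Ω}
    [IsProbabilityMeasure P] {X : ℝ → Ω → ℝ} {w : ℝ → ℝ → ℝ≥0}
    (hX : ∀ t ∈ Set.Icc (0 : ℝ) 1, AEMeasurable (X t) P)
    (hlaw : ∀ s ∈ Set.Icc (0 : ℝ) 1, ∀ t ∈ Set.Icc (0 : ℝ) 1,
      HasLaw (fun ω => X s ω - X t ω) (gaussianReal 0 (w s t)) P)
    {h : ℝ} (h0 : 0 < h) (h1 : h ≤ 1)
    (hup : ∀ α, 0 < α → α < h → ∃ C, 0 ≤ C ∧ ∀ s ∈ Set.Icc (0 : ℝ) 1, ∀ t ∈ Set.Icc (0 : ℝ) 1,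
      (w s t : ℝ) ≤ C * |s - t| ^ (2 * α))
    (hlo : ∀ α, h < α → ∃ c, 0 < c ∧ ∀ s ∈ Set.Icc (0 : ℝ) 1, ∀ t ∈ Set.Icc (0 : ℝ) 1,
      c * |s - t| ^ (2 * α) ≤ (w s t : ℝ)) :
    GraphHasDimension P X (2 - h) := by
  have hver : ∀ α, 0 < α → α < h → ∃ Y : ℝ → Ω → ℝ, (∀ t, Measurable (Y t)) ∧
      (∀ ω, Continuous fun t => Y t ω) ∧ (∀ t ∈ Set.Icc (0 : ℝ) 1, Y t =ᵐ[P] X t) ∧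
      ∀ ω, ∃ K, 0 ≤ K ∧ ∀ s ∈ Set.Icc (0 : ℝ) 1, ∀ t ∈ Set.Icc (0 : ℝ) 1,
        |Y s ω - Y t ω| ≤ K * |s - t| ^ α := fun α hα hαh => by
    obtain ⟨C, hC, hC'⟩ := hup ((α + h) / 2) (by linarith) (by linarith)
    exact exists_holder_version hX hlaw hα (by linarith) hC hC'
  obtain ⟨Y₀, hY₀m, hY₀c, hY₀X, -⟩ := hver (h / 2) (by linarith) (by linarith)
  have hY₀ : IsContinuousVersion P X Y₀ := ⟨hY₀X, Eventually.of_forall fun ω => (hY₀c ω).continuousOn⟩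
  have hlim : Tendsto (fun n : ℕ => (1 : ℝ) / (n + 2)) atTop (𝓝 0) := by
    have := (tendsto_add_atTop_iff_nat 1).2 (tendsto_one_div_add_atTop_nhds_zero_nat (𝕜 := ℝ))
    refine this.congr fun n => ?_
    push_cast; ring_nf
  have hsmall : ∀ n : ℕ, 0 < (1 : ℝ) / (n + 2) ∧ (1 : ℝ) / (n + 2) < 1 := fun n => by
    refine ⟨by positivity, ?_⟩
    rw [div_lt_one (by positivity)]
    linarith [n.cast_nonneg (α := ℝ)]
  have himg : ∀ {Y : ℝ → Ω → ℝ} {Y' : ℝ → Ω → ℝ} {ω : Ω},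
      (∀ t ∈ Set.Icc (0 : ℝ) 1, Y t ω = Y' t ω) →
      (fun t : ℝ => (t, Y t ω)) '' Set.Icc (0 : ℝ) 1 =
        (fun t : ℝ => (t, Y' t ω)) '' Set.Icc (0 : ℝ) 1 := fun hYY =>
    Set.image_congr fun t ht => by rw [hYY t ht]
  refine ⟨⟨Y₀, hY₀⟩, fun Y hY => ?_⟩
  have hupper : ∀ᵐ ω ∂P, dimH ((fun t : ℝ => (t, Y t ω)) '' Set.Icc (0 : ℝ) 1) ≤
      ENNReal.ofReal (2 - h) := by
    -- The Hölder version depends on the exponent, but almost surely each of the countably many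
    -- versions coincides with `Y`; then n tends to infinity.
    have : ∀ᵐ ω ∂P, ∀ n : ℕ, dimH ((fun t : ℝ => (t, Y t ω)) '' Set.Icc (0 : ℝ) 1) ≤
        ENNReal.ofReal (2 - h * (1 - 1 / (n + 2))) := by
      rw [ae_all_iff]; intro n
      have hα0 : 0 < h * (1 - 1 / ((n : ℝ) + 2)) := mul_pos h0 (by linarith [(hsmall n).2])
      have hαh : h * (1 - 1 / ((n : ℝ) + 2)) < h := by nlinarith [(hsmall n).1]
      obtain ⟨Y', -, hY'c, hY'X, hY'h⟩ := hver _ hα0 hαh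
      filter_upwards [ae_forall_eq_of_continuousVersion hY
        ⟨hY'X, Eventually.of_forall fun ω => (hY'c ω).continuousOn⟩] with ω hω
      rw [himg hω]
      obtain ⟨K, hK, hK'⟩ := hY'h ω
      exact dimH_graph_le_of_holder hα0 (by linarith) hK hK'
    filter_upwards [this] with ω hω
    have hl : Tendsto (fun n : ℕ => 2 - h * (1 - 1 / ((n : ℝ) + 2))) atTop (𝓝 (2 - h)) := by
      simpa using ((hlim.const_sub 1).const_mul h).const_sub 2
    exact ge_of_tendsto' (ENNReal.tendsto_ofReal hl) hω
  have hlower : ∀ᵐ ω ∂P, ENNReal.ofReal (2 - h) ≤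
      dimH ((fun t : ℝ => (t, Y t ω)) '' Set.Icc (0 : ℝ) 1) := by
    rcases h1.eq_or_lt with rfl | hlt
    · refine Eventually.of_forall fun ω => ?_
      norm_num
      exact one_le_dimH_graph _
    have hlaw₀ : ∀ s ∈ Set.Icc (0 : ℝ) 1, ∀ t ∈ Set.Icc (0 : ℝ) 1,
        HasLaw (fun ω => Y₀ s ω - Y₀ t ω) (gaussianReal 0 (w s t)) P := fun s hs t ht =>
      (hlaw s hs t ht).congr (by
        filter_upwards [hY₀X s hs, hY₀X t ht] with ω h1 h2
        rw [h1, h2])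
    have : ∀ᵐ ω ∂P, ∀ n : ℕ, ENNReal.ofReal (2 - h - (1 - h) * (1 / (n + 2))) ≤
        dimH ((fun t : ℝ => (t, Y₀ t ω)) '' Set.Icc (0 : ℝ) 1) := by
      rw [ae_all_iff]; intro n
      have hs := hsmall n
      have hpos : 0 < (1 - h) * (1 / ((n : ℝ) + 2)) := mul_pos (by linarith) hs.1
      -- The target γ is 2 - h minus the gap (1 - h)/(n + 2), which keeps γ > 1; taking α above h by
      -- half the gap leaves γ < 2 - α.
      obtain ⟨c, hc, hc'⟩ := hlo (h + (1 - h) * (1 / (n + 2)) / 2) (by linarith)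
      refine ae_le_dimH_graph hY₀m hY₀c hlaw₀ hc hc' ?_ ?_
      · rw [← NNReal.coe_lt_coe, Real.coe_toNNReal']
        refine lt_max_of_lt_left ?_
        push_cast
        nlinarith [hs.2]
      · rw [Real.coe_toNNReal _ (by nlinarith [hs.2])]
        linarith
    filter_upwards [this, ae_forall_eq_of_continuousVersion hY hY₀] with ω hω hYY
    rw [himg hYY]
    have hl : Tendsto (fun n : ℕ => 2 - h - (1 - h) * (1 / ((n : ℝ) + 2))) atTop (𝓝 (2 - h)) := by
      simpa using (hlim.const_mul (1 - h)).const_sub (2 - h)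
    exact le_of_tendsto' (ENNReal.tendsto_ofReal hl) hω
  filter_upwards [hupper, hlower] with ω h1 h2
  exact le_antisymm h1 h2


/-! ### Isonormal random measures and integrals of simple functions -/

/-- An independently scattered random measure for which all `re (c Z(A))` are centred Gaussian with
variance `v |c|² |A|`. Both real and complex isotropic Gaussian random measures are of this form. -/
structure IsIsonormal {d : ℕ} {Ω 𝕜 : Type*} [MeasurableSpace Ω] [RCLike 𝕜]
    [MeasurableSpace 𝕜] (P : Measure Ω) (v : ℝ≥0) (Z : Set (EuclideanSpace ℝ (Fin d)) → Ω → 𝕜) :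
    Prop extends IsIndependentlyScattered P Z where
  law_re : ∀ A, MeasurableSet A → volume A ≠ ⊤ → ∀ c : 𝕜,
    HasLaw (fun ω => RCLike.re (c * Z A ω)) (gaussianReal 0 (v * ‖c‖₊ ^ 2 * (volume A).toNNReal)) P

theorem IsGaussianRandomMeasure.isIsonormal {d : ℕ} {Ω : Type*} [MeasurableSpace Ω]
    {P : Measure Ω} {v : ℝ≥0} {Z : Set (EuclideanSpace ℝ (Fin d)) → Ω → ℝ}
    (hZ : IsGaussianRandomMeasure P v Z) : IsIsonormal P v Z where
  toIsIndependentlyScattered := hZ.toIsIndependentlyScattered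
  law_re A hA hA' c := by
    have h := gaussianReal_const_mul (hZ.law A hA hA') c
    rw [mul_zero] at h
    convert! h using 2
    apply NNReal.eq
    simp only [NNReal.coe_mul, NNReal.coe_pow, coe_nnnorm, Real.norm_eq_abs, sq_abs]
    change _ = c ^ 2 * ((v : ℝ) * ((volume A).toNNReal : ℝ))
    ring

/-- The real part of cW(A) is Re c Re W(A) - Im c Im W(A), a sum of independent Gaussians, and the
variances add up to |c|² times the common one. -/
theorem IsIsotropicGaussianRandomMeasure.isIsonormal {d : ℕ} {Ω : Type*} [MeasurableSpace Ω]
    {P : Measure Ω} [IsProbabilityMeasure P]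
    {v : ℝ≥0} {W : Set (EuclideanSpace ℝ (Fin d)) → Ω → ℂ}
    (hW : IsIsotropicGaussianRandomMeasure P v W) : IsIsonormal P v W where
  toIsIndependentlyScattered := hW.toIsIndependentlyScattered
  law_re A hA hA' c := by
    have h := hW.law A hA hA'
    set ν := gaussianReal 0 (v * (volume A).toNNReal) with hν
    have hmeas : Measurable fun p : ℝ × ℝ => c.re * p.1 + (-c.im) * p.2 := by fun_prop
    have h1 : HasLaw (fun p : ℝ × ℝ => c.re * p.1 + (-c.im) * p.2)
        (gaussianReal 0 (v * ‖c‖₊ ^ 2 * (volume A).toNNReal)) (ν.prod ν) := by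
      have hf : HasLaw (fun p : ℝ × ℝ => c.re * p.1)
          (gaussianReal (c.re * 0) (⟨c.re ^ 2, sq_nonneg _⟩ * (v * (volume A).toNNReal)))
          (ν.prod ν) := gaussianReal_const_mul ⟨by fun_prop, by
            rw [← Measure.fst, Measure.fst_prod]⟩ c.re
      have hs : HasLaw (fun p : ℝ × ℝ => (-c.im) * p.2)
          (gaussianReal ((-c.im) * 0) (⟨(-c.im) ^ 2, sq_nonneg _⟩ * (v * (volume A).toNNReal)))
          (ν.prod ν) := gaussianReal_const_mul ⟨by fun_prop, by
            rw [← Measure.snd, Measure.snd_prod]⟩ (-c.im)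
      have hind : IndepFun (fun p : ℝ × ℝ => c.re * p.1) (fun p : ℝ × ℝ => (-c.im) * p.2)
          (ν.prod ν) := indepFun_prod (by fun_prop) (by fun_prop)
      have := gaussianReal_add_gaussianReal_of_indepFun hind hf.map_eq hs.map_eq
      refine ⟨hmeas.aemeasurable, ?_⟩
      rw [show (fun p : ℝ × ℝ => c.re * p.1 + (-c.im) * p.2) =
        (fun p : ℝ × ℝ => c.re * p.1) + (fun p : ℝ × ℝ => (-c.im) * p.2) from rfl, this]
      congr 1
      · simp
      · apply NNReal.eq
        simp only [NNReal.coe_mul, NNReal.coe_pow, coe_nnnorm, Complex.sq_norm,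
          Complex.normSq_apply]
        change c.re ^ 2 * ((v : ℝ) * ((volume A).toNNReal : ℝ)) +
          (-c.im) ^ 2 * ((v : ℝ) * ((volume A).toNNReal : ℝ)) = _
        ring
    have h2 := h1.comp h
    refine h2.congr (Eventually.of_forall fun ω => ?_)
    simp [sub_eq_add_neg]

theorem volume_preimage_ne_top_of_memLp {d : ℕ} {𝕜 : Type*} [RCLike 𝕜]
    {s : SimpleFunc (EuclideanSpace ℝ (Fin d)) 𝕜}
    (hs : MemLp s 2 volume) {c : 𝕜} (hc : c ≠ 0) : volume (s ⁻¹' {c}) ≠ ⊤ :=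
  (SimpleFunc.measure_preimage_lt_top_of_memLp (by norm_num) (by norm_num) s hs c hc).ne

theorem eLpNorm_two_sq {α E : Type*} [MeasurableSpace α] {μ : Measure α} [NormedAddCommGroup E]
    (f : α → E) : eLpNorm f 2 μ ^ 2 = ∫⁻ x, ‖f x‖ₑ ^ 2 ∂μ := by
  have := eLpNorm_nnreal_pow_eq_lintegral (f := f) (μ := μ) (p := 2) (by norm_num)
  simpa using this

theorem eLpNorm_simpleFunc_sq {d : ℕ} {𝕜 : Type*} [RCLike 𝕜]
    (s : SimpleFunc (EuclideanSpace ℝ (Fin d)) 𝕜) :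
    eLpNorm s 2 volume ^ 2 = ∑ c ∈ s.range, ‖c‖ₑ ^ 2 * volume (s ⁻¹' {c}) := by
  rw [eLpNorm_two_sq, ← SimpleFunc.map_lintegral (fun c => ‖c‖ₑ ^ 2) s,
    ← SimpleFunc.lintegral_eq_lintegral]
  rfl

section

variable {d : ℕ} {Ω 𝕜 : Type*} [MeasurableSpace Ω] [RCLike 𝕜] [MeasurableSpace 𝕜]
  {P : Measure Ω} {v : ℝ≥0}
  {Z : Set (EuclideanSpace ℝ (Fin d)) → Ω → 𝕜}

theorem IsIsonormal.ae_eq_zero (hZ : IsIsonormal P v Z) {A : Set (EuclideanSpace ℝ (Fin d))}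
    (hA : MeasurableSet A) (hA0 : volume A = 0) : Z A =ᵐ[P] 0 := by
  have h : ∀ c : 𝕜, ∀ᵐ ω ∂P, RCLike.re (c * Z A ω) = 0 := fun c => by
    have h1 := hZ.law_re A hA (by simp [hA0]) c
    have h2 : ∀ᵐ x ∂(gaussianReal 0 (v * ‖c‖₊ ^ 2 * (volume A).toNNReal)), x = 0 := by
      simp [hA0, gaussianReal_zero_var]
    rw [← h1.map_eq] at h2
    exact ae_of_ae_map h1.aemeasurable h2
  filter_upwards [h 1, h RCLike.I] with ω h1 h2
  rw [one_mul] at h1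
  apply RCLike.ext
  · simpa using h1
  · rw [RCLike.I_mul_re] at h2
    simpa using h2

/-- σ-additivity applied to the sequence A, B, ∅, ∅, …, where Z(∅) = 0 almost surely. -/
theorem IsIsonormal.ae_union (hZ : IsIsonormal P v Z) {A B : Set (EuclideanSpace ℝ (Fin d))}
    (hA : MeasurableSet A) (hB : MeasurableSet B) (hA' : volume A ≠ ⊤) (hB' : volume B ≠ ⊤)
    (hAB : Disjoint A B) : Z (A ∪ B) =ᵐ[P] fun ω => Z A ω + Z B ω := by
  let S : ℕ → Set (EuclideanSpace ℝ (Fin d)) := fun n => if n = 0 then A else if n = 1 then B else ∅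
  have hS : ⋃ n, S n = A ∪ B := by
    ext x
    simp only [Set.mem_iUnion, Set.mem_union, S]
    constructor
    · rintro ⟨n, hn⟩
      split_ifs at hn
      · exact Or.inl hn
      · exact Or.inr hn
      · simp at hn
    · rintro (h | h)
      · exact ⟨0, by simpa using h⟩
      · exact ⟨1, by simpa using h⟩
  have h1 := hZ.sigma_additive S (fun n => by simp only [S]; split_ifs <;> simp [hA, hB])
    (by rw [hS]; exact (measure_union_lt_top hA'.lt_top hB'.lt_top).ne) (by
      intro m n hmn
      simp only [Function.onFun, S]
      split_ifs <;> first | omega | simp [hAB.symm])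
  have h2 := hZ.ae_eq_zero MeasurableSet.empty measure_empty
  filter_upwards [h1, h2] with ω h3 h4
  rw [hS] at h3
  refine tendsto_nhds_unique h3 (tendsto_const_nhds.congr' ?_)
  filter_upwards [eventually_ge_atTop 2] with N hN
  obtain ⟨k, rfl⟩ := Nat.exists_eq_add_of_le hN
  have hz : ∑ i ∈ Finset.range k, Z (S (2 + i)) ω = 0 :=
    Finset.sum_eq_zero fun i _ => by
      have : S (2 + i) = ∅ := by simp only [S]; rw [if_neg (by omega), if_neg (by omega)]
      rw [this, h4]; rfl
  rw [Finset.sum_range_add, hz, Finset.sum_range_succ, Finset.sum_range_one]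
  simp [S]

theorem IsIsonormal.ae_biUnion (hZ : IsIsonormal P v Z) {ι : Type*} (F : Finset ι)
    {B : ι → Set (EuclideanSpace ℝ (Fin d))} (hB : ∀ i ∈ F, MeasurableSet (B i))
    (hB' : ∀ i ∈ F, volume (B i) ≠ ⊤) (hd : (F : Set ι).PairwiseDisjoint B) :
    Z (⋃ i ∈ F, B i) =ᵐ[P] fun ω => ∑ i ∈ F, Z (B i) ω := by
  classical
  induction F using Finset.induction_on with
  | empty => simpa using! hZ.ae_eq_zero MeasurableSet.empty measure_empty
  | insert i F hi ih =>
    have ih' := ih (fun j hj => hB j (Finset.mem_insert_of_mem hj))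
      (fun j hj => hB' j (Finset.mem_insert_of_mem hj)) (hd.subset (by simp))
    have hu := hZ.ae_union (A := B i) (B := ⋃ j ∈ F, B j) (hB i (Finset.mem_insert_self _ _))
      (F.measurableSet_biUnion fun j hj => hB j (Finset.mem_insert_of_mem hj))
      (hB' i (Finset.mem_insert_self _ _))
      (by
        refine ((measure_biUnion_finset_le F B).trans_lt ?_).ne
        exact ENNReal.sum_lt_top.2 fun j hj => (hB' j (Finset.mem_insert_of_mem hj)).lt_top)
      (by
        rw [Set.disjoint_iUnion₂_right]
        intro j hj
        refine hd (by simp) (by simp [hj]) ?_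
        rintro rfl
        exact hi hj)
    rw [Finset.set_biUnion_insert]
    filter_upwards [hu, ih'] with ω h1 h2
    rw [h1, h2, Finset.sum_insert hi]

/-- The integral of a simple function can be computed on any finer finite partition. -/
theorem IsIsonormal.simpleIntegral_map (hZ : IsIsonormal P v Z) {β : Type*}
    (p : SimpleFunc (EuclideanSpace ℝ (Fin d)) β) (g : β → 𝕜)
    (hp : ∀ b, g b ≠ 0 → volume (p ⁻¹' {b}) ≠ ⊤) :
    simpleIntegral Z (p.map g) =ᵐ[P] fun ω => ∑ b ∈ p.range, g b * Z (p ⁻¹' {b}) ω := by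
  classical
  -- Only nonzero values matter: the level set of 0 may have infinite measure, where `Z` is
  -- uncontrolled, but its coefficient vanishes.
  have h : ∀ c ∈ (p.map g).range, c ≠ 0 →
      Z (p.map g ⁻¹' {c}) =ᵐ[P] fun ω => ∑ b ∈ p.range with g b = c, Z (p ⁻¹' {b}) ω := by
    intro c _ hc0
    have hset : p.map g ⁻¹' {c} = ⋃ b ∈ p.range.filter (fun b => g b = c), p ⁻¹' {b} := by
      rw [SimpleFunc.map_preimage_singleton]
      ext x
      simp
    rw [hset]
    refine hZ.ae_biUnion _ (fun b _ => p.measurableSet_preimage _) (fun b hb => ?_) ?_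
    · exact hp b (by rw [(Finset.mem_filter.1 hb).2]; exact hc0)
    · intro b _ b' _ hbb'
      exact Disjoint.preimage _ (by simpa using hbb')
  have h' : ∀ᵐ ω ∂P, ∀ c ∈ (p.map g).range, c ≠ 0 →
      Z (p.map g ⁻¹' {c}) ω = ∑ b ∈ p.range with g b = c, Z (p ⁻¹' {b}) ω := by
    refine (eventually_all_finset _).2 fun c hc => ?_
    by_cases hc0 : c = 0
    · exact Eventually.of_forall fun ω h => absurd hc0 h
    · filter_upwards [h c hc hc0] with ω hω _ using hω
  filter_upwards [h'] with ω hω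
  rw [simpleIntegral]
  simp only [SimpleFunc.range_map] at hω ⊢
  refine Finset.sum_image' _ fun b hb => ?_
  by_cases h0 : g b = 0
  · rw [h0, zero_mul]
    refine (Finset.sum_eq_zero fun b' hb' => ?_).symm
    rw [(Finset.mem_filter.1 hb').2, zero_mul]
  · rw [hω (g b) (Finset.mem_image_of_mem g hb) h0, Finset.mul_sum]
    refine Finset.sum_congr rfl fun b' hb' => ?_
    rw [(Finset.mem_filter.1 hb').2]

/-- All three integrals are computed on the common refinement given by the pair of functions; a
level set of a nonzero pair has finite measure. -/
theorem IsIsonormal.simpleIntegral_sub (hZ : IsIsonormal P v Z)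
    {s r : SimpleFunc (EuclideanSpace ℝ (Fin d)) 𝕜} (hs : MemLp s 2 volume)
    (hr : MemLp r 2 volume) :
    simpleIntegral Z (s - r) =ᵐ[P] fun ω => simpleIntegral Z s ω - simpleIntegral Z r ω := by
  have hfin : ∀ b : 𝕜 × 𝕜, b ≠ 0 → volume (s.pair r ⁻¹' {b}) ≠ ⊤ := by
    rintro ⟨c, c'⟩ hb
    rw [SimpleFunc.pair_preimage_singleton]
    by_cases hc : c = 0
    · have hc' : c' ≠ 0 := by rintro rfl; exact hb (by rw [hc]; rfl)
      exact measure_ne_top_of_subset Set.inter_subset_right (volume_preimage_ne_top_of_memLp hr hc')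
    · exact measure_ne_top_of_subset Set.inter_subset_left (volume_preimage_ne_top_of_memLp hs hc)
  have h1 := hZ.simpleIntegral_map (s.pair r) Prod.fst (fun b hb => hfin b (by rintro rfl; simp at hb))
  have h2 := hZ.simpleIntegral_map (s.pair r) Prod.snd (fun b hb => hfin b (by rintro rfl; simp at hb))
  have h3 := hZ.simpleIntegral_map (s.pair r) (fun b => b.1 - b.2)
    (fun b hb => hfin b (by rintro rfl; simp at hb))
  rw [SimpleFunc.map_fst_pair] at h1
  rw [SimpleFunc.map_snd_pair] at h2
  rw [show s - r = (s.pair r).map (fun b => b.1 - b.2) from rfl]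
  filter_upwards [h1, h2, h3] with ω h1 h2 h3
  rw [h1, h2, h3, ← Finset.sum_sub_distrib]
  exact Finset.sum_congr rfl fun b _ => by rw [sub_mul]

variable [BorelSpace 𝕜]

theorem IsIsonormal.measurable_simpleIntegral (hZ : IsIsonormal P v Z)
    {s : SimpleFunc (EuclideanSpace ℝ (Fin d)) 𝕜} (hs : MemLp s 2 volume) :
    Measurable (simpleIntegral Z s) := by
  unfold simpleIntegral
  refine Finset.measurable_sum _ fun c _ => ?_
  by_cases hc : c = 0
  · simp only [hc, zero_mul]; exact measurable_const
  · exact (hZ.measurable _ (s.measurableSet_preimage _)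
      (volume_preimage_ne_top_of_memLp hs hc)).const_mul c

/-- The integral of a simple function has a centred Gaussian law. -/
theorem IsIsonormal.hasLaw_simpleIntegral (hZ : IsIsonormal P v Z) [IsProbabilityMeasure P]
    {s : SimpleFunc (EuclideanSpace ℝ (Fin d)) 𝕜} (hs : MemLp s 2 volume) (a : 𝕜) :
    HasLaw (fun ω => RCLike.re (a * simpleIntegral Z s ω))
      (gaussianReal 0 (v * ‖a‖₊ ^ 2 * (eLpNorm s 2 volume).toNNReal ^ 2)) P := by
  classical
  -- The value 0 is discarded, so that every remaining level set has finite measure and independence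
  -- applies.
  set F := s.range.filter (· ≠ 0) with hF
  have hmem : ∀ c : F, volume (s ⁻¹' {(c : 𝕜)}) ≠ ⊤ := fun c =>
    volume_preimage_ne_top_of_memLp hs (Finset.mem_filter.1 c.2).2
  let e := F.equivFin
  let X : Fin F.card → Ω → ℝ := fun k ω =>
    RCLike.re (a * ((e.symm k : 𝕜) * Z (s ⁻¹' {(e.symm k : 𝕜)}) ω))
  have hXlaw : ∀ k, HasLaw (X k) (gaussianReal 0
      (v * ‖a * (e.symm k : 𝕜)‖₊ ^ 2 * (volume (s ⁻¹' {(e.symm k : 𝕜)})).toNNReal)) P := fun k => by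
    have := hZ.law_re _ (s.measurableSet_preimage {(e.symm k : 𝕜)}) (hmem _) (a * (e.symm k : 𝕜))
    simpa only [X, ← mul_assoc] using this
  have hind : iIndepFun X P := by
    have h1 := hZ.indep F.card (fun k => s ⁻¹' {(e.symm k : 𝕜)})
      (fun k => s.measurableSet_preimage _) (fun k => hmem _) (by
        intro j k hjk
        refine Disjoint.preimage _ ?_
        rw [Set.disjoint_singleton]
        intro h
        exact hjk (e.symm.injective (Subtype.ext h)))
    exact h1.comp (fun k z => RCLike.re (a * ((e.symm k : 𝕜) * z))) (fun k => by
      exact RCLike.continuous_re.measurable.comp ((measurable_id.const_mul _).const_mul _))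
  have hsum : ∀ ω, RCLike.re (a * simpleIntegral Z s ω) = ∑ k, X k ω := fun ω => by
    rw [simpleIntegral, Finset.mul_sum, map_sum,
      e.symm.sum_comp (fun c : F => RCLike.re (a * ((c : 𝕜) * Z (s ⁻¹' {(c : 𝕜)}) ω))),
      Finset.sum_coe_sort F (fun c => RCLike.re (a * (c * Z (s ⁻¹' {c}) ω))), hF,
      Finset.sum_filter_of_ne]
    rintro c _ h rfl
    simp at h
  have hvar : v * ‖a‖₊ ^ 2 * (eLpNorm s 2 volume).toNNReal ^ 2 =
      ∑ k, (v * ‖a * (e.symm k : 𝕜)‖₊ ^ 2 * (volume (s ⁻¹' {(e.symm k : 𝕜)})).toNNReal) := by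
    rw [← ENNReal.toNNReal_pow, eLpNorm_simpleFunc_sq,
      e.symm.sum_comp (fun c : F => v * ‖a * (c : 𝕜)‖₊ ^ 2 * (volume (s ⁻¹' {(c : 𝕜)})).toNNReal),
      Finset.sum_coe_sort F (fun c => v * ‖a * c‖₊ ^ 2 * (volume (s ⁻¹' {c})).toNNReal),
      ENNReal.toNNReal_sum, Finset.mul_sum, hF, Finset.sum_filter_of_ne]
    · refine Finset.sum_congr rfl fun c _ => ?_
      rw [ENNReal.toNNReal_mul, nnnorm_mul, ENNReal.toNNReal_pow, toNNReal_enorm]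
      ring
    · rintro c _ h rfl
      simp at h
    · intro c _
      by_cases hc : c = 0
      · simp [hc]
      · exact ENNReal.mul_ne_top (by simp) (volume_preimage_ne_top_of_memLp hs hc)
  refine ⟨?_, ?_⟩
  · exact (RCLike.continuous_re.measurable.comp
      ((hZ.measurable_simpleIntegral hs).const_mul a)).aemeasurable
  · have : IsProbabilityMeasure (P.map fun ω => RCLike.re (a * simpleIntegral Z s ω)) :=
      Measure.isProbabilityMeasure_map (RCLike.continuous_re.measurable.comp
        ((hZ.measurable_simpleIntegral hs).const_mul a)).aemeasurable
    -- The characteristic function of a sum of independent Gaussians is a product of exponentials,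
    -- so the variances add.
    refine Measure.ext_of_charFun ?_
    simp_rw [hsum]
    rw [hind.charFun_map_fun_sum_eq_prod fun k => (hXlaw k).aemeasurable]
    ext t
    rw [Finset.prod_apply, hvar, charFun_gaussianReal]
    simp_rw [(hXlaw _).map_eq, charFun_gaussianReal]
    rw [← Complex.exp_sum]
    congr 1
    push_cast
    simp only [mul_zero, zero_mul, zero_sub, Finset.sum_neg_distrib,
      Finset.sum_mul, Finset.sum_div]

end


/-! ### Stochastic integrals of square integrable functions -/

theorem tendsto_eLpNorm_toNNReal {α E ι : Type*} [MeasurableSpace α] {μ : Measure α}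
    [NormedAddCommGroup E] {l : Filter ι} {f : ι → α → E} {g : α → E}
    (hf : ∀ n, MemLp (f n) 2 μ) (hg : MemLp g 2 μ)
    (h : Tendsto (fun n => eLpNorm (f n - g) 2 μ) l (𝓝 0)) :
    Tendsto (fun n => (eLpNorm (f n) 2 μ).toNNReal) l (𝓝 (eLpNorm g 2 μ).toNNReal) := by
  have h1 := ((Lp.tendsto_Lp_iff_tendsto_eLpNorm'' f hf g hg).2 h).nnnorm
  simpa [Lp.nnnorm_toLp] using h1

theorem tendsto_eLpNorm_sub_of_tendsto {α E : Type*} [MeasurableSpace α] {μ : Measure α}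
    [NormedAddCommGroup E] {f g : α → E} {s r : ℕ → α → E} (hf : MemLp f 2 μ) (hg : MemLp g 2 μ)
    (hs : ∀ n, MemLp (s n) 2 μ) (hr : ∀ n, MemLp (r n) 2 μ)
    (h1 : Tendsto (fun n => eLpNorm (f - s n) 2 μ) atTop (𝓝 0))
    (h2 : Tendsto (fun n => eLpNorm (g - r n) 2 μ) atTop (𝓝 0)) :
    Tendsto (fun n => eLpNorm (s n - r n - (f - g)) 2 μ) atTop (𝓝 0) := by
  have h3 := h1.add h2
  rw [add_zero] at h3
  refine tendsto_of_tendsto_of_tendsto_of_le_of_le tendsto_const_nhds h3 (fun _ => zero_le)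
    fun n => ?_
  have e : s n - r n - (f - g) = (g - r n) - (f - s n) := by abel
  rw [e, add_comm]
  exact eLpNorm_sub_le (hg.1.sub (hr n).1) (hf.1.sub (hs n).1) (by norm_num)

section

variable {d : ℕ} {Ω 𝕜 : Type*} [MeasurableSpace Ω] [RCLike 𝕜] [MeasurableSpace 𝕜]
  [BorelSpace 𝕜] {P : Measure Ω} [IsProbabilityMeasure P] {v : ℝ≥0}
  {Z : Set (EuclideanSpace ℝ (Fin d)) → Ω → 𝕜}

/-- Differences of stochastic integrals have centred Gaussian real parts. -/
theorem IsIsonormal.hasLaw_sub (hZ : IsIsonormal P v Z)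
    {f g : EuclideanSpace ℝ (Fin d) → 𝕜} {Y Y' : Ω → 𝕜}
    (hY : IsStochasticIntegral P Z f Y) (hY' : IsStochasticIntegral P Z g Y') :
    HasLaw (fun ω => RCLike.re (Y ω) - RCLike.re (Y' ω))
      (gaussianReal 0 (v * (eLpNorm (f - g) 2 volume).toNNReal ^ 2)) P := by
  obtain ⟨hf, hYm, s, hs, hsf, hsY⟩ := hY
  obtain ⟨hg, hYm', r, hr, hrg, hrY⟩ := hY'
  -- Two nested subsequences make both approximations converge almost surely along the same indices.
  obtain ⟨ns, hns, hnsY⟩ := hsY.exists_seq_tendsto_ae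
  obtain ⟨ms, hms, hmsY⟩ := (hrY.comp hns.tendsto_atTop).exists_seq_tendsto_ae
  let k : ℕ → ℕ := fun n => ns (ms n)
  have hk : Tendsto k atTop atTop := hns.tendsto_atTop.comp hms.tendsto_atTop
  let D : ℕ → Ω → ℝ := fun n ω => RCLike.re (1 * simpleIntegral Z (s (k n) - r (k n)) ω)
  have hsr : ∀ n, MemLp (s (k n) - r (k n) : SimpleFunc (EuclideanSpace ℝ (Fin d)) 𝕜) 2 volume :=
    fun n => (hs _).sub (hr _)
  have hDlaw : ∀ n, HasLaw (D n) (gaussianReal 0 (v * ‖(1 : 𝕜)‖₊ ^ 2 *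
      (eLpNorm (s (k n) - r (k n) : SimpleFunc (EuclideanSpace ℝ (Fin d)) 𝕜)
        2 volume).toNNReal ^ 2)) P :=
    fun n => hZ.hasLaw_simpleIntegral (hsr n) 1
  have hvar : Tendsto (fun n => v * ‖(1 : 𝕜)‖₊ ^ 2 *
      (eLpNorm (s (k n) - r (k n) : SimpleFunc (EuclideanSpace ℝ (Fin d)) 𝕜)
        2 volume).toNNReal ^ 2) atTop (𝓝 (v * (eLpNorm (f - g) 2 volume).toNNReal ^ 2)) := by
    simp only [nnnorm_one, one_pow, mul_one]
    refine ((tendsto_eLpNorm_toNNReal hsr (hf.sub hg) ?_).pow 2).const_mul v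
    exact tendsto_eLpNorm_sub_of_tendsto hf hg (fun n => hs (k n)) (fun n => hr (k n))
      (hsf.comp hk) (hrg.comp hk)
  have hDlim : ∀ᵐ ω ∂P, Tendsto (fun n => D n ω) atTop
      (𝓝 (RCLike.re (Y ω) - RCLike.re (Y' ω))) := by
    have hsub : ∀ᵐ ω ∂P, ∀ n, simpleIntegral Z (s (k n) - r (k n)) ω =
        simpleIntegral Z (s (k n)) ω - simpleIntegral Z (r (k n)) ω :=
      ae_all_iff.2 fun n => hZ.simpleIntegral_sub (hs _) (hr _)
    filter_upwards [hsub, hnsY, hmsY] with ω h1 h2 h3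
    have h4 := (h2.comp hms.tendsto_atTop).sub h3
    have h5 := (RCLike.continuous_re.tendsto _).comp h4
    rw [map_sub] at h5
    refine h5.congr fun n => ?_
    simp only [D, one_mul, h1 n]
    rfl
  have hmeas : AEMeasurable (fun ω => RCLike.re (Y ω) - RCLike.re (Y' ω)) P :=
    ((RCLike.continuous_re.comp_aestronglyMeasurable hYm).sub
      (RCLike.continuous_re.comp_aestronglyMeasurable hYm')).aemeasurable
  refine ⟨hmeas, ?_⟩
  have : IsProbabilityMeasure (P.map fun ω => RCLike.re (Y ω) - RCLike.re (Y' ω)) :=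
    Measure.isProbabilityMeasure_map hmeas
  refine Measure.ext_of_charFun ?_
  ext t
  have hchar : ∀ {X : Ω → ℝ}, AEMeasurable X P →
      charFun (P.map X) t = ∫ ω, Complex.exp (t * X ω * Complex.I) ∂P := fun hX => by
    rw [charFun_apply_real, integral_map hX (by fun_prop)]
  -- The characteristic functions converge by dominated convergence on the one hand, and by the
  -- explicit Gaussian formula and convergence of the variances on the other.
  have hl1 : Tendsto (fun n => charFun (P.map (D n)) t) atTop
      (𝓝 (charFun (P.map fun ω => RCLike.re (Y ω) - RCLike.re (Y' ω)) t)) := by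
    simp_rw [hchar hmeas, fun n => hchar (hDlaw n).aemeasurable]
    refine tendsto_integral_of_dominated_convergence (fun _ => 1) (fun n => ?_)
      (integrable_const _) (fun n => ?_) ?_
    · have := (hDlaw n).aemeasurable
      exact (by fun_prop : AEMeasurable _ P).aestronglyMeasurable
    · refine Eventually.of_forall fun ω => ?_
      rw [← Complex.ofReal_mul, Complex.norm_exp_ofReal_mul_I]
    · filter_upwards [hDlim] with ω hω
      have hc : Continuous fun x : ℝ => Complex.exp (t * x * Complex.I) := by fun_prop
      exact (hc.tendsto _).comp hω
  have hl2 : Tendsto (fun n => charFun (P.map (D n)) t) atTop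
      (𝓝 (charFun (gaussianReal 0 (v * (eLpNorm (f - g) 2 volume).toNNReal ^ 2)) t)) := by
    simp_rw [fun n => (hDlaw n).map_eq, charFun_gaussianReal]
    have hc : Continuous fun w : ℝ≥0 =>
        Complex.exp (t * ((0 : ℝ) : ℂ) * Complex.I - ((w : ℝ) : ℂ) * t ^ 2 / 2) := by fun_prop
    exact (hc.tendsto _).comp hvar
  exact tendsto_nhds_unique hl1 hl2

/-- From |z|² = (Re z)² + (Re(Iz))², where both terms have a known Gaussian law when z is the
integral. For real scalars I = 0 and the second term disappears. The bound turns L² approximation of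
integrands into Cauchy sequences of integrals. -/
theorem IsIsonormal.exists_eLpNorm_simpleIntegral_le (hZ : IsIsonormal P v Z) :
    ∃ C : ℝ≥0, ∀ s : SimpleFunc (EuclideanSpace ℝ (Fin d)) 𝕜, MemLp s 2 volume →
      eLpNorm (simpleIntegral Z s) 2 P ≤ C * eLpNorm s 2 volume := by
  obtain ⟨c, hc⟩ := exists_lintegral_enorm_pow_gaussianReal 1
  refine ⟨NNReal.sqrt (c * v + c * v * ‖(RCLike.I : 𝕜)‖₊ ^ 2), fun s hs => ?_⟩
  have h1 : ∀ a : 𝕜, ∫⁻ ω, ‖RCLike.re (a * simpleIntegral Z s ω)‖ₑ ^ 2 ∂P =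
      c * v * ‖a‖₊ ^ 2 * eLpNorm s 2 volume ^ 2 := fun a => by
    have := hc P _ _ (hZ.hasLaw_simpleIntegral hs a)
    rw [mul_one, pow_one] at this
    rw [this]
    push_cast
    rw [ENNReal.coe_toNNReal hs.2.ne]
    ring
  have hm := hZ.measurable_simpleIntegral hs
  have h2 : eLpNorm (simpleIntegral Z s) 2 P ^ 2 =
      (c * v + c * v * ‖(RCLike.I : 𝕜)‖₊ ^ 2 : ℝ≥0) * eLpNorm s 2 volume ^ 2 := by
    rw [eLpNorm_two_sq]
    have h3 : ∀ z : 𝕜, ‖z‖ₑ ^ 2 = ‖RCLike.re (1 * z)‖ₑ ^ 2 + ‖RCLike.re (RCLike.I * z)‖ₑ ^ 2 := by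
      intro z
      rw [one_mul, RCLike.I_mul_re, enorm_neg, ← ofReal_norm, ← ofReal_norm,
        ← ofReal_norm, ← ENNReal.ofReal_pow (by positivity),
        ← ENNReal.ofReal_pow (by positivity), ← ENNReal.ofReal_pow (by positivity),
        ← ENNReal.ofReal_add (by positivity) (by positivity), RCLike.norm_sq_eq_def]
      simp [sq]
    simp_rw [h3]
    have h4 : Measurable fun ω => ‖RCLike.re (1 * simpleIntegral Z s ω)‖ₑ ^ 2 :=
      (RCLike.continuous_re.measurable.comp (hm.const_mul 1)).enorm.pow_const 2
    rw [lintegral_add_left h4, h1, h1]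
    push_cast
    simp
    ring
  have h4 : (eLpNorm (simpleIntegral Z s) 2 P) ^ 2 ≤
      (NNReal.sqrt (c * v + c * v * ‖(RCLike.I : 𝕜)‖₊ ^ 2) * eLpNorm s 2 volume) ^ 2 := by
    rw [h2, mul_pow, ← ENNReal.coe_pow, NNReal.sq_sqrt]
  exact (ENNReal.pow_le_pow_left_iff (by norm_num)).1 h4

/-- Every square integrable function has a stochastic integral. -/
theorem IsIsonormal.exists_isStochasticIntegral (hZ : IsIsonormal P v Z)
    {f : EuclideanSpace ℝ (Fin d) → 𝕜} (hf : MemLp f 2 volume) :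
    ∃ Y, IsStochasticIntegral P Z f Y := by
  have happ : ∀ n : ℕ, ∃ g : SimpleFunc (EuclideanSpace ℝ (Fin d)) 𝕜,
      eLpNorm (f - ⇑g) 2 volume < (2 ^ n)⁻¹ ∧ MemLp g 2 volume := fun n =>
    hf.exists_simpleFunc_eLpNorm_sub_lt (by norm_num) (by simp)
  choose s hs hsm using happ
  obtain ⟨C, hC⟩ := hZ.exists_eLpNorm_simpleIntegral_le
  have hsf : Tendsto (fun n => eLpNorm (f - ⇑(s n)) 2 volume) atTop (𝓝 0) := by
    refine tendsto_of_tendsto_of_tendsto_of_le_of_le tendsto_const_nhds ?_ (fun _ => zero_le)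
      fun n => (hs n).le
    simp_rw [ENNReal.inv_pow]
    exact ENNReal.tendsto_pow_atTop_nhds_zero_of_lt_one (by simp)
  have hI : ∀ n, MemLp (simpleIntegral Z (s n)) 2 P := fun n =>
    ⟨(hZ.measurable_simpleIntegral (hsm n)).aestronglyMeasurable,
      (hC _ (hsm n)).trans_lt (ENNReal.mul_lt_top (by simp) (hsm n).2)⟩
  have hcauchy : CauchySeq fun n => (hI n).toLp (simpleIntegral Z (s n)) := by
    refine cauchySeq_of_edist_le_geometric_two (C * 2 : ℝ≥0) ENNReal.coe_ne_top fun n => ?_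
    rw [Lp.edist_toLp_toLp]
    calc eLpNorm (simpleIntegral Z (s n) - simpleIntegral Z (s (n + 1))) 2 P
        = eLpNorm (simpleIntegral Z (s n - s (n + 1))) 2 P :=
          eLpNorm_congr_ae (hZ.simpleIntegral_sub (hsm n) (hsm (n + 1))).symm
      _ ≤ C * eLpNorm (s n - s (n + 1) : SimpleFunc (EuclideanSpace ℝ (Fin d)) 𝕜) 2 volume :=
          hC _ ((hsm n).sub (hsm (n + 1)))
      _ ≤ C * (2 * (2 ^ n)⁻¹) := by
          gcongr
          have e : ⇑(s n - s (n + 1)) = (f - ⇑(s (n + 1))) - (f - ⇑(s n)) := by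
            rw [SimpleFunc.coe_sub]; abel
          rw [e, two_mul]
          refine (eLpNorm_sub_le (hf.1.sub (hsm (n + 1)).1) (hf.1.sub (hsm n).1)
            (by norm_num)).trans (add_le_add ((hs (n + 1)).le.trans ?_) (hs n).le)
          apply ENNReal.inv_le_inv.2
          exact pow_le_pow_right₀ (by norm_num) (Nat.le_succ n)
      _ = (C * 2 : ℝ≥0) / 2 ^ n := by
          rw [div_eq_mul_inv, ENNReal.coe_mul, mul_assoc]; rfl
  obtain ⟨Y, hY⟩ := cauchySeq_tendsto_of_complete hcauchy
  refine ⟨Y, hf, Lp.aestronglyMeasurable Y, s, hsm, hsf, ?_⟩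
  exact (tendstoInMeasure_of_tendsto_Lp hY).congr_left fun n => (hI n).coeFn_toLp

theorem IsIsonormal.isStochasticIntegral_stochasticIntegral (hZ : IsIsonormal P v Z)
    {f : EuclideanSpace ℝ (Fin d) → 𝕜} (hf : MemLp f 2 volume) :
    IsStochasticIntegral P Z f (stochasticIntegral P Z f) := by
  have h := hZ.exists_isStochasticIntegral hf
  rw [stochasticIntegral, dif_pos h]
  exact h.choose_spec

end


/-! ### Growth of matrix exponentials on generalized eigenspaces -/

section

open scoped Matrix Matrix.Norms.Operator

variable {d : ℕ}

/-- The exponential series terminates on a vector killed by a power of the matrix. It is used with M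
minus an eigenvalue, so that only polynomial growth remains besides the scalar exponential. -/
theorem exp_smul_sub_mulVec_eq_sum (M : Matrix (Fin d) (Fin d) ℂ) {w : Fin d → ℂ} {N : ℕ}
    (hN : M ^ N *ᵥ w = 0) (z : ℂ) :
    NormedSpace.exp (z • M) *ᵥ w =
      ∑ k ∈ Finset.range N, ((k.factorial : ℂ)⁻¹ * z ^ k) • (M ^ k *ᵥ w) := by
  have h1 := NormedSpace.exp_series_hasSum_exp' (𝕂 := ℂ) (z • M)
  let L : Matrix (Fin d) (Fin d) ℂ →ₗ[ℂ] (Fin d → ℂ) := (Matrix.mulVecBilin ℂ ℂ).flip w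
  have h2 := h1.mapL (LinearMap.toContinuousLinearMap L)
  have hL : ∀ A, LinearMap.toContinuousLinearMap L A = A *ᵥ w := fun A => rfl
  simp only [hL] at h2
  have h3 : HasSum (fun k : ℕ => ((k.factorial : ℂ)⁻¹ • (z • M) ^ k) *ᵥ w)
      (∑ k ∈ Finset.range N, ((k.factorial : ℂ)⁻¹ • (z • M) ^ k) *ᵥ w) := by
    refine hasSum_sum_of_ne_finset_zero fun k hk => ?_
    rw [Finset.mem_range, not_lt] at hk
    obtain ⟨j, rfl⟩ := Nat.exists_eq_add_of_le' hk
    rw [smul_pow, smul_smul, Matrix.smul_mulVec, pow_add M, ← Matrix.mulVec_mulVec, hN,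
      Matrix.mulVec_zero, smul_zero]
  refine (h2.unique h3).trans ?_
  refine Finset.sum_congr rfl fun k _ => ?_
  rw [smul_pow, smul_smul, Matrix.smul_mulVec]

/-- Growth of `exp (s M)` on a generalized eigenvector. -/
theorem exists_norm_exp_smul_mulVec_le (M : Matrix (Fin d) (Fin d) ℂ) {μ : ℂ} {w : Fin d → ℂ}
    (hw : w ∈ Module.End.maxGenEigenspace (Matrix.toLin' M) μ) {δ : ℝ} (hδ : 0 < δ) :
    ∃ C, ∀ s : ℝ, ‖NormedSpace.exp ((s : ℂ) • M) *ᵥ w‖ ≤ C * Real.exp (s * μ.re + δ * |s|) := by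
  obtain ⟨N, hN⟩ := Module.End.mem_maxGenEigenspace _ _ _ |>.1 hw
  set A : Matrix (Fin d) (Fin d) ℂ := M - μ • 1 with hA
  have hAN : A ^ N *ᵥ w = 0 := by
    have e : Matrix.toLin' A = Matrix.toLin' M - μ • 1 := by
      rw [hA, map_sub, map_smul, Matrix.toLin'_one]; rfl
    rw [← Matrix.toLin'_apply, Matrix.toLin'_pow, e]
    exact hN
  -- The polynomial factors are absorbed through |s|^k / k! ≤ δ^(-k) e^(δ|s|).
  refine ⟨∑ k ∈ Finset.range N, (δ ^ k)⁻¹ * ‖A ^ k *ᵥ w‖, fun s => ?_⟩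
  have hsplit : NormedSpace.exp ((s : ℂ) • M) =
      Complex.exp (s * μ) • NormedSpace.exp ((s : ℂ) • A) := by
    have e : (s : ℂ) • M = algebraMap ℂ (Matrix (Fin d) (Fin d) ℂ) (s * μ) + (s : ℂ) • A := by
      rw [hA, smul_sub, Algebra.algebraMap_eq_smul_one, smul_smul]; abel
    have e2 : NormedSpace.exp (algebraMap ℂ (Matrix (Fin d) (Fin d) ℂ) (s * μ)) =
        algebraMap ℂ (Matrix (Fin d) (Fin d) ℂ) (NormedSpace.exp (s * μ)) :=
      (NormedSpace.algebraMap_exp_comm (𝔸 := Matrix (Fin d) (Fin d) ℂ) (s * μ : ℂ)).symm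
    rw [e, Matrix.exp_add_of_commute _ _ (Algebra.commute_algebraMap_left _ _), e2, Algebra.algebraMap_eq_smul_one, smul_mul_assoc, one_mul,
      Complex.exp_eq_exp_ℂ]
  rw [hsplit, Matrix.smul_mulVec, norm_smul, Complex.norm_exp, exp_smul_sub_mulVec_eq_sum A hAN]
  have hre : (s * μ : ℂ).re = s * μ.re := by simp
  rw [hre, Real.exp_add, mul_left_comm]
  gcongr Real.exp (s * μ.re) * ?_
  refine (norm_sum_le _ _).trans ?_
  rw [Finset.sum_mul]
  refine Finset.sum_le_sum fun k _ => ?_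
  rw [norm_smul]
  have h1 := Real.pow_div_factorial_le_exp (δ * |s|) (by positivity) k
  have h2 : ‖((k.factorial : ℂ)⁻¹ * (s : ℂ) ^ k)‖ ≤ (δ ^ k)⁻¹ * Real.exp (δ * |s|) := by
    rw [norm_mul, norm_inv, norm_pow, Complex.norm_natCast, Complex.norm_real, Real.norm_eq_abs]
    rw [mul_pow, mul_div_assoc] at h1
    rw [← div_eq_inv_mul, ← div_eq_inv_mul, le_div_iff₀ (by positivity), mul_comm]
    exact h1
  calc _ ≤ (δ ^ k)⁻¹ * Real.exp (δ * |s|) * ‖A ^ k *ᵥ w‖ := by gcongr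
    _ = _ := by ring

/-- The vectors along which `exp (s A)` grows at most like `exp ((r + δ) s)` for all `δ > 0`. -/
noncomputable def growthSubmodule (A : Matrix (Fin d) (Fin d) ℂ) (r : ℝ) :
    Submodule ℂ (Fin d → ℂ) where
  carrier := {w | ∀ δ > 0, ∃ C, ∀ s : ℝ, 0 ≤ s →
    ‖NormedSpace.exp ((s : ℂ) • A) *ᵥ w‖ ≤ C * Real.exp ((r + δ) * s)}
  add_mem' := by
    intro w w' hw hw' δ hδ
    obtain ⟨C, hC⟩ := hw δ hδ
    obtain ⟨C', hC'⟩ := hw' δ hδ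
    refine ⟨C + C', fun s hs => ?_⟩
    rw [Matrix.mulVec_add, add_mul]
    exact (norm_add_le _ _).trans (add_le_add (hC s hs) (hC' s hs))
  zero_mem' := fun δ _ => ⟨0, fun s _ => by simp⟩
  smul_mem' := by
    intro c w hw δ hδ
    obtain ⟨C, hC⟩ := hw δ hδ
    refine ⟨‖c‖ * C, fun s hs => ?_⟩
    rw [Matrix.mulVec_smul, norm_smul, mul_assoc]
    gcongr
    exact hC s hs

theorem mem_growthSubmodule {A : Matrix (Fin d) (Fin d) ℂ} {r : ℝ} {w : Fin d → ℂ} :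
    w ∈ growthSubmodule A r ↔ ∀ δ > 0, ∃ C, ∀ s : ℝ, 0 ≤ s →
      ‖NormedSpace.exp ((s : ℂ) • A) *ᵥ w‖ ≤ C * Real.exp ((r + δ) * s) := Iff.rfl

theorem maxGenEigenspace_le_growthSubmodule (M : Matrix (Fin d) (Fin d) ℂ) {μ : ℂ} {r : ℝ}
    (h : μ.re ≤ r) : Module.End.maxGenEigenspace (Matrix.toLin' M) μ ≤ growthSubmodule M r := by
  intro w hw δ hδ
  obtain ⟨C, hC⟩ := exists_norm_exp_smul_mulVec_le M hw hδ
  refine ⟨|C|, fun s hs => (hC s).trans ?_⟩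
  rw [abs_of_nonneg hs]
  gcongr
  · exact le_abs_self C
  · nlinarith

/-- The growth estimate holds for negative times as well, and is read here backwards in time. -/
theorem maxGenEigenspace_le_growthSubmodule_neg (M : Matrix (Fin d) (Fin d) ℂ) {μ : ℂ} {r : ℝ}
    (h : r ≤ μ.re) :
    Module.End.maxGenEigenspace (Matrix.toLin' M) μ ≤ growthSubmodule (-M) (-r) := by
  intro w hw δ hδ
  obtain ⟨C, hC⟩ := exists_norm_exp_smul_mulVec_le M hw hδ
  refine ⟨|C|, fun s hs => ?_⟩
  have e : (s : ℂ) • (-M) = ((-s : ℝ) : ℂ) • M := by simp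
  rw [e]
  refine (hC (-s)).trans ?_
  rw [abs_neg, abs_of_nonneg hs]
  gcongr
  · exact le_abs_self C
  · nlinarith

/-- A family of linear maps is bounded uniformly on the unit ball if it is bounded on a basis. -/
theorem exists_forall_norm_mulVec_le {r : ℝ} (A : Matrix (Fin d) (Fin d) ℂ)
    (B : Matrix (Fin d) (Fin d) ℂ) (h : ∀ w, B *ᵥ w ∈ growthSubmodule A r) {δ : ℝ} (hδ : 0 < δ) :
    ∃ K, 0 < K ∧ ∀ s : ℝ, 0 ≤ s → ∀ w,
      ‖NormedSpace.exp ((s : ℂ) • A) *ᵥ (B *ᵥ w)‖ ≤ K * Real.exp ((r + δ) * s) * ‖w‖ := by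
  choose C hC using fun j : Fin d => h (Pi.single j 1) δ hδ
  refine ⟨∑ j, |C j| + 1, by positivity, fun s hs w => ?_⟩
  have e : NormedSpace.exp ((s : ℂ) • A) *ᵥ (B *ᵥ w) =
      ∑ j, w j • (NormedSpace.exp ((s : ℂ) • A) *ᵥ (B *ᵥ Pi.single j 1)) := by
    conv_lhs => rw [pi_eq_sum_univ' w]
    rw [Matrix.mulVec_sum, Matrix.mulVec_sum]
    exact Finset.sum_congr rfl fun j _ => by rw [Matrix.mulVec_smul, Matrix.mulVec_smul]
  rw [e]
  calc _ ≤ ∑ j, ‖w j • (NormedSpace.exp ((s : ℂ) • A) *ᵥ (B *ᵥ Pi.single j 1))‖ := norm_sum_le _ _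
    _ ≤ ∑ j, |C j| * Real.exp ((r + δ) * s) * ‖w‖ := by
        refine Finset.sum_le_sum fun j _ => ?_
        rw [norm_smul, mul_comm]
        gcongr
        · exact (hC j s hs).trans (by gcongr; exact le_abs_self _)
        · exact norm_le_pi_norm w j
    _ ≤ _ := by
        rw [← Finset.sum_mul, ← Finset.sum_mul]
        gcongr
        linarith

/-- If `w` is not in the sum of the generalized eigenspaces of eigenvalues with real part `< r`,
then `exp (s M) w` grows at least like `exp ((r - δ) s)`. -/
theorem exists_le_norm_exp_smul_mulVec (M : Matrix (Fin d) (Fin d) ℂ) {r : ℝ} {w : Fin d → ℂ}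
    (hw : w ∉ ⨆ μ ∈ {μ : ℂ | μ.re < r}, Module.End.maxGenEigenspace (Matrix.toLin' M) μ)
    {δ : ℝ} (hδ : 0 < δ) :
    ∃ k, 0 < k ∧ ∀ s : ℝ, 0 ≤ s →
      k * Real.exp ((r - δ) * s) ≤ ‖NormedSpace.exp ((s : ℂ) • M) *ᵥ w‖ := by
  set T := Matrix.toLin' M with hT
  set A := ⨆ μ ∈ {μ : ℂ | μ.re < r}, Module.End.maxGenEigenspace T μ with hA
  set B := ⨆ μ ∈ {μ : ℂ | r ≤ μ.re}, Module.End.maxGenEigenspace T μ with hB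
  -- The space splits into the invariant parts with real parts below r and at least r. The
  -- projection p onto the latter commutes with M, and p w ≠ 0 by assumption.
  have hAB : IsCompl B A := by
    refine ⟨?_, ?_⟩
    · refine (Module.End.independent_maxGenEigenspace T).disjoint_biSup_biSup ?_
      rw [Set.disjoint_left]
      intro μ h1 h2
      exact (not_lt.2 (show r ≤ μ.re from h1)) h2
    · rw [codisjoint_iff, eq_top_iff, ← Module.End.iSup_maxGenEigenspace_eq_top T]
      refine iSup_le fun μ => ?_
      rcases lt_or_ge μ.re r with h | h
      · exact le_sup_of_le_right (le_biSup (fun μ => Module.End.maxGenEigenspace T μ)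
          (show μ ∈ {μ : ℂ | μ.re < r} from h))
      · exact le_sup_of_le_left (le_biSup (fun μ => Module.End.maxGenEigenspace T μ)
          (show μ ∈ {μ : ℂ | r ≤ μ.re} from h))
  have hinv : ∀ (S : Set ℂ) (x : Fin d → ℂ), x ∈ ⨆ μ ∈ S, Module.End.maxGenEigenspace T μ →
      T x ∈ ⨆ μ ∈ S, Module.End.maxGenEigenspace T μ := by
    intro S x hx
    have : (⨆ μ ∈ S, Module.End.maxGenEigenspace T μ) ≤
        (⨆ μ ∈ S, Module.End.maxGenEigenspace T μ).comap T := by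
      refine iSup₂_le fun μ hμ x hx => ?_
      exact (le_biSup (fun μ => Module.End.maxGenEigenspace T μ) hμ)
        (Module.End.mapsTo_maxGenEigenspace_of_comm (Commute.refl T) μ hx)
    exact this hx
  set p : (Fin d → ℂ) →ₗ[ℂ] (Fin d → ℂ) := B.projection A hAB with hp
  have hpB : ∀ x ∈ B, p x = x := fun x hx => Submodule.projection_apply_left hAB ⟨x, hx⟩
  have hpA : ∀ x ∈ A, p x = 0 := fun x hx => (Submodule.projection_apply_eq_zero_iff hAB).2 hx
  have hpmem : ∀ x, p x ∈ B := fun x => Submodule.projection_apply_mem hAB x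
  have hcomm : ∀ x, p (T x) = T (p x) := fun x => by
    have hx : x ∈ B ⊔ A := by rw [hAB.sup_eq_top]; trivial
    obtain ⟨b, hb, a, ha, rfl⟩ := Submodule.mem_sup.1 hx
    rw [map_add, map_add, map_add, hpB b hb, hpA a ha, add_zero, hpB _ (hinv _ b hb),
      hpA _ (hinv _ a ha), add_zero]
  set Q : Matrix (Fin d) (Fin d) ℂ := LinearMap.toMatrix' p with hQ
  have hQp : ∀ x, Q *ᵥ x = p x := fun x => by
    rw [hQ, ← Matrix.toLin'_apply, Matrix.toLin'_toMatrix']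
  have hQM : Commute Q M := by
    apply Matrix.toLin'.injective
    rw [Matrix.toLin'_mul, Matrix.toLin'_mul, ← hT, hQ, Matrix.toLin'_toMatrix']
    exact LinearMap.ext hcomm
  obtain ⟨K, hK, hKb⟩ := exists_forall_norm_mulVec_le (r := -r) (-M) Q (fun x => by
    rw [hQp]
    have : B ≤ growthSubmodule (-M) (-r) :=
      iSup₂_le fun μ hμ => maxGenEigenspace_le_growthSubmodule_neg M hμ
    exact this (hpmem x)) hδ
  have hpw : 0 < ‖p w‖ := by
    rw [norm_pos_iff]
    intro h
    exact hw ((Submodule.projection_apply_eq_zero_iff hAB).1 h)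
  refine ⟨‖p w‖ / K, by positivity, fun s hs => ?_⟩
  -- The fixed nonzero vector p w is recovered from exp(sM)w by exp(-sM) p, whose norm is at most of
  -- order e^((-r + δ)s); hence exp(sM)w cannot be too small.
  have e : NormedSpace.exp ((s : ℂ) • (-M)) *ᵥ (Q *ᵥ (NormedSpace.exp ((s : ℂ) • M) *ᵥ w)) =
      p w := by
    have hc : Commute Q (NormedSpace.exp ((s : ℂ) • M)) := (hQM.smul_right _).exp_right
    rw [Matrix.mulVec_mulVec _ Q, hc.eq, ← Matrix.mulVec_mulVec, Matrix.mulVec_mulVec,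
      ← Matrix.exp_add_of_commute _ _ (by
        rw [smul_neg]; exact (Commute.refl _).neg_left), smul_neg, neg_add_cancel,
      NormedSpace.exp_zero, Matrix.one_mulVec, hQp]
  have h1 := hKb s hs (NormedSpace.exp ((s : ℂ) • M) *ᵥ w)
  rw [e] at h1
  rw [div_mul_eq_mul_div, div_le_iff₀ hK]
  have h2 : Real.exp ((-r + δ) * s) * Real.exp ((r - δ) * s) = 1 := by
    rw [← Real.exp_add, ← Real.exp_zero]; congr 1; ring
  calc ‖p w‖ * Real.exp ((r - δ) * s)
      ≤ K * Real.exp ((-r + δ) * s) * ‖NormedSpace.exp ((s : ℂ) • M) *ᵥ w‖ *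
          Real.exp ((r - δ) * s) := by gcongr
    _ = ‖NormedSpace.exp ((s : ℂ) • M) *ᵥ w‖ * K *
          (Real.exp ((-r + δ) * s) * Real.exp ((r - δ) * s)) := by ring
    _ = _ := by rw [h2, mul_one]

end


/-! ### The one-parameter group c^E on ℝ^d and its Jacobian -/

section

open scoped Matrix Matrix.Norms.Operator

variable {d : ℕ} (E : Matrix (Fin d) (Fin d) ℝ)

theorem complexify_toEuclideanLin (A : Matrix (Fin d) (Fin d) ℝ) (x : EuclideanSpace ℝ (Fin d)) :
    complexify d (Matrix.toEuclideanLin A x) = complexMatrix A *ᵥ complexify d x := by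
  ext j
  exact RingHom.map_mulVec (algebraMap ℝ ℂ) A x j

theorem complexMatrix_exp (s : ℝ) :
    complexMatrix (NormedSpace.exp (s • E)) = NormedSpace.exp ((s : ℂ) • complexMatrix E) := by
  have h := NormedSpace.map_exp (𝔸 := Matrix (Fin d) (Fin d) ℝ)
    (𝔹 := Matrix (Fin d) (Fin d) ℂ) ((algebraMap ℝ ℂ).mapMatrix)
    (by
      refine continuous_matrix fun i j => ?_
      exact Complex.continuous_ofReal.comp (continuous_id.matrix_elem i j)) (s • E)
  refine h.trans ?_
  congr 1
  ext i j
  simp [complexMatrix]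

theorem complexify_powAct (c : ℝ) (x : EuclideanSpace ℝ (Fin d)) :
    complexify d (powAct E c x) =
      NormedSpace.exp ((Real.log c : ℂ) • complexMatrix E) *ᵥ complexify d x := by
  rw [powAct, complexify_toEuclideanLin, complexMatrix_exp]

theorem norm_complexify_le (x : EuclideanSpace ℝ (Fin d)) : ‖complexify d x‖ ≤ ‖x‖ := by
  rw [pi_norm_le_iff_of_nonneg (norm_nonneg _)]
  intro j
  change ‖((x j : ℝ) : ℂ)‖ ≤ _
  rw [Complex.norm_real]
  exact PiLp.norm_apply_le x j

theorem norm_le_mul_norm_complexify (x : EuclideanSpace ℝ (Fin d)) :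
    ‖x‖ ≤ (d + 1) * ‖complexify d x‖ := by
  refine abs_le_of_sq_le_sq' ?_ (by positivity) |>.2
  rw [EuclideanSpace.norm_sq_eq]
  have : ∀ j, ‖x j‖ ≤ ‖complexify d x‖ := fun j => by
    rw [← Complex.norm_real]
    exact norm_le_pi_norm (complexify d x) j
  calc ∑ j, ‖x j‖ ^ 2 ≤ ∑ _j : Fin d, ‖complexify d x‖ ^ 2 := by
        gcongr with j; exact this j
    _ = d * ‖complexify d x‖ ^ 2 := by simp
    _ ≤ _ := by
      rw [mul_pow]
      gcongr
      nlinarith [(Nat.cast_nonneg d : (0:ℝ) ≤ d)]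

theorem powAct_mul {c c' : ℝ} (hc : 0 < c) (hc' : 0 < c') (x : EuclideanSpace ℝ (Fin d)) :
    powAct E (c * c') x = powAct E c (powAct E c' x) := by
  rw [powAct, powAct, powAct, Real.log_mul hc.ne' hc'.ne', add_smul,
    Matrix.exp_add_of_commute _ _ (((Commute.refl E).smul_left _).smul_right _)]
  apply PiLp.ext
  intro j
  simp only [Matrix.ofLp_toLpLin, Matrix.toLin'_apply, Matrix.mulVec_mulVec]

theorem powAct_one (x : EuclideanSpace ℝ (Fin d)) : powAct E 1 x = x := by
  rw [powAct, Real.log_one, zero_smul, NormedSpace.exp_zero]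
  apply PiLp.ext
  intro j
  simp only [Matrix.ofLp_toLpLin, Matrix.toLin'_apply, Matrix.one_mulVec]

theorem powAct_zero (c : ℝ) : powAct E c 0 = 0 := map_zero _

theorem powAct_add (c : ℝ) (x y : EuclideanSpace ℝ (Fin d)) :
    powAct E c (x + y) = powAct E c x + powAct E c y := map_add _ _ _

theorem powAct_sub (c : ℝ) (x y : EuclideanSpace ℝ (Fin d)) :
    powAct E c (x - y) = powAct E c x - powAct E c y := map_sub _ _ _

theorem powAct_neg (c : ℝ) (x : EuclideanSpace ℝ (Fin d)) :
    powAct E c (-x) = - powAct E c x := map_neg _ _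

theorem powAct_smul (c t : ℝ) (x : EuclideanSpace ℝ (Fin d)) :
    powAct E c (t • x) = t • powAct E c x := map_smul _ _ _

theorem powAct_inv_powAct {c : ℝ} (hc : 0 < c) (x : EuclideanSpace ℝ (Fin d)) :
    powAct E c⁻¹ (powAct E c x) = x := by
  rw [← powAct_mul E (inv_pos.2 hc) hc, inv_mul_cancel₀ hc.ne', powAct_one]

theorem powAct_powAct_inv {c : ℝ} (hc : 0 < c) (x : EuclideanSpace ℝ (Fin d)) :
    powAct E c (powAct E c⁻¹ x) = x := by
  rw [← powAct_mul E hc (inv_pos.2 hc), mul_inv_cancel₀ hc.ne', powAct_one]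

theorem continuous_powAct (c : ℝ) : Continuous (powAct E c) :=
  LinearMap.continuous_of_finiteDimensional _

theorem continuousOn_powAct (x : EuclideanSpace ℝ (Fin d)) :
    ContinuousOn (fun c => powAct E c x) (Set.Ioi 0) := by
  have h1 : Continuous (fun s : ℝ => NormedSpace.exp (s • E)) :=
    NormedSpace.exp_continuous.comp (continuous_id.smul continuous_const)
  have h2 : Continuous (fun A : Matrix (Fin d) (Fin d) ℝ => Matrix.toEuclideanLin A x) :=
    LinearMap.continuous_of_finiteDimensional
      ((Matrix.toEuclideanLin.toLinearMap : _ →ₗ[ℝ] _).flip x)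
  exact (h2.comp h1).comp_continuousOn
    (Real.continuousOn_log.mono fun c hc => (ne_of_gt hc : c ≠ 0))

theorem inner_powAct_transpose (c : ℝ) (x y : EuclideanSpace ℝ (Fin d)) :
    inner ℝ x (powAct E.transpose c y) = inner ℝ (powAct E c x) y := by
  simp only [powAct, ← Matrix.transpose_smul, Matrix.exp_transpose]
  rw [EuclideanSpace.inner_eq_star_dotProduct, EuclideanSpace.inner_eq_star_dotProduct]
  simp only [Matrix.ofLp_toLpLin, Matrix.toLin'_apply, star_trivial]
  rw [Matrix.mulVec_transpose, ← Matrix.dotProduct_mulVec, dotProduct_comm]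

/-- The curves exp(sE) and 1 + sE have the same value and velocity at 0, so their determinants have
the same derivative there; for 1 + sE it is a derivative of a polynomial. -/
theorem hasDerivAt_det_exp_smul_zero :
    HasDerivAt (fun s : ℝ => (NormedSpace.exp (s • E)).det) E.trace 0 := by
  have hd : Differentiable ℝ (fun A : Matrix (Fin d) (Fin d) ℝ => A.det) := by
    simp_rw [Matrix.det_apply]
    refine Differentiable.fun_sum fun σ _ => Differentiable.const_smul ?_ _
    refine ContDiff.differentiable (n := 1) (contDiff_prod fun i _ => ?_) one_ne_zero
    let l : Matrix (Fin d) (Fin d) ℝ →ₗ[ℝ] ℝ := Matrix.entryLinearMap ℝ ℝ (σ i) i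
    exact (LinearMap.toContinuousLinearMap l).contDiff
  have h1 : HasDerivAt (fun s : ℝ => (1 : Matrix (Fin d) (Fin d) ℝ) + s • E) E 0 := by
    have h := ((hasDerivAt_id (0 : ℝ)).smul_const E).const_add (1 : Matrix (Fin d) (Fin d) ℝ)
    rw [one_smul] at h
    exact h
  have h2 : HasDerivAt (fun s : ℝ => NormedSpace.exp (s • E)) E 0 := by
    have h := hasDerivAt_exp_smul_const (𝕂 := ℝ) E (0 : ℝ)
    rw [zero_smul, NormedSpace.exp_zero, one_mul] at h
    exact h
  have k1 := (hd 1).hasFDerivAt.comp_hasDerivAt_of_eq (0 : ℝ) h1 (by simp)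
  have k2 := (hd 1).hasFDerivAt.comp_hasDerivAt_of_eq (0 : ℝ) h2 (by simp)
  have k3 : HasDerivAt (fun s : ℝ => ((1 : Matrix (Fin d) (Fin d) ℝ) + s • E).det) E.trace 0 := by
    have h := (Matrix.det (1 + (Polynomial.X : Polynomial ℝ) • E.map Polynomial.C)).hasDerivAt 0
    rw [Matrix.derivative_det_one_add_X_smul] at h
    convert! h using 2 with s
    rw [← Polynomial.coe_evalRingHom, RingHom.map_det]
    congr 1
    ext i j
    rcases eq_or_ne i j with rfl | hij
    · simp
      exact mul_comm _ _
    · simp [hij]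
      exact mul_comm _ _
  rw [← k1.unique k3]
  exact k2

/-- The determinant is multiplicative in s, so its derivative at 0 gives the equation f' = trace(E)
f, which integrates to the exponential. -/
theorem det_exp_smul (s : ℝ) : (NormedSpace.exp (s • E)).det = Real.exp (s * E.trace) := by
  set f : ℝ → ℝ := fun s => (NormedSpace.exp (s • E)).det with hf
  have hadd : ∀ s t, f (s + t) = f s * f t := fun s t => by
    simp only [hf]
    rw [add_smul, Matrix.exp_add_of_commute _ _ (((Commute.refl E).smul_left _).smul_right _),
      Matrix.det_mul]
  have hder : ∀ s, HasDerivAt f (f s * E.trace) s := fun s => by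
    have h1 : HasDerivAt (fun t => f (t - s)) E.trace s := by
      have := (hasDerivAt_det_exp_smul_zero E)
      rw [← sub_self s] at this
      simpa using this.comp_sub_const s s
    have h2 := h1.const_mul (f s)
    convert! h2 using 2 with t
    rw [← hadd]; congr 1; ring
  have hconst : ∀ s, HasDerivAt (fun s => f s * Real.exp (-(s * E.trace))) 0 s := fun s => by
    convert! (hder s).mul (((hasDerivAt_id s).mul_const E.trace).neg.exp) using 1
    simp; ring
  have h := is_const_of_deriv_eq_zero (fun s => (hconst s).differentiableAt)
    (fun s => (hconst s).deriv) s 0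
  simp only [hf, zero_smul, NormedSpace.exp_zero, Matrix.det_one, zero_mul, neg_zero,
    Real.exp_zero, mul_one] at h
  rw [Real.exp_neg, mul_inv_eq_one₀ (Real.exp_ne_zero _)] at h
  exact h

theorem map_volume_powAct {c : ℝ} (hc : 0 < c) :
    Measure.map (powAct E c) volume = ENNReal.ofReal (c ^ (-E.trace)) • volume := by
  have hdet : LinearMap.det (Matrix.toEuclideanLin (NormedSpace.exp (Real.log c • E))) =
      c ^ E.trace := by
    rw [Matrix.toEuclideanLin_eq_toLin_orthonormal, LinearMap.det_toLin, det_exp_smul,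
      Real.rpow_def_of_pos hc]
  have hpos : 0 < c ^ E.trace := Real.rpow_pos_of_pos hc _
  have := Measure.map_linearMap_addHaar_eq_smul_addHaar
    (volume : Measure (EuclideanSpace ℝ (Fin d))) (hdet ▸ hpos.ne')
  rw [hdet, abs_of_pos (inv_pos.2 hpos), ← Real.rpow_neg hc.le] at this
  exact this

theorem lintegral_comp_powAct {c : ℝ} (hc : 0 < c) (g : EuclideanSpace ℝ (Fin d) → ℝ≥0∞)
    (hg : Measurable g) :
    ∫⁻ x, g (powAct E c x) = ENNReal.ofReal (c ^ (-E.trace)) * ∫⁻ x, g x := by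
  rw [← lintegral_map hg (continuous_powAct E c).measurable, map_volume_powAct E hc,
    lintegral_smul_measure, smul_eq_mul]

end


/-! ### Growth of c^E along the spectral flag and contraction at the origin -/

section

open scoped Matrix Matrix.Norms.Operator

variable {d p : ℕ} (E : Matrix (Fin d) (Fin d) ℝ)

theorem re_mem_realSpectrum {μ : ℂ}
    (h : Module.End.maxGenEigenspace (Matrix.toLin' (complexMatrix E)) μ ≠ ⊥) :
    μ.re ∈ realSpectrum E := by
  refine ⟨μ, ?_, rfl⟩
  rw [← Matrix.spectrum_toLin', ← Module.End.hasEigenvalue_iff_mem_spectrum]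
  rw [Module.End.maxGenEigenspace] at h
  exact Module.End.HasUnifEigenvalue.lt (k := ⊤) zero_lt_one h

theorem spectralFlag_le_comap_growthSubmodule {a : Fin p → ℝ} (ha : StrictMono a) (i : Fin p) :
    spectralFlag E a (i + 1) ≤
      ((growthSubmodule (complexMatrix E) (a i)).restrictScalars ℝ).comap (complexify d) := by
  refine iSup₂_le fun j hj => Submodule.comap_mono ?_
  have : a j ≤ a i := ha.monotone (Fin.le_def.2 (Nat.lt_succ_iff.1 hj))
  intro x hx
  have h : (⨆ μ : ℂ, ⨆ _ : μ.re = a j,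
      Module.End.maxGenEigenspace (Matrix.toLin' (complexMatrix E)) μ) ≤
      growthSubmodule (complexMatrix E) (a i) :=
    iSup₂_le fun μ hμ => maxGenEigenspace_le_growthSubmodule _ (hμ.le.trans this)
  exact h hx

theorem exists_norm_powAct_le {a : Fin p → ℝ} (ha : StrictMono a) {i : Fin p}
    {u : EuclideanSpace ℝ (Fin d)} (hu : u ∈ spectralFlag E a (i + 1)) {δ : ℝ} (hδ : 0 < δ) :
    ∃ C, 0 < C ∧ ∀ c : ℝ, 1 ≤ c → ‖powAct E c u‖ ≤ C * c ^ (a i + δ) := by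
  obtain ⟨C, hC⟩ := mem_growthSubmodule.1 (spectralFlag_le_comap_growthSubmodule E ha i hu) δ hδ
  refine ⟨(d + 1) * (|C| + 1), by positivity, fun c hc => ?_⟩
  refine (norm_le_mul_norm_complexify _).trans ?_
  have h := hC (Real.log c) (Real.log_nonneg hc)
  rw [complexify_powAct, mul_assoc]
  rw [Real.rpow_def_of_pos (by linarith), mul_comm (Real.log c)]
  gcongr
  refine h.trans ?_
  gcongr
  linarith [le_abs_self C]

/-- The real part of a complex vector. -/
noncomputable def realPart (d : ℕ) : (Fin d → ℂ) →ₗ[ℝ] EuclideanSpace ℝ (Fin d) where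
  toFun w := WithLp.toLp 2 fun j => (w j).re
  map_add' x y := by ext j; simp
  map_smul' c x := by ext j; simp

theorem realPart_complexify (x : EuclideanSpace ℝ (Fin d)) : realPart d (complexify d x) = x := by
  ext j
  simp [realPart, complexify]

theorem complexify_realPart (w : Fin d → ℂ) :
    complexify d (realPart d w) = (2⁻¹ : ℂ) • (w + star w) := by
  ext j
  simp only [complexify, realPart, LinearMap.coe_mk, AddHom.coe_mk, Pi.smul_apply, Pi.add_apply,
    Pi.star_apply, smul_eq_mul]
  rw [Complex.star_def, Complex.add_conj]
  push_cast
  ring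

/-- E is real, so conjugation exchanges the generalized eigenspaces of conjugate eigenvalues, which
share their real part. -/
theorem star_mem_maxGenEigenspace {μ : ℂ} {w : Fin d → ℂ}
    (hw : w ∈ Module.End.maxGenEigenspace (Matrix.toLin' (complexMatrix E)) μ) :
    star w ∈ Module.End.maxGenEigenspace (Matrix.toLin' (complexMatrix E)) (star μ) := by
  rw [Module.End.mem_maxGenEigenspace] at hw ⊢
  obtain ⟨k, hk⟩ := hw
  refine ⟨k, ?_⟩
  set T := Matrix.toLin' (complexMatrix E) with hT
  have h1 : ∀ x, (T - star μ • 1) (star x) = star ((T - μ • 1) x) := fun x => by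
    have : T (star x) = star (T x) := by
      ext j
      rw [hT, Matrix.toLin'_apply, Matrix.toLin'_apply]
      have := RingHom.map_mulVec (starRingEnd ℂ) (complexMatrix E) x j
      refine Eq.trans ?_ this.symm
      congr 2
      ext i j
      simp [complexMatrix]
    simp [this]
  have h2 : ∀ n : ℕ, ∀ x, ((T - star μ • 1) ^ n) (star x) = star (((T - μ • 1) ^ n) x) := by
    intro n
    induction n with
    | zero => intro x; simp
    | succ n ih =>
      intro x
      rw [pow_succ, pow_succ, Module.End.mul_apply, Module.End.mul_apply, h1, ih]
  rw [h2, hk, star_zero]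

/-- Links the real flag to the complex sum of eigenspaces needed for the lower growth bound: a real
vector in that sum is its own real part, and real parts of the summands stay in the flag. -/
theorem complexify_notMem_of_notMem_spectralFlag {a : Fin p → ℝ} (ha : StrictMono a)
    (hr : Set.range a = realSpectrum E) {i : Fin p}
    {u : EuclideanSpace ℝ (Fin d)} (hu : u ∉ spectralFlag E a i) :
    complexify d u ∉ ⨆ μ ∈ {μ : ℂ | μ.re < a i},
      Module.End.maxGenEigenspace (Matrix.toLin' (complexMatrix E)) μ := by
  intro hmem
  -- Quantifying over all complex multiples makes this a complex subspace, so it can be compared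
  -- with the sum of eigenspaces summand by summand.
  let N : Submodule ℂ (Fin d → ℂ) :=
    { carrier := {w | ∀ z : ℂ, realPart d (z • w) ∈ spectralFlag E a i}
      add_mem' := fun {x y} hx hy z => by
        rw [smul_add, map_add]; exact add_mem (hx z) (hy z)
      zero_mem' := fun z => by rw [smul_zero, map_zero]; exact zero_mem _
      smul_mem' := fun c x hx z => by rw [smul_smul]; exact hx _ }
  have hle : (⨆ μ ∈ {μ : ℂ | μ.re < a i},
      Module.End.maxGenEigenspace (Matrix.toLin' (complexMatrix E)) μ) ≤ N := by
    refine iSup₂_le fun μ hμ w hw z => ?_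
    have hzw := Submodule.smul_mem _ z hw
    by_cases hbot : Module.End.maxGenEigenspace (Matrix.toLin' (complexMatrix E)) μ = ⊥
    · rw [hbot, Submodule.mem_bot] at hzw
      rw [hzw, map_zero]
      exact zero_mem _
    obtain ⟨j, hj⟩ : μ.re ∈ Set.range a := hr ▸ re_mem_realSpectrum E hbot
    have hji : j < i := ha.lt_iff_lt.1 (hj ▸ hμ)
    have hV : spectralSubspace E (a j) ≤ spectralFlag E a i :=
      le_iSup₂_of_le (f := fun (j : Fin p) (_ : (j : ℕ) < i) => spectralSubspace E (a j)) j hji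
        le_rfl
    refine hV ?_
    change complexify d (realPart d (z • w)) ∈ (⨆ μ : ℂ, ⨆ _ : μ.re = a j,
      Module.End.maxGenEigenspace (Matrix.toLin' (complexMatrix E)) μ)
    rw [complexify_realPart]
    have hG : ∀ ν : ℂ, ν.re = a j → Module.End.maxGenEigenspace (Matrix.toLin' (complexMatrix E)) ν
        ≤ ⨆ μ : ℂ, ⨆ _ : μ.re = a j,
          Module.End.maxGenEigenspace (Matrix.toLin' (complexMatrix E)) μ :=
      fun ν hν => le_iSup₂_of_le (f := fun (μ : ℂ) (_ : μ.re = a j) =>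
        Module.End.maxGenEigenspace (Matrix.toLin' (complexMatrix E)) μ) ν hν le_rfl
    refine Submodule.smul_mem _ _ (add_mem (hG μ hj.symm hzw) (hG (star μ) ?_ ?_))
    · simp [hj]
    · exact star_mem_maxGenEigenspace E hzw
  have := hle hmem 1
  rw [one_smul, realPart_complexify] at this
  exact hu this

theorem exists_le_norm_powAct {a : Fin p → ℝ} (ha : StrictMono a)
    (hr : Set.range a = realSpectrum E) {i : Fin p}
    {u : EuclideanSpace ℝ (Fin d)} (hu : u ∉ spectralFlag E a i) {δ : ℝ} (hδ : 0 < δ) :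
    ∃ k, 0 < k ∧ ∀ c : ℝ, 1 ≤ c → k * c ^ (a i - δ) ≤ ‖powAct E c u‖ := by
  obtain ⟨k, hk, h⟩ := exists_le_norm_exp_smul_mulVec (complexMatrix E)
    (complexify_notMem_of_notMem_spectralFlag E ha hr hu) hδ
  refine ⟨k, hk, fun c hc => ?_⟩
  refine le_trans ?_ (norm_complexify_le _)
  rw [complexify_powAct, Real.rpow_def_of_pos (by linarith), mul_comm (Real.log c)]
  exact h (Real.log c) (Real.log_nonneg hc)

/-- `c ^ E` contracts at least like `c ^ l` as `c` tends to `0`. -/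
def IsContractive (E : Matrix (Fin d) (Fin d) ℝ) (l : ℝ) : Prop :=
  ∃ K, 0 < K ∧ ∀ c : ℝ, 0 < c → c ≤ 1 → ∀ x, ‖powAct E c x‖ ≤ K * c ^ l * ‖x‖

theorem isContractive_of_lt {r l : ℝ} (hr : ∀ x ∈ realSpectrum E, r ≤ x) (hl : l < r) :
    IsContractive E l := by
  have htop : ∀ w : Fin d → ℂ, (1 : Matrix (Fin d) (Fin d) ℂ) *ᵥ w ∈
      growthSubmodule (-complexMatrix E) (-r) := fun w => by
    have h : (⊤ : Submodule ℂ (Fin d → ℂ)) ≤ growthSubmodule (-complexMatrix E) (-r) := by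
      rw [← Module.End.iSup_maxGenEigenspace_eq_top (Matrix.toLin' (complexMatrix E))]
      refine iSup_le fun μ => ?_
      by_cases hbot : Module.End.maxGenEigenspace (Matrix.toLin' (complexMatrix E)) μ = ⊥
      · rw [hbot]; exact bot_le
      · exact maxGenEigenspace_le_growthSubmodule_neg _ (hr _ (re_mem_realSpectrum E hbot))
    exact h trivial
  obtain ⟨K, hK, h⟩ := exists_forall_norm_mulVec_le (-complexMatrix E) 1 htop (sub_pos.2 hl)
  refine ⟨(d + 1) * K, by positivity, fun c hc hc1 x => ?_⟩
  refine (norm_le_mul_norm_complexify _).trans ?_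
  have h1 := h (-Real.log c) (by linarith [Real.log_nonpos hc.le hc1]) (complexify d x)
  have e : ((-Real.log c : ℝ) : ℂ) • (-complexMatrix E) = (Real.log c : ℂ) • complexMatrix E := by
    simp
  rw [e, Matrix.one_mulVec] at h1
  rw [complexify_powAct, Real.rpow_def_of_pos hc, mul_assoc, mul_assoc]
  gcongr
  refine h1.trans ?_
  have e2 : (-r + (r - l)) * -Real.log c = Real.log c * l := by ring
  rw [mul_assoc, e2]
  gcongr
  exact norm_complexify_le x

/-- An operator and its adjoint have the same norm: ‖Aᵗy‖² = ⟨A Aᵗy, y⟩. -/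
theorem IsContractive.transpose {E : Matrix (Fin d) (Fin d) ℝ} {l : ℝ} (h : IsContractive E l) :
    IsContractive E.transpose l := by
  obtain ⟨K, hK, h⟩ := h
  refine ⟨K, hK, fun c hc hc1 y => ?_⟩
  have h1 : ‖powAct E.transpose c y‖ * ‖powAct E.transpose c y‖ ≤
      (K * c ^ l * ‖y‖) * ‖powAct E.transpose c y‖ := by
    rw [← real_inner_self_eq_norm_mul_norm, inner_powAct_transpose]
    refine (real_inner_le_norm _ _).trans ?_
    have := h c hc hc1 (powAct E.transpose c y)
    calc _ ≤ K * c ^ l * ‖powAct E.transpose c y‖ * ‖y‖ := by gcongr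
      _ = _ := by ring
  rcases (norm_nonneg (powAct E.transpose c y)).eq_or_lt with h0 | h0
  · rw [← h0]
    have := Real.rpow_nonneg hc.le l
    positivity
  · exact le_of_mul_le_mul_right h1 h0

end


/-! ### Radial functions and square integrability of their powers -/

section

variable {d : ℕ} {F : Matrix (Fin d) (Fin d) ℝ} {l : ℝ}

theorem exists_forall_norm_powAct_le (F : Matrix (Fin d) (Fin d) ℝ) (c : ℝ) :
    ∃ K, 0 < K ∧ ∀ x, ‖powAct F c x‖ ≤ K * ‖x‖ := by
  set L := LinearMap.toContinuousLinearMap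
    (Matrix.toEuclideanLin (NormedSpace.exp (Real.log c • F)))
  refine ⟨‖L‖ + 1, by positivity, fun x => ?_⟩
  have : ‖L x‖ ≤ ‖L‖ * ‖x‖ := L.le_opNorm x
  calc ‖powAct F c x‖ = ‖L x‖ := rfl
    _ ≤ _ := this.trans (by gcongr; linarith)

theorem IsContractive.tendsto_powAct (hF : IsContractive F l) (hl : 0 < l)
    (x : EuclideanSpace ℝ (Fin d)) : Tendsto (fun c => powAct F c x) (𝓝[>] 0) (𝓝 0) := by
  obtain ⟨K, hK, h⟩ := hF
  have h0 : Tendsto (fun c : ℝ => K * c ^ l * ‖x‖) (𝓝[>] 0) (𝓝 0) := by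
    have : Tendsto (fun c : ℝ => c ^ l) (𝓝[>] 0) (𝓝 0) := by
      have := (Real.continuousAt_rpow_const 0 l (Or.inr hl.le)).tendsto
      rw [Real.zero_rpow hl.ne'] at this
      exact this.mono_left nhdsWithin_le_nhds
    simpa using (this.const_mul K).mul_const ‖x‖
  refine squeeze_zero_norm' ?_ h0
  filter_upwards [Ioc_mem_nhdsGT (zero_lt_one' ℝ)] with c hc
  exact h c hc.1 hc.2 x

/-- Polar coordinates with respect to `c ^ F` and the unit sphere. -/
theorem IsContractive.exists_norm_powAct_eq_one (hF : IsContractive F l) (hl : 0 < l)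
    {x : EuclideanSpace ℝ (Fin d)} (hx : x ≠ 0) : ∃ c, 0 < c ∧ ‖powAct F c x‖ = 1 := by
  have hsmall := (hF.tendsto_powAct hl x).norm
  rw [norm_zero] at hsmall
  obtain ⟨c₀, h₀, hc₀⟩ := ((hsmall.eventually_lt_const (zero_lt_one' ℝ)).and
    self_mem_nhdsWithin).exists
  obtain ⟨K, hK, h⟩ := hF
  have hx' : 0 < ‖x‖ := norm_pos_iff.2 hx
  -- Contraction by c⁻¹ applied to c^F x gives c^l ‖x‖ ≤ K ‖c^F x‖, so the orbit leaves the unit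
  -- ball; it meets the sphere by continuity.
  obtain ⟨c₁, hc₁, h₁⟩ : ∃ c₁ : ℝ, 0 < c₁ ∧ 1 ≤ ‖powAct F c₁ x‖ := by
    have := (tendsto_rpow_atTop hl).eventually_ge_atTop (K / ‖x‖)
    obtain ⟨c, hc, hc1⟩ := (this.and (eventually_ge_atTop 1)).exists
    have hc0 : 0 < c := by linarith
    refine ⟨c, hc0, ?_⟩
    have h2 := h c⁻¹ (inv_pos.2 hc0) (inv_le_one_of_one_le₀ hc1) (powAct F c x)
    rw [powAct_inv_powAct F hc0, Real.inv_rpow hc0.le] at h2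
    have hcl : 0 < c ^ l := Real.rpow_pos_of_pos hc0 l
    rw [div_le_iff₀ hx'] at hc
    have h3 : c ^ l * ‖x‖ ≤ K * ‖powAct F c x‖ := by
      calc c ^ l * ‖x‖ ≤ c ^ l * (K * (c ^ l)⁻¹ * ‖powAct F c x‖) := by gcongr
        _ = _ := by field_simp
    have h4 : K * 1 ≤ K * ‖powAct F c x‖ := by linarith
    exact le_of_mul_le_mul_left h4 hK
  have hcont : ContinuousOn (fun c => ‖powAct F c x‖) (Set.Ioi 0) := (continuousOn_powAct F x).norm
  obtain ⟨c, hc, he⟩ := isPreconnected_Ioi.intermediate_value hc₀ hc₁ hcont ⟨h₀.le, h₁⟩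
  exact ⟨c, hc, he⟩

/-- A radial function for the one-parameter group `c ^ F`: continuous, homogeneous, and positive
away from the origin. -/
structure IsRadial (F : Matrix (Fin d) (Fin d) ℝ) (φ : EuclideanSpace ℝ (Fin d) → ℝ) : Prop where
  continuous : Continuous φ
  map_powAct : ∀ c, 0 < c → ∀ x, φ (powAct F c x) = c * φ x
  pos : ∀ x, x ≠ 0 → 0 < φ x

variable {φ : EuclideanSpace ℝ (Fin d) → ℝ}

theorem IsRadial.map_zero (h : IsRadial F φ) : φ 0 = 0 := by
  have := h.map_powAct 2 two_pos 0
  rw [powAct_zero] at this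
  linarith

theorem IsRadial.nonneg (h : IsRadial F φ) (x : EuclideanSpace ℝ (Fin d)) : 0 ≤ φ x := by
  rcases eq_or_ne x 0 with rfl | hx
  · rw [h.map_zero]
  · exact (h.pos x hx).le

/-- Homogeneity is given off the origin only; at the origin it follows from φ(0) = lim φ(c^F x) =
lim c φ(x) = 0 as c tends to 0, for any nonzero x. -/
theorem isRadial_of_isHomogeneous [Nontrivial (EuclideanSpace ℝ (Fin d))] (hF : IsContractive F l)
    (hl : 0 < l) (hc : Continuous φ) (hh : IsHomogeneous F φ) (hp : ∀ x, x ≠ 0 → 0 < φ x) :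
    IsRadial F φ := by
  have h0 : φ 0 = 0 := by
    obtain ⟨x, hx⟩ := exists_ne (0 : EuclideanSpace ℝ (Fin d))
    have h1 := (hc.tendsto 0).comp (hF.tendsto_powAct hl x)
    have h2 : Tendsto (fun c : ℝ => c * φ x) (𝓝[>] 0) (𝓝 0) := by
      have : Tendsto (fun c : ℝ => c * φ x) (𝓝 0) (𝓝 (0 * φ x)) :=
        (continuous_id.mul continuous_const).tendsto 0
      rw [zero_mul] at this
      exact this.mono_left nhdsWithin_le_nhds
    refine tendsto_nhds_unique (h1.congr' ?_) h2
    filter_upwards [self_mem_nhdsWithin] with c hc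
    exact hh c hc x hx
  refine ⟨hc, fun c hc x => ?_, hp⟩
  rcases eq_or_ne x 0 with rfl | hx
  · rw [powAct_zero, h0, mul_zero]
  · exact hh c hc x hx

namespace IsRadial

/-- Let m be the minimum of φ on the Euclidean unit sphere. If φ(x) = 1 and c^F x lies on the
sphere, then c = φ(c^F x) ≥ m, so x arises from a vector of bounded norm by (m/c)^F with m/c ≤ 1. -/
theorem exists_norm_le_of_eq_one (h : IsRadial F φ) (hF : IsContractive F l) (hl : 0 < l) :
    ∃ R, 0 < R ∧ ∀ x, φ x = 1 → ‖x‖ ≤ R := by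
  obtain ⟨m, hm, hmb⟩ : ∃ m, 0 < m ∧ ∀ x, ‖x‖ = 1 → m ≤ φ x := by
    by_cases hne : (Metric.sphere (0 : EuclideanSpace ℝ (Fin d)) 1).Nonempty
    · obtain ⟨y, hy, hmin⟩ := (isCompact_sphere (0 : EuclideanSpace ℝ (Fin d)) 1).exists_isMinOn hne
        h.continuous.continuousOn
      refine ⟨φ y, h.pos y ?_, fun x hx => hmin (by simpa using hx)⟩
      rintro rfl
      simp at hy
    · exact ⟨1, one_pos, fun x hx => (hne ⟨x, by simpa using hx⟩).elim⟩
  obtain ⟨M, hM, hMb⟩ := exists_forall_norm_powAct_le F m⁻¹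
  obtain ⟨K, hK, hKb⟩ := hF
  refine ⟨K * M, by positivity, fun x hx => ?_⟩
  have hx0 : x ≠ 0 := by
    rintro rfl
    rw [h.map_zero] at hx
    exact zero_ne_one hx
  obtain ⟨c, hc, hcx⟩ := IsContractive.exists_norm_powAct_eq_one ⟨K, hK, hKb⟩ hl hx0
  have h1 := hmb _ hcx
  rw [h.map_powAct c hc, hx, mul_one] at h1
  have e : x = powAct F (m / c) (powAct F m⁻¹ (powAct F c x)) := by
    rw [← powAct_mul F (by positivity) (by positivity), ← powAct_mul F (by positivity)
      (by positivity)]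
    rw [show m / c * m⁻¹ * c = 1 by field_simp, powAct_one]
  have h2 := hKb (m / c) (by positivity) ((div_le_one hc).2 h1) (powAct F m⁻¹ (powAct F c x))
  rw [← e] at h2
  have h3 := hMb (powAct F c x)
  rw [hcx, mul_one] at h3
  have h4 : (m / c) ^ l ≤ 1 := Real.rpow_le_one (by positivity) ((div_le_one hc).2 h1) hl.le
  calc ‖x‖ ≤ K * (m / c) ^ l * ‖powAct F m⁻¹ (powAct F c x)‖ := h2
    _ ≤ K * 1 * M := by gcongr
    _ = _ := by ring

/-- Contract the level set φ = 1 by φ(x)^F. This controls the harmonizable kernel at low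
frequencies. -/
theorem exists_norm_le_rpow (h : IsRadial F φ) (hF : IsContractive F l) (hl : 0 < l) :
    ∃ R, 0 < R ∧ ∀ x, φ x ≤ 1 → ‖x‖ ≤ R * φ x ^ l := by
  obtain ⟨R, hR, hRb⟩ := h.exists_norm_le_of_eq_one hF hl
  obtain ⟨K, hK, hKb⟩ := hF
  refine ⟨K * R, by positivity, fun x hx => ?_⟩
  rcases eq_or_ne x 0 with rfl | hx0
  · rw [h.map_zero, Real.zero_rpow hl.ne']; simp
  have hp := h.pos x hx0
  have h1 := hRb (powAct F (φ x)⁻¹ x) (by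
    rw [h.map_powAct _ (inv_pos.2 hp), inv_mul_cancel₀ hp.ne'])
  have h2 := hKb (φ x) hp hx (powAct F (φ x)⁻¹ x)
  rw [powAct_powAct_inv F hp] at h2
  refine h2.trans ?_
  have := Real.rpow_nonneg hp.le l
  calc _ ≤ K * φ x ^ l * R := by gcongr
    _ = _ := by ring

theorem exists_norm_le (h : IsRadial F φ) (hF : IsContractive F l) (hl : 0 < l) (r : ℝ) :
    ∃ R, 0 < R ∧ ∀ x, φ x ≤ r → ‖x‖ ≤ R := by
  obtain ⟨R, hR, hRb⟩ := h.exists_norm_le_rpow hF hl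
  set r' := max r 1 with hr'
  have hr0 : 0 < r' := by positivity
  obtain ⟨M, hM, hMb⟩ := exists_forall_norm_powAct_le F r'
  refine ⟨M * R, by positivity, fun x hx => ?_⟩
  have h1 : φ (powAct F r'⁻¹ x) ≤ 1 := by
    rw [h.map_powAct _ (by positivity), inv_mul_le_one₀ hr0]
    exact hx.trans (le_max_left _ _)
  have h2 := hMb (powAct F r'⁻¹ x)
  rw [powAct_powAct_inv F hr0] at h2
  refine h2.trans ?_
  gcongr
  refine (hRb _ h1).trans ?_
  calc _ ≤ R * 1 := by
        gcongr
        exact Real.rpow_le_one (h.nonneg _) h1 hl.le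
    _ = R := mul_one R

theorem exists_le_norm_of_eq_one (h : IsRadial F φ) :
    ∃ A, 0 < A ∧ ∀ x, φ x = 1 → A ≤ ‖x‖ := by
  have : ∀ᶠ x in 𝓝 0, φ x < 1 := by
    have := h.continuous.tendsto 0
    rw [h.map_zero] at this
    exact this.eventually_lt_const one_pos
  obtain ⟨A, hA, hAb⟩ := Metric.eventually_nhds_iff.1 this
  refine ⟨A, hA, fun x hx => ?_⟩
  by_contra! hlt
  have := hAb (y := x) (by simpa using hlt)
  linarith

/-- The integral of a power of `φ` over a shell scales like a power of its radius. -/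
theorem lintegral_shell (h : IsRadial F φ) (κ : ℝ) {c : ℝ} (hc : 0 < c) :
    ∫⁻ x, (Set.Icc c (2 * c)).indicator (fun t => ENNReal.ofReal (t ^ κ)) (φ x) =
      ENNReal.ofReal (c ^ (κ + F.trace)) *
        ∫⁻ x, (Set.Icc 1 2).indicator (fun t : ℝ => ENNReal.ofReal (t ^ κ)) (φ x) := by
  have hmeas : Measurable fun t : ℝ => ENNReal.ofReal (t ^ κ) := by fun_prop
  have e := lintegral_comp_powAct F hc
    (fun x => (Set.Icc c (2 * c)).indicator (fun t => ENNReal.ofReal (t ^ κ)) (φ x))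
    ((hmeas.indicator measurableSet_Icc).comp h.continuous.measurable)
  have e2 : ∀ x, (Set.Icc c (2 * c)).indicator (fun t => ENNReal.ofReal (t ^ κ))
      (φ (powAct F c x)) = ENNReal.ofReal (c ^ κ) *
        (Set.Icc 1 2).indicator (fun t : ℝ => ENNReal.ofReal (t ^ κ)) (φ x) := fun x => by
    rw [h.map_powAct c hc]
    by_cases hx : φ x ∈ Set.Icc (1 : ℝ) 2
    · rw [Set.indicator_of_mem hx, Set.indicator_of_mem, Real.mul_rpow hc.le (h.nonneg x),
        ENNReal.ofReal_mul (by positivity)]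
      constructor <;> nlinarith [hx.1, hx.2]
    · rw [Set.indicator_of_notMem hx, Set.indicator_of_notMem, mul_zero]
      rintro ⟨h1, h2⟩
      refine hx ⟨?_, ?_⟩
      · exact le_of_mul_le_mul_left (by linarith) hc
      · exact le_of_mul_le_mul_left (by linarith) hc
  simp_rw [e2] at e
  rw [lintegral_const_mul' _ _ ENNReal.ofReal_ne_top] at e
  have hq : ENNReal.ofReal (c ^ F.trace) * ENNReal.ofReal (c ^ (-F.trace)) = 1 := by
    rw [← ENNReal.ofReal_mul (by positivity), ← Real.rpow_add hc, add_neg_cancel, Real.rpow_zero,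
      ENNReal.ofReal_one]
  rw [Real.rpow_add hc, mul_comm (c ^ κ), ENNReal.ofReal_mul (by positivity), mul_assoc, e,
    ← mul_assoc, hq, one_mul]

theorem lintegral_shell_one_lt_top (h : IsRadial F φ) (hF : IsContractive F l) (hl : 0 < l)
    (κ : ℝ) :
    ∫⁻ x, (Set.Icc 1 2).indicator (fun t : ℝ => ENNReal.ofReal (t ^ κ)) (φ x) < ⊤ := by
  obtain ⟨R, hR, hRb⟩ := h.exists_norm_le hF hl 2
  have hle : ∀ x, (Set.Icc 1 2).indicator (fun t : ℝ => ENNReal.ofReal (t ^ κ)) (φ x) ≤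
      (Metric.closedBall (0 : EuclideanSpace ℝ (Fin d)) R).indicator
        (fun _ => ENNReal.ofReal (2 ^ |κ|)) x := fun x => by
    by_cases hx : φ x ∈ Set.Icc (1 : ℝ) 2
    · rw [Set.indicator_of_mem hx, Set.indicator_of_mem (by simpa using hRb x hx.2)]
      refine ENNReal.ofReal_le_ofReal ?_
      calc φ x ^ κ ≤ φ x ^ |κ| := Real.rpow_le_rpow_of_exponent_le hx.1 (le_abs_self κ)
        _ ≤ _ := Real.rpow_le_rpow (by linarith [hx.1]) hx.2 (abs_nonneg κ)
    · rw [Set.indicator_of_notMem hx]; exact zero_le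
  refine (lintegral_mono hle).trans_lt ?_
  rw [lintegral_indicator_const measurableSet_closedBall]
  exact ENNReal.mul_lt_top ENNReal.ofReal_lt_top measure_closedBall_lt_top

/-- By scaling, the shells of radii r b^n contribute a geometric series of ratio b^(κ + q), with q
the trace. -/
theorem tsum_lintegral_shell_lt_top (h : IsRadial F φ) (hF : IsContractive F l) (hl : 0 < l)
    {κ r b : ℝ} (hr : 0 < r) (hb : 0 < b) (hb1 : b ^ (κ + F.trace) < 1) :
    ∑' n : ℕ, ∫⁻ x, (Set.Icc (r * b ^ n) (2 * (r * b ^ n))).indicator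
      (fun t => ENNReal.ofReal (t ^ κ)) (φ x) < ⊤ := by
  have e : ∀ n : ℕ, ∫⁻ x, (Set.Icc (r * b ^ n) (2 * (r * b ^ n))).indicator
      (fun t => ENNReal.ofReal (t ^ κ)) (φ x) =
      (ENNReal.ofReal (r ^ (κ + F.trace)) *
        ∫⁻ x, (Set.Icc 1 2).indicator (fun t : ℝ => ENNReal.ofReal (t ^ κ)) (φ x)) *
      (ENNReal.ofReal (b ^ (κ + F.trace))) ^ n := fun n => by
    rw [h.lintegral_shell κ (by positivity), Real.mul_rpow hr.le (by positivity),
      ENNReal.ofReal_mul (by positivity), ← ENNReal.ofReal_pow (by positivity),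
      ← Real.rpow_natCast b n, ← Real.rpow_mul hb.le, mul_comm (n : ℝ),
      Real.rpow_mul hb.le, Real.rpow_natCast]
    ring
  simp_rw [e]
  rw [ENNReal.tsum_mul_left, ENNReal.tsum_geometric]
  refine ENNReal.mul_lt_top (ENNReal.mul_lt_top ENNReal.ofReal_lt_top
    (h.lintegral_shell_one_lt_top hF hl κ)) ?_
  rw [ENNReal.inv_lt_top, tsub_pos_iff_lt]
  exact ENNReal.ofReal_lt_one.2 hb1

theorem memLp_of_shells (h : IsRadial F φ) (hF : IsContractive F l) (hl : 0 < l)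
    [Nontrivial (EuclideanSpace ℝ (Fin d))]
    {κ r b : ℝ} (hr : 0 < r) (hb : 0 < b) (hb1 : b ^ (2 * κ + F.trace) < 1)
    {S : Set ℝ} (hS : MeasurableSet S)
    (hcov : ∀ t ∈ S, 0 < t → ∃ n : ℕ, t ∈ Set.Icc (r * b ^ n) (2 * (r * b ^ n))) :
    MemLp (fun x => S.indicator (fun t => t ^ κ) (φ x)) 2 volume := by
  have hm : Measurable fun x => S.indicator (fun t => t ^ κ) (φ x) :=
    ((measurable_id.pow_const κ).indicator hS).comp h.continuous.measurable
  refine ⟨hm.aestronglyMeasurable, ?_⟩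
  have h2 := h.tsum_lintegral_shell_lt_top hF hl hr hb hb1
  rw [← lintegral_tsum fun n => by
    exact (((measurable_id.pow_const (2 * κ)).ennreal_ofReal.indicator
      measurableSet_Icc).comp h.continuous.measurable).aemeasurable] at h2
  have hle : eLpNorm (fun x => S.indicator (fun t => t ^ κ) (φ x)) 2 volume ^ 2 < ⊤ := by
    rw [eLpNorm_two_sq]
    refine lt_of_le_of_lt (lintegral_mono_ae ?_) h2
    -- The shells miss the origin, which is a null set.
    filter_upwards [(measure_eq_zero_iff_ae_notMem.1
      (measure_singleton (0 : EuclideanSpace ℝ (Fin d))))] with x hx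
    by_cases hxS : φ x ∈ S
    · have hx0 : 0 < φ x := h.pos x hx
      obtain ⟨n, hn⟩ := hcov _ hxS hx0
      refine le_trans (le_of_eq ?_) (ENNReal.le_tsum n)
      rw [Set.indicator_of_mem hxS, Set.indicator_of_mem hn, ← ofReal_norm, Real.norm_eq_abs,
        abs_of_nonneg (by positivity), ← ENNReal.ofReal_pow (by positivity), mul_comm 2 κ,
        Real.rpow_mul hx0.le]
      norm_cast
    · rw [Set.indicator_of_notMem hxS]; simp
  exact (ENNReal.pow_lt_top_iff.1 hle).resolve_right two_ne_zero

theorem memLp_indicator_Iic (h : IsRadial F φ) (hF : IsContractive F l) (hl : 0 < l)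
    [Nontrivial (EuclideanSpace ℝ (Fin d))] {κ : ℝ} (hκ : 0 < 2 * κ + F.trace) {r : ℝ}
    (hr : 0 < r) :
    MemLp (fun x => (Set.Iic r).indicator (fun t => t ^ κ) (φ x)) 2 volume := by
  -- Shells [c, 2c] with c = (r/2) 2^(-n) exhaust (0, r].
  refine h.memLp_of_shells hF hl (r := r / 2) (b := 1 / 2) (by positivity) (by positivity)
    (Real.rpow_lt_one (by positivity) (by norm_num) hκ) measurableSet_Iic fun t ht ht0 => ?_
  obtain ⟨n, h1, h2⟩ := exists_nat_pow_near_of_lt_one (div_pos ht0 hr) ((div_le_one hr).2 ht)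
    (one_half_pos (α := ℝ)) one_half_lt_one
  rw [lt_div_iff₀ hr, pow_succ] at h1
  rw [div_le_iff₀ hr] at h2
  exact ⟨n, by linarith, by linarith⟩

theorem memLp_indicator_Ici (h : IsRadial F φ) (hF : IsContractive F l) (hl : 0 < l)
    [Nontrivial (EuclideanSpace ℝ (Fin d))] {κ : ℝ} (hκ : 2 * κ + F.trace < 0) {r : ℝ}
    (hr : 0 < r) :
    MemLp (fun x => (Set.Ici r).indicator (fun t => t ^ κ) (φ x)) 2 volume := by
  refine h.memLp_of_shells hF hl (r := r) (b := 2) hr two_pos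
    (Real.rpow_lt_one_of_one_lt_of_neg one_lt_two hκ) measurableSet_Ici fun t ht ht0 => ?_
  obtain ⟨n, h1, h2⟩ := exists_nat_pow_near ((one_le_div hr).2 ht) (one_lt_two (α := ℝ))
  rw [le_div_iff₀ hr] at h1
  rw [div_lt_iff₀ hr, pow_succ] at h2
  exact ⟨n, by linarith, by linarith⟩

end IsRadial

theorem eLpNorm_comp_powAct {G : Type*} [NormedAddCommGroup G] {c : ℝ} (hc : 0 < c)
    {g : EuclideanSpace ℝ (Fin d) → G} (hg : AEStronglyMeasurable g volume) :
    eLpNorm (fun x => g (powAct F c x)) 2 volume =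
      ENNReal.ofReal (c ^ (-(F.trace / 2))) * eLpNorm g 2 volume := by
  have hmap := map_volume_powAct F hc
  have hg' : AEStronglyMeasurable g (Measure.map (powAct F c) volume) := by
    rw [hmap]; exact hg.smul_measure _
  have h := eLpNorm_map_measure (p := 2) hg' (continuous_powAct F c).aemeasurable
  rw [hmap, eLpNorm_smul_measure_of_ne_top (by simp), ENNReal.ofReal_rpow_of_nonneg (by positivity)
    (by simp), ← Real.rpow_mul hc.le] at h
  refine h.symm.trans ?_
  rw [smul_eq_mul]
  congr 3
  simp
  ring

end

/-! ### Scaling kernels and the moving average kernel -/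

open scoped Pointwise

section

variable {d : ℕ} {E : Matrix (Fin d) (Fin d) ℝ} {l : ℝ}

/-- A family of square integrable kernels whose `L²` norms behave like the scaling function of an
operator scaling random field with stationary increments. -/
structure IsScalingKernel {𝕜 : Type*} [RCLike 𝕜] (E : Matrix (Fin d) (Fin d) ℝ) (H : ℝ)
    (k : EuclideanSpace ℝ (Fin d) → EuclideanSpace ℝ (Fin d) → 𝕜) : Prop where
  memLp : ∀ x, MemLp (k x) 2 volume
  eLpNorm_sub : ∀ x y, eLpNorm (k x - k y) 2 volume = eLpNorm (k (x - y)) 2 volume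
  eLpNorm_powAct : ∀ c, 0 < c → ∀ x,
    eLpNorm (k (powAct E c x)) 2 volume = ENNReal.ofReal (c ^ H) * eLpNorm (k x) 2 volume
  tendsto : ∀ (x : ℕ → EuclideanSpace ℝ (Fin d)) (x₀ : EuclideanSpace ℝ (Fin d)),
    Tendsto x atTop (𝓝 x₀) → ∀ᵐ y, Tendsto (fun n => k (x n) y) atTop (𝓝 (k x₀ y))
  eLpNorm_ne_zero : ∀ x, x ≠ 0 → eLpNorm (k x) 2 volume ≠ 0

theorem radialPart_nonneg (x : EuclideanSpace ℝ (Fin d)) : 0 ≤ radialPart E x :=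
  Real.sInf_nonneg fun _ hr => hr.1.le

/-- The set under the infimum is scaled by c. Apart from nonnegativity this is all the proof needs
about τ. -/
theorem radialPart_powAct {c : ℝ} (hc : 0 < c) (x : EuclideanSpace ℝ (Fin d)) :
    radialPart E (powAct E c x) = c * radialPart E x := by
  rw [radialPart, radialPart, ← smul_eq_mul, ← Real.sInf_smul_of_nonneg hc.le]
  congr 1
  ext r
  rw [Set.mem_smul_set_iff_inv_smul_mem₀ hc.ne']
  change (0 < r ∧ _) ↔ (0 < c⁻¹ • r ∧ _)
  rw [smul_eq_mul]
  have hcr : 0 < c⁻¹ * r ↔ 0 < r := mul_pos_iff_of_pos_left (inv_pos.2 hc)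
  rw [hcr]
  refine and_congr_right fun hr => ?_
  rw [← powAct_mul E (inv_pos.2 hr) hc, mul_inv, inv_inv, mul_comm]

theorem exists_abs_rpow_sub_one_le (ρ : ℝ) :
    ∃ L, 0 < L ∧ ∀ t : ℝ, |t - 1| ≤ 1 / 2 → |t ^ ρ - 1| ≤ L * |t - 1| := by
  obtain ⟨L, hL⟩ := (isCompact_Icc (a := (1 / 2 : ℝ)) (b := 3 / 2)).exists_bound_of_continuousOn
    (f := fun t => ρ * t ^ (ρ - 1))
    (continuousOn_const.mul (continuousOn_id.rpow_const fun t ht => Or.inl (by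
      have : (0 : ℝ) < t := by linarith [ht.1]
      exact this.ne')))
  refine ⟨|L| + 1, by positivity, fun t ht => ?_⟩
  rw [abs_le] at ht
  have h := (convex_Icc (1 / 2 : ℝ) (3 / 2)).norm_image_sub_le_of_norm_hasDerivWithin_le
    (f := fun t : ℝ => t ^ ρ) (f' := fun t => ρ * t ^ (ρ - 1)) (x := 1) (y := t)
    (fun t ht => (Real.hasDerivAt_rpow_const (Or.inl (by
      have : (0 : ℝ) < t := by linarith [ht.1]
      exact this.ne'))).hasDerivWithinAt) hL ⟨by norm_num, by norm_num⟩
    ⟨by linarith, by linarith⟩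
  rw [Real.one_rpow, Real.norm_eq_abs, Real.norm_eq_abs] at h
  refine h.trans ?_
  gcongr
  linarith [le_abs_self L]

/-- The kernel of the moving average field. -/
noncomputable def movingAverageKernel (φ : EuclideanSpace ℝ (Fin d) → ℝ) (ρ : ℝ)
    (x y : EuclideanSpace ℝ (Fin d)) : ℝ :=
  φ (x - y) ^ ρ - φ (-y) ^ ρ

variable {φ : EuclideanSpace ℝ (Fin d) → ℝ}

/-- Put r = φ(-y) and rescale by r^(-E): then -y moves to the level set φ = 1 and τ(x) becomes
τ(x)/r. Admissibility gives φ(x - y)/r = 1 + O((τ(x)/r)^β), and the power ρ preserves this order,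
which yields r^(ρ - β). -/
theorem IsRadial.exists_abs_movingAverageKernel_le (h : IsRadial E φ) (hE : IsContractive E l)
    (hl : 0 < l) {β : ℝ} (hβ : 0 < β) (hadm : IsAdmissible β E φ) (ρ : ℝ)
    (x : EuclideanSpace ℝ (Fin d)) :
    ∃ R M, 0 < R ∧ ∀ y, R ≤ φ (-y) → |movingAverageKernel φ ρ x y| ≤ M * φ (-y) ^ (ρ - β) := by
  obtain ⟨A, hA, hAb⟩ := h.exists_le_norm_of_eq_one
  obtain ⟨R, hR, hRb⟩ := h.exists_norm_le_of_eq_one hE hl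
  -- An annulus containing the level set φ = 1; the outer radius R + A makes it strictly larger than
  -- A.
  obtain ⟨C, hC, hCb⟩ := hadm.bound A (R + A) hA (by linarith)
  obtain ⟨L, hL, hLb⟩ := exists_abs_rpow_sub_one_le ρ
  set τ := radialPart E x with hτ
  have hτ0 : 0 ≤ τ := radialPart_nonneg x
  have hlim : Tendsto (fun r : ℝ => C * (r⁻¹ * τ) ^ β) atTop (𝓝 0) := by
    have h1 : Tendsto (fun r : ℝ => r⁻¹ * τ) atTop (𝓝 0) := by
      simpa using tendsto_inv_atTop_zero.mul_const τ
    have h2 := (Real.continuousAt_rpow_const 0 β (Or.inr hβ.le)).tendsto.comp h1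
    rw [Real.zero_rpow hβ.ne'] at h2
    simpa using h2.const_mul C
  -- For r ≥ R₀ the rescaled shift satisfies τ ≤ 1, and φ(x - y)/r is within 1/2 of 1.
  obtain ⟨R₀, hR₀⟩ := eventually_atTop.1 ((hlim.eventually_le_const (one_half_pos (α := ℝ))).and
    ((eventually_ge_atTop τ).and (eventually_gt_atTop 0)))
  refine ⟨R₀, L * (C * τ ^ β), (hR₀ R₀ le_rfl).2.2, fun y hy => ?_⟩
  obtain ⟨h1, h2, h3⟩ := hR₀ _ hy
  set r := φ (-y) with hr
  have hφ : φ (powAct E r⁻¹ (-y)) = 1 := by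
    rw [h.map_powAct _ (inv_pos.2 h3), inv_mul_cancel₀ h3.ne']
  have h4 := hCb (powAct E r⁻¹ x) (powAct E r⁻¹ (-y)) (hAb _ hφ)
    ((hRb _ hφ).trans (by linarith)) (by
      rw [radialPart_powAct (inv_pos.2 h3), inv_mul_le_one₀ h3]; exact h2)
  rw [radialPart_powAct (inv_pos.2 h3), ← powAct_add, ← sub_eq_add_neg,
    h.map_powAct _ (inv_pos.2 h3), hφ] at h4
  have h5 := hLb _ (h4.trans h1)
  have e : movingAverageKernel φ ρ x y = r ^ ρ * ((r⁻¹ * φ (x - y)) ^ ρ - 1) := by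
    rw [movingAverageKernel, Real.mul_rpow (by positivity) (h.nonneg _), mul_sub, mul_one,
      ← mul_assoc, ← Real.mul_rpow h3.le (by positivity), mul_inv_cancel₀ h3.ne', Real.one_rpow,
      one_mul]
  rw [e, abs_mul, abs_of_pos (Real.rpow_pos_of_pos h3 ρ), Real.rpow_sub h3]
  calc r ^ ρ * |(r⁻¹ * φ (x - y)) ^ ρ - 1| ≤ r ^ ρ * (L * (C * (r⁻¹ * τ) ^ β)) := by
        gcongr
        exact h5.trans (by gcongr)
    _ = _ := by
      rw [Real.mul_rpow (by positivity) hτ0, Real.inv_rpow h3.le]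
      ring

theorem measurable_movingAverageKernel (hφ : Continuous φ) (ρ : ℝ)
    (x : EuclideanSpace ℝ (Fin d)) : Measurable (movingAverageKernel φ ρ x) := by
  have := hφ.measurable
  unfold movingAverageKernel
  fun_prop

/-- Near their singularities both terms are square integrable since 2ρ + q = 2H > 0. At infinity
cancellation leaves the exponent ρ - β, with 2(ρ - β) + q = 2(H - β) < 0. -/
theorem memLp_movingAverageKernel [Nontrivial (EuclideanSpace ℝ (Fin d))] (h : IsRadial E φ)
    (hE : IsContractive E l) (hl : 0 < l) {β H : ℝ} (hadm : IsAdmissible β E φ) (hH : 0 < H)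
    (hHβ : H < β) (x : EuclideanSpace ℝ (Fin d)) :
    MemLp (movingAverageKernel φ (H - E.trace / 2) x) 2 volume := by
  set ρ := H - E.trace / 2 with hρ
  obtain ⟨R, M, hR, hM⟩ := h.exists_abs_movingAverageKernel_le hE hl (hH.trans hHβ) hadm ρ x
  obtain ⟨R₁, hR₁, hR₁b⟩ := h.exists_norm_le hE hl R
  obtain ⟨R₂, hR₂⟩ := (isCompact_closedBall (0 : EuclideanSpace ℝ (Fin d))
    (‖x‖ + R₁)).exists_bound_of_continuousOn h.continuous.continuousOn
  set R₃ := |R₂| + 1 with hR₃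
  have hR₃0 : 0 < R₃ := by positivity
  have m1 := h.memLp_indicator_Iic hE hl (κ := ρ) (by rw [hρ]; linarith) hR
  have m2 := h.memLp_indicator_Iic hE hl (κ := ρ) (by rw [hρ]; linarith) hR₃0
  have m3 := h.memLp_indicator_Ici hE hl (κ := ρ - β) (by rw [hρ]; linarith) hR
  have n1 := m1.comp_measurePreserving (Measure.measurePreserving_neg volume)
  have n2 := m2.comp_measurePreserving (Measure.measurePreserving_sub_left volume x)
  have n3 := m3.comp_measurePreserving (Measure.measurePreserving_neg volume)
  refine ((n2.add n1).add (n3.const_mul M)).mono'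
    (measurable_movingAverageKernel h.continuous ρ x).aestronglyMeasurable
    (Eventually.of_forall fun y => ?_)
  simp only [Pi.add_apply, Function.comp_apply, Real.norm_eq_abs]
  have p1 : ∀ z, 0 ≤ φ z ^ ρ := fun z => Real.rpow_nonneg (h.nonneg z) ρ
  rcases le_total (φ (-y)) R with hy | hy
  · have hxy : φ (x - y) ≤ R₃ := by
      have h1 := hR₁b _ hy
      rw [norm_neg] at h1
      have h2 := hR₂ (x - y) (by
        rw [mem_closedBall_zero_iff]
        exact (norm_sub_le x y).trans (by linarith))
      rw [Real.norm_eq_abs] at h2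
      linarith [le_abs_self (φ (x - y)), le_abs_self R₂]
    rw [Set.indicator_of_mem (show φ (x - y) ∈ Set.Iic R₃ from hxy),
      Set.indicator_of_mem (show φ (-y) ∈ Set.Iic R from hy)]
    have h3 : |movingAverageKernel φ ρ x y| ≤ φ (x - y) ^ ρ + φ (-y) ^ ρ := by
      refine (abs_sub _ _).trans ?_
      rw [abs_of_nonneg (p1 _), abs_of_nonneg (p1 _)]
    by_cases hy' : φ (-y) ∈ Set.Ici R
    · have := hM y hy'
      rw [Set.indicator_of_mem hy']
      have h4 := p1 (x - y)
      have h5 := p1 (-y)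
      linarith
    · rw [Set.indicator_of_notMem hy']
      linarith
  · rw [Set.indicator_of_mem (show φ (-y) ∈ Set.Ici R from hy)]
    have h1 := hM y hy
    have h2 : 0 ≤ (Set.Iic R₃).indicator (fun t => t ^ ρ) (φ (x - y)) := by
      by_cases hz : φ (x - y) ∈ Set.Iic R₃
      · rw [Set.indicator_of_mem hz]; exact p1 _
      · rw [Set.indicator_of_notMem hz]
    have h3 : 0 ≤ (Set.Iic R).indicator (fun t => t ^ ρ) (φ (-y)) := by
      by_cases hz : φ (-y) ∈ Set.Iic R
      · rw [Set.indicator_of_mem hz]; exact p1 _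
      · rw [Set.indicator_of_notMem hz]
    linarith

theorem isScalingKernel_movingAverageKernel [Nontrivial (EuclideanSpace ℝ (Fin d))]
    (h : IsRadial E φ) (hE : IsContractive E l) (hl : 0 < l) {β H : ℝ}
    (hadm : IsAdmissible β E φ) (hH : 0 < H) (hHβ : H < β) (hHq : H ≠ E.trace / 2) :
    IsScalingKernel E H (movingAverageKernel φ (H - E.trace / 2)) where
  memLp := memLp_movingAverageKernel h hE hl hadm hH hHβ
  eLpNorm_sub x y := by
    have := eLpNorm_comp_measurePreserving (p := 2)
      (measurable_movingAverageKernel h.continuous (H - E.trace / 2) (x - y)).aestronglyMeasurable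
      (measurePreserving_sub_right volume y)
    rw [← this]
    congr 1
    ext z
    simp only [Pi.sub_apply, Function.comp_apply, movingAverageKernel]
    rw [show x - y - (z - y) = x - z by abel, show -(z - y) = y - z by abel]
    ring
  eLpNorm_powAct c hc x := by
    set ρ := H - E.trace / 2 with hρ
    have h1 := eLpNorm_comp_powAct (F := E) hc
      (measurable_movingAverageKernel h.continuous ρ (powAct E c x)).aestronglyMeasurable
    have h2 : (fun y => movingAverageKernel φ ρ (powAct E c x) (powAct E c y)) =
        c ^ ρ • movingAverageKernel φ ρ x := by
      ext y
      simp only [movingAverageKernel, Pi.smul_apply, smul_eq_mul]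
      rw [← powAct_sub, ← powAct_neg, h.map_powAct c hc, h.map_powAct c hc,
        Real.mul_rpow hc.le (h.nonneg _), Real.mul_rpow hc.le (h.nonneg _)]
      ring
    rw [h2, eLpNorm_const_smul, Real.enorm_of_nonneg (by positivity)] at h1
    have h3 : ENNReal.ofReal (c ^ H) =
        ENNReal.ofReal (c ^ (E.trace / 2)) * ENNReal.ofReal (c ^ ρ) := by
      rw [← ENNReal.ofReal_mul (by positivity), ← Real.rpow_add hc, hρ]
      congr 2; ring
    have h4 : ENNReal.ofReal (c ^ (E.trace / 2)) * ENNReal.ofReal (c ^ (-(E.trace / 2))) = 1 := by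
      rw [← ENNReal.ofReal_mul (by positivity), ← Real.rpow_add hc, add_neg_cancel,
        Real.rpow_zero, ENNReal.ofReal_one]
    rw [h3, mul_assoc, h1, ← mul_assoc, h4, one_mul]
  tendsto x x₀ hx := by
    -- Since the exponent may be negative, continuity in x can fail at y = x₀, and only there.
    filter_upwards [(measure_eq_zero_iff_ae_notMem.1 (measure_singleton x₀))] with y hy
    have hy' : x₀ - y ≠ 0 := fun h0 => hy (by rw [sub_eq_zero] at h0; exact h0.symm)
    have h1 : Tendsto (fun n => φ (x n - y)) atTop (𝓝 (φ (x₀ - y))) :=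
      (h.continuous.tendsto _).comp (hx.sub_const y)
    exact (h1.rpow_const (Or.inl (h.pos _ hy').ne')).sub_const _
  eLpNorm_ne_zero x hx h0 := by
    -- As the exponent is nonzero, a vanishing kernel gives φ(x - y) = φ(-y), for all y by
    -- continuity; y = 0 then yields φ(x) = 0.
    have hρ : H - E.trace / 2 ≠ 0 := sub_ne_zero.2 hHq
    rw [eLpNorm_eq_zero_iff (measurable_movingAverageKernel h.continuous _ _).aestronglyMeasurable
      two_ne_zero] at h0
    have h1 : (fun y => φ (x - y)) =ᵐ[volume] fun y => φ (-y) := by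
      filter_upwards [h0] with y hy
      exact (Real.rpow_left_inj (h.nonneg _) (h.nonneg _) hρ).1 (sub_eq_zero.1 hy)
    have hc := h.continuous
    have h2 := (Continuous.ae_eq_iff_eq volume (by fun_prop) (by fun_prop)).1 h1
    have h3 := congrFun h2 0
    simp only [sub_zero, neg_zero, h.map_zero] at h3
    exact (h.pos x hx).ne' h3

end


/-! ### The harmonizable kernel -/

section

variable {d : ℕ} {E : Matrix (Fin d) (Fin d) ℝ} {l : ℝ}

/-- The kernel of the harmonizable field. -/
noncomputable def harmonizableKernel (ψ : EuclideanSpace ℝ (Fin d) → ℝ) (κ : ℝ)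
    (x ξ : EuclideanSpace ℝ (Fin d)) : ℂ :=
  (Complex.exp (Complex.I * ((inner ℝ x ξ : ℝ) : ℂ)) - 1) * ((ψ ξ ^ κ : ℝ) : ℂ)

variable {ψ : EuclideanSpace ℝ (Fin d) → ℝ}

theorem measurable_harmonizableKernel (hψ : Continuous ψ) (κ : ℝ)
    (x : EuclideanSpace ℝ (Fin d)) : Measurable (harmonizableKernel ψ κ x) := by
  have := hψ.measurable
  have h1 : Measurable fun ξ => (Complex.exp (Complex.I * ((inner ℝ x ξ : ℝ) : ℂ)) - 1) :=
    Continuous.measurable (by fun_prop)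
  exact h1.mul (Complex.measurable_ofReal.comp (this.pow_const κ))

/-- For ψ ≤ 1 the exponential factor is at most ‖x‖‖ξ‖, hence of order ψ^l, and 2(l + κ) + q = 2(l -
H) > 0. For ψ ≥ 1 it is at most 2, and 2κ + q = -2H < 0. -/
theorem memLp_harmonizableKernel [Nontrivial (EuclideanSpace ℝ (Fin d))]
    (h : IsRadial E.transpose ψ) (hE : IsContractive E.transpose l) (hl : 0 < l) {H : ℝ}
    (hH : 0 < H) (hHl : H < l) (x : EuclideanSpace ℝ (Fin d)) :
    MemLp (harmonizableKernel ψ (-H - E.trace / 2) x) 2 volume := by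
  set κ := -H - E.trace / 2 with hκ
  have ht : E.transpose.trace = E.trace := Matrix.trace_transpose E
  obtain ⟨R, hR, hRb⟩ := h.exists_norm_le_rpow hE hl
  have m1 := h.memLp_indicator_Iic hE hl (κ := l + κ) (by rw [ht, hκ]; linarith) one_pos
  have m2 := h.memLp_indicator_Ici hE hl (κ := κ) (by rw [ht, hκ]; linarith) one_pos
  refine ((m1.const_mul (‖x‖ * R)).add (m2.const_mul 2)).mono'
    (measurable_harmonizableKernel h.continuous κ x).aestronglyMeasurable
    (Eventually.of_forall fun ξ => ?_)
  have p : ∀ s : ℝ, 0 ≤ ψ ξ ^ s := fun s => Real.rpow_nonneg (h.nonneg ξ) s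
  have n1 : 0 ≤ (Set.Iic 1).indicator (fun t : ℝ => t ^ (l + κ)) (ψ ξ) := by
    by_cases hz : ψ ξ ∈ Set.Iic 1
    · rw [Set.indicator_of_mem hz]; exact p _
    · rw [Set.indicator_of_notMem hz]
  have n2 : 0 ≤ (Set.Ici 1).indicator (fun t : ℝ => t ^ κ) (ψ ξ) := by
    by_cases hz : ψ ξ ∈ Set.Ici 1
    · rw [Set.indicator_of_mem hz]; exact p _
    · rw [Set.indicator_of_notMem hz]
  have hn : ‖harmonizableKernel ψ κ x ξ‖ =
      ‖Complex.exp (Complex.I * ((inner ℝ x ξ : ℝ) : ℂ)) - 1‖ * ψ ξ ^ κ := by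
    rw [harmonizableKernel, norm_mul, Complex.norm_real, Real.norm_eq_abs, abs_of_nonneg (p κ)]
  simp only [Pi.add_apply]
  rw [hn]
  rcases le_total (ψ ξ) 1 with h1 | h1
  · rw [Set.indicator_of_mem (show ψ ξ ∈ Set.Iic 1 from h1)]
    rcases eq_or_ne ξ 0 with rfl | hξ
    · have := p (l + κ)
      simp only [inner_zero_right, Complex.ofReal_zero, mul_zero, Complex.exp_zero, sub_self,
        norm_zero, zero_mul]
      positivity
    have h2 : ‖Complex.exp (Complex.I * ((inner ℝ x ξ : ℝ) : ℂ)) - 1‖ ≤ ‖x‖ * (R * ψ ξ ^ l) :=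
      calc _ ≤ ‖(inner ℝ x ξ : ℝ)‖ := Real.norm_exp_I_mul_ofReal_sub_one_le
        _ ≤ ‖x‖ * ‖ξ‖ := norm_inner_le_norm x ξ
        _ ≤ _ := by gcongr; exact hRb ξ h1
    rw [Real.rpow_add (h.pos ξ hξ)]
    have := mul_le_mul_of_nonneg_right h2 (p κ)
    linarith
  · rw [Set.indicator_of_mem (show ψ ξ ∈ Set.Ici 1 from h1)]
    have h2 : ‖Complex.exp (Complex.I * ((inner ℝ x ξ : ℝ) : ℂ)) - 1‖ ≤ 2 := by
      refine (norm_sub_le _ _).trans ?_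
      rw [mul_comm, Complex.norm_exp_ofReal_mul_I, norm_one]
      norm_num
    have h3 := mul_le_mul_of_nonneg_right h2 (p κ)
    have h4 := mul_nonneg (mul_nonneg (norm_nonneg x) hR.le) n1
    linarith

theorem isScalingKernel_harmonizableKernel [Nontrivial (EuclideanSpace ℝ (Fin d))]
    (h : IsRadial E.transpose ψ) (hE : IsContractive E.transpose l) (hl : 0 < l) {H : ℝ}
    (hH : 0 < H) (hHl : H < l) :
    IsScalingKernel E H (harmonizableKernel ψ (-H - E.trace / 2)) where
  memLp := memLp_harmonizableKernel h hE hl hH hHl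
  eLpNorm_sub x y := by
    refine eLpNorm_congr_norm_ae (Eventually.of_forall fun ξ => ?_)
    have e : Complex.exp (Complex.I * ((inner ℝ x ξ : ℝ) : ℂ)) =
        Complex.exp (Complex.I * ((inner ℝ y ξ : ℝ) : ℂ)) *
          Complex.exp (Complex.I * ((inner ℝ (x - y) ξ : ℝ) : ℂ)) := by
      rw [← Complex.exp_add, inner_sub_left]
      congr 1
      push_cast
      ring
    have e2 : harmonizableKernel ψ (-H - E.trace / 2) x ξ -
        harmonizableKernel ψ (-H - E.trace / 2) y ξ =
        Complex.exp (Complex.I * ((inner ℝ y ξ : ℝ) : ℂ)) *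
          harmonizableKernel ψ (-H - E.trace / 2) (x - y) ξ := by
      simp only [harmonizableKernel]
      rw [e]
      ring
    rw [Pi.sub_apply, e2, norm_mul, mul_comm Complex.I, Complex.norm_exp_ofReal_mul_I, one_mul]
  eLpNorm_powAct c hc x := by
    set κ := -H - E.trace / 2 with hκ
    have ht : E.transpose.trace = E.trace := Matrix.trace_transpose E
    have h1 := eLpNorm_comp_powAct (F := E.transpose) (inv_pos.2 hc)
      (measurable_harmonizableKernel h.continuous κ (powAct E c x)).aestronglyMeasurable
    -- The substitution in ξ by the transposed group at c⁻¹ cancels c^E in the inner product.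
    have h2 : (fun ξ => harmonizableKernel ψ κ (powAct E c x) (powAct E.transpose c⁻¹ ξ)) =
        ((c⁻¹ ^ κ : ℝ) : ℂ) • harmonizableKernel ψ κ x := by
      ext ξ
      simp only [harmonizableKernel, Pi.smul_apply, smul_eq_mul]
      rw [← inner_powAct_transpose, powAct_powAct_inv _ hc, h.map_powAct _ (inv_pos.2 hc),
        Real.mul_rpow (inv_pos.2 hc).le (h.nonneg _)]
      push_cast
      ring
    have h0 : ‖((c⁻¹ ^ κ : ℝ) : ℂ)‖ₑ = ENNReal.ofReal (c⁻¹ ^ κ) := by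
      rw [← ofReal_norm, Complex.norm_real, Real.norm_of_nonneg (by positivity)]
    rw [h2, eLpNorm_const_smul, h0, ht] at h1
    have h3 : ENNReal.ofReal (c ^ H) =
        ENNReal.ofReal (c⁻¹ ^ (E.trace / 2)) * ENNReal.ofReal (c⁻¹ ^ κ) := by
      rw [← ENNReal.ofReal_mul (by positivity), ← Real.rpow_add (inv_pos.2 hc), hκ,
        Real.inv_rpow hc.le, ← Real.rpow_neg hc.le]
      congr 2; ring
    have h4 : ENNReal.ofReal (c⁻¹ ^ (E.trace / 2)) * ENNReal.ofReal (c⁻¹ ^ (-(E.trace / 2))) =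
        1 := by
      rw [← ENNReal.ofReal_mul (by positivity), ← Real.rpow_add (inv_pos.2 hc), add_neg_cancel,
        Real.rpow_zero, ENNReal.ofReal_one]
    rw [h3, mul_assoc, h1, ← mul_assoc, h4, one_mul]
  tendsto x x₀ hx := Eventually.of_forall fun ξ => by
    have h1 : Continuous fun x => harmonizableKernel ψ (-H - E.trace / 2) x ξ := by
      unfold harmonizableKernel
      fun_prop
    exact (h1.tendsto x₀).comp hx
  eLpNorm_ne_zero x hx h0 := by
    rw [eLpNorm_eq_zero_iff (measurable_harmonizableKernel h.continuous _ _).aestronglyMeasurable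
      two_ne_zero] at h0
    have h1 : (fun ξ => Complex.exp (Complex.I * ((inner ℝ x ξ : ℝ) : ℂ))) =ᵐ[volume]
        fun _ => 1 := by
      filter_upwards [h0, (measure_eq_zero_iff_ae_notMem.1
        (measure_singleton (0 : EuclideanSpace ℝ (Fin d))))] with ξ hξ hξ0
      have hp := Real.rpow_pos_of_pos (h.pos ξ hξ0) (-H - E.trace / 2)
      rcases mul_eq_zero.1 hξ with h2 | h2
      · exact sub_eq_zero.1 h2
      · exact (hp.ne' (Complex.ofReal_eq_zero.1 h2)).elim
    have h2 := (Continuous.ae_eq_iff_eq volume (by fun_prop) (by fun_prop)).1 h1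
    -- At this frequency ⟨x, ξ⟩ = π, so the exponential is -1 instead of 1.
    have h3 := congrFun h2 ((Real.pi / ‖x‖ ^ 2) • x)
    have hx' : ‖x‖ ^ 2 ≠ 0 := pow_ne_zero 2 (norm_ne_zero_iff.2 hx)
    simp only [inner_smul_right, real_inner_self_eq_norm_sq] at h3
    rw [div_mul_cancel₀ _ hx', mul_comm, Complex.exp_pi_mul_I] at h3
    norm_num at h3

end


/-! ### The L² norm of a scaling kernel along a line -/

section

variable {d p : ℕ} {E : Matrix (Fin d) (Fin d) ℝ} {H : ℝ} {𝕜 : Type*} [RCLike 𝕜]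
  {k : EuclideanSpace ℝ (Fin d) → EuclideanSpace ℝ (Fin d) → 𝕜}

namespace IsScalingKernel

theorem eLpNorm_zero (hk : IsScalingKernel E H k) : eLpNorm (k 0) 2 volume = 0 := by
  have h := hk.eLpNorm_sub 0 0
  rw [sub_self, sub_self] at h
  rw [← h]
  simp

theorem eLpNorm_neg (hk : IsScalingKernel E H k) (x : EuclideanSpace ℝ (Fin d)) :
    eLpNorm (k (-x)) 2 volume = eLpNorm (k x) 2 volume := by
  rw [← zero_sub, ← hk.eLpNorm_sub, eLpNorm_sub_comm, hk.eLpNorm_sub, sub_zero]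

theorem eLpNorm_sub_le (hk : IsScalingKernel E H k) (x y : EuclideanSpace ℝ (Fin d)) :
    eLpNorm (k (x - y)) 2 volume ≤ eLpNorm (k x) 2 volume + eLpNorm (k y) 2 volume := by
  rw [← hk.eLpNorm_sub]
  exact MeasureTheory.eLpNorm_sub_le (hk.memLp x).1 (hk.memLp y).1 (by norm_num)

theorem eLpNorm_nsmul_le (hk : IsScalingKernel E H k) (n : ℕ) (x : EuclideanSpace ℝ (Fin d)) :
    eLpNorm (k ((n : ℝ) • x)) 2 volume ≤ n * eLpNorm (k x) 2 volume := by
  induction n with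
  | zero => simp [hk.eLpNorm_zero]
  | succ n ih =>
    have e : ((n + 1 : ℕ) : ℝ) • x = (n : ℝ) • x - (-x) := by
      push_cast; rw [add_smul, one_smul, sub_neg_eq_add]
    rw [e]
    refine (hk.eLpNorm_sub_le _ _).trans ?_
    rw [hk.eLpNorm_neg]
    push_cast
    rw [add_mul, one_mul]
    gcongr

/-- Fatou's lemma, from the pointwise convergence of the kernels. -/
theorem lowerSemicontinuous (hk : IsScalingKernel E H k) :
    LowerSemicontinuous fun x => eLpNorm (k x) 2 volume := by
  rw [lowerSemicontinuous_iff_isClosed_preimage]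
  intro C
  refine IsSeqClosed.isClosed fun x x₀ hx hlim => ?_
  refine (Lp.eLpNorm_lim_le_liminf_eLpNorm (fun n => (hk.memLp (x n)).1) (k x₀)
    (hk.tendsto x x₀ hlim)).trans ?_
  exact (liminf_le_liminf (Eventually.of_forall fun n => hx n)).trans_eq (by simp)

/-- Baire category replaces continuity: some closed sublevel set of the norm contains a ball,
differences move the ball to the origin, and subadditivity extends the bound to every radius. -/
theorem exists_forall_eLpNorm_le (hk : IsScalingKernel E H k) (r : ℝ) :
    ∃ M : ℝ≥0, ∀ x, ‖x‖ ≤ r → eLpNorm (k x) 2 volume ≤ M := by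
  obtain ⟨n, hn⟩ := nonempty_interior_of_iUnion_of_closed
    (f := fun n : ℕ => (fun x => eLpNorm (k x) 2 volume) ⁻¹' Set.Iic (n : ℝ≥0∞))
    (fun n => (lowerSemicontinuous_iff_isClosed_preimage.1 hk.lowerSemicontinuous) n)
    (by
      refine Set.eq_univ_of_forall fun x => Set.mem_iUnion.2 ?_
      obtain ⟨n, hn⟩ := ENNReal.exists_nat_gt (hk.memLp x).2.ne
      exact ⟨n, hn.le⟩)
  obtain ⟨x₀, hx₀⟩ := hn
  obtain ⟨ε, hε, hb⟩ := Metric.mem_nhds_iff.1 (mem_interior_iff_mem_nhds.1 hx₀)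
  have hsmall : ∀ z, ‖z‖ < ε → eLpNorm (k z) 2 volume ≤ n + n := fun z hz => by
    have h1 : eLpNorm (k (x₀ + z)) 2 volume ≤ n := hb (by simpa using hz)
    have h2 : eLpNorm (k x₀) 2 volume ≤ n := hb (Metric.mem_ball_self hε)
    have h3 := hk.eLpNorm_sub_le (x₀ + z) x₀
    rw [add_sub_cancel_left] at h3
    exact h3.trans (add_le_add h1 h2)
  obtain ⟨m, hm⟩ := exists_nat_gt (max (r / ε) 0)
  have hm0 : (0 : ℝ) < m := (le_max_right _ _).trans_lt hm
  have hmr : r < m * ε := (div_lt_iff₀ hε).1 ((le_max_left _ _).trans_lt hm)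
  refine ⟨m * (n + n), fun x hx => ?_⟩
  have e : x = (m : ℝ) • ((m : ℝ)⁻¹ • x) := by rw [smul_smul, mul_inv_cancel₀ hm0.ne', one_smul]
  rw [e]
  refine (hk.eLpNorm_nsmul_le m _).trans ?_
  push_cast
  gcongr
  refine hsmall _ ?_
  rw [norm_smul, norm_inv, Real.norm_of_nonneg hm0.le, inv_mul_lt_iff₀ hm0]
  linarith

theorem eLpNorm_smul_abs (hk : IsScalingKernel E H k) (t : ℝ) (u : EuclideanSpace ℝ (Fin d)) :
    eLpNorm (k (|t| • u)) 2 volume = eLpNorm (k (t • u)) 2 volume := by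
  rcases abs_cases t with ⟨h, _⟩ | ⟨h, _⟩
  · rw [h]
  · rw [h, neg_smul, hk.eLpNorm_neg]

/-- Take c = |t|^(-α/H) and δ = H/α - r, so that |t| c^(r + δ) = 1. Then c^E(tu) stays in a fixed
ball, where the norm of the kernel is bounded, and c^(-H) = |t|^α. -/
theorem exists_toReal_le_rpow (hk : IsScalingKernel E H k) (hH : 0 < H)
    {u : EuclideanSpace ℝ (Fin d)} {r : ℝ} (hr : 0 < r)
    (hu : ∀ δ > 0, ∃ C, 0 < C ∧ ∀ c : ℝ, 1 ≤ c → ‖powAct E c u‖ ≤ C * c ^ (r + δ))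
    {α : ℝ} (hα : 0 < α) (hαr : α < H / r) :
    ∃ M, 0 ≤ M ∧ ∀ t : ℝ, |t| ≤ 1 → (eLpNorm (k (t • u)) 2 volume).toReal ≤ M * |t| ^ α := by
  have hδ : 0 < H / α - r := by
    rw [sub_pos, lt_div_iff₀ hα, mul_comm]; rwa [lt_div_iff₀ hr] at hαr
  obtain ⟨C, hC, hCb⟩ := hu _ hδ
  obtain ⟨M, hM⟩ := hk.exists_forall_eLpNorm_le C
  refine ⟨M, M.2, fun t ht => ?_⟩
  rw [← hk.eLpNorm_smul_abs]
  rcases (abs_nonneg t).eq_or_lt with h0 | h0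
  · rw [← h0, zero_smul, hk.eLpNorm_zero, Real.zero_rpow hα.ne']; simp
  set s := |t|
  have hs1 : 1 ≤ s ^ (-(α / H)) :=
    Real.one_le_rpow_of_pos_of_le_one_of_nonpos h0 ht (by
      have : 0 < α / H := by positivity
      linarith)
  set c := s ^ (-(α / H)) with hc
  have hc0 : 0 < c := by positivity
  have h1 := hCb c hs1
  have h2 := hM (powAct E c (s • u)) (by
    rw [powAct_smul, norm_smul, Real.norm_of_nonneg h0.le]
    have : s * c ^ (r + (H / α - r)) = 1 := by
      rw [hc, ← Real.rpow_mul h0.le, show -(α / H) * (r + (H / α - r)) = -1 by field_simp; ring,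
        Real.rpow_neg_one, mul_inv_cancel₀ h0.ne']
    calc s * ‖powAct E c u‖ ≤ s * (C * c ^ (r + (H / α - r))) := by gcongr
      _ = C * (s * c ^ (r + (H / α - r))) := by ring
      _ = C := by rw [this, mul_one])
  rw [hk.eLpNorm_powAct c hc0] at h2
  have h3 := ENNReal.toReal_mono ENNReal.coe_ne_top h2
  rw [ENNReal.toReal_mul, ENNReal.toReal_ofReal (by positivity), ENNReal.coe_toReal] at h3
  have e : c ^ H * s ^ α = 1 := by
    rw [hc, ← Real.rpow_mul h0.le, ← Real.rpow_add h0,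
      show -(α / H) * H + α = 0 by field_simp; ring, Real.rpow_zero]
  have h4 : 0 < s ^ α := by positivity
  calc _ = c ^ H * s ^ α * (eLpNorm (k (s • u)) 2 volume).toReal := by rw [e, one_mul]
    _ = c ^ H * (eLpNorm (k (s • u)) 2 volume).toReal * s ^ α := by ring
    _ ≤ _ := by gcongr

/-- With c₀ = |t|^(-α/H) the vector c₀^E(tu) has norm at least κ. It may be too long for a
compactness argument, so the orbit is stopped earlier, in the annulus `S`, where the norm of the
kernel attains a positive minimum. -/
theorem exists_rpow_le_toReal (hk : IsScalingKernel E H k) (hH : 0 < H)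
    {u : EuclideanSpace ℝ (Fin d)} {r : ℝ} (hr : 0 < r)
    (hu : ∀ δ > 0, ∃ C, 0 < C ∧ ∀ c : ℝ, 1 ≤ c → C * c ^ (r - δ) ≤ ‖powAct E c u‖)
    {α : ℝ} (hαr : H / r < α) :
    ∃ m, 0 < m ∧ ∀ t : ℝ, |t| ≤ 1 → m * |t| ^ α ≤ (eLpNorm (k (t • u)) 2 volume).toReal := by
  have hα : 0 < α := lt_trans (by positivity) hαr
  have hδ : 0 < r - H / α := by
    rw [sub_pos, div_lt_iff₀ hα, mul_comm]; rwa [div_lt_iff₀ hr] at hαr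
  obtain ⟨κ, hκ, hκb⟩ := hu _ hδ
  have hκu : κ ≤ ‖u‖ := by
    have := hκb 1 le_rfl
    rwa [powAct_one, Real.one_rpow, mul_one] at this
  set S : Set (EuclideanSpace ℝ (Fin d)) := Metric.closedBall 0 ‖u‖ ∩ {x | κ ≤ ‖x‖} with hS
  have hScomp : IsCompact S := (isCompact_closedBall _ _).inter_right
    (isClosed_le continuous_const continuous_norm)
  obtain ⟨x₁, hx₁, hmin⟩ := (hk.lowerSemicontinuous.lowerSemicontinuousOn S).exists_isMinOn
    (show S.Nonempty from ⟨u, by simp, hκu⟩) hScomp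
  have hx₁0 : x₁ ≠ 0 := by
    rintro rfl
    have : κ ≤ ‖(0 : EuclideanSpace ℝ (Fin d))‖ := hx₁.2
    rw [norm_zero] at this
    linarith
  set m := (eLpNorm (k x₁) 2 volume).toReal with hm
  have hm0 : 0 < m := ENNReal.toReal_pos (hk.eLpNorm_ne_zero x₁ hx₁0) (hk.memLp x₁).2.ne
  refine ⟨m, hm0, fun t ht => ?_⟩
  rw [← hk.eLpNorm_smul_abs]
  rcases (abs_nonneg t).eq_or_lt with h0 | h0
  · rw [← h0, zero_smul, hk.eLpNorm_zero, Real.zero_rpow hα.ne']; simp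
  set s := |t|
  have hs1 : 1 ≤ s ^ (-(α / H)) :=
    Real.one_le_rpow_of_pos_of_le_one_of_nonpos h0 ht (by
      have : 0 < α / H := by positivity
      linarith)
  set c₀ := s ^ (-(α / H)) with hc₀
  have hlarge : κ ≤ ‖powAct E c₀ (s • u)‖ := by
    have h1 := hκb c₀ hs1
    rw [powAct_smul, norm_smul, Real.norm_of_nonneg h0.le]
    have : s * c₀ ^ (r - (r - H / α)) = 1 := by
      rw [hc₀, ← Real.rpow_mul h0.le, show -(α / H) * (r - (r - H / α)) = -1 by field_simp; ring,
        Real.rpow_neg_one, mul_inv_cancel₀ h0.ne']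
    calc κ = κ * (s * c₀ ^ (r - (r - H / α))) := by rw [this, mul_one]
      _ = s * (κ * c₀ ^ (r - (r - H / α))) := by ring
      _ ≤ _ := by gcongr
  -- The orbit starts inside the ball of radius ‖u‖. Either it is already in `S` at c = 1, or it
  -- crosses the sphere of radius κ before c₀. Stopping early is harmless, as c ≤ c₀ gives c^H ≤
  -- c₀^H.
  obtain ⟨c, hc1, hcc₀, hcS⟩ : ∃ c, 1 ≤ c ∧ c ≤ c₀ ∧ powAct E c (s • u) ∈ S := by
    have hone : ‖powAct E 1 (s • u)‖ ≤ ‖u‖ := by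
      rw [powAct_one, norm_smul, Real.norm_of_nonneg h0.le]
      exact mul_le_of_le_one_left (norm_nonneg _) ht
    rcases le_total κ ‖powAct E 1 (s • u)‖ with h | h
    · exact ⟨1, le_rfl, hs1, by simpa using hone, h⟩
    · have hcont : ContinuousOn (fun c => ‖powAct E c (s • u)‖) (Set.Icc 1 c₀) :=
        (continuousOn_powAct E (s • u)).norm.mono fun c hc => by
          have : (0 : ℝ) < c := by linarith [hc.1]
          exact this
      obtain ⟨c, hc, he⟩ := intermediate_value_Icc hs1 hcont ⟨h, hlarge⟩
      exact ⟨c, hc.1, hc.2, by simpa using he.le.trans hκu, he.ge⟩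
  have hc0 : 0 < c := by linarith
  have h2 : eLpNorm (k x₁) 2 volume ≤ eLpNorm (k (powAct E c (s • u))) 2 volume := hmin hcS
  have h3 := ENNReal.toReal_mono (hk.memLp _).2.ne h2
  rw [hk.eLpNorm_powAct c hc0, ENNReal.toReal_mul, ENNReal.toReal_ofReal (by positivity)] at h3
  have e : c₀ ^ H * s ^ α = 1 := by
    rw [hc₀, ← Real.rpow_mul h0.le, ← Real.rpow_add h0,
      show -(α / H) * H + α = 0 by field_simp; ring, Real.rpow_zero]
  calc m * s ^ α ≤ c₀ ^ H * (eLpNorm (k (s • u)) 2 volume).toReal * s ^ α := by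
        gcongr
        exact h3.trans (by gcongr)
    _ = c₀ ^ H * s ^ α * (eLpNorm (k (s • u)) 2 volume).toReal := by ring
    _ = _ := by rw [e, one_mul]

/-- If H/r > 1, choose α strictly in between; then N(u) ≤ n N(u/n) ≤ M n^(1 - α) tends to 0,
although N(u) > 0. -/
theorem div_le_one_of_growth (hk : IsScalingKernel E H k) (hH : 0 < H)
    {u : EuclideanSpace ℝ (Fin d)} (hu0 : u ≠ 0) {r : ℝ} (hr : 0 < r)
    (hu : ∀ δ > 0, ∃ C, 0 < C ∧ ∀ c : ℝ, 1 ≤ c → ‖powAct E c u‖ ≤ C * c ^ (r + δ)) :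
    H / r ≤ 1 := by
  by_contra! hlt
  obtain ⟨α, h1, h2⟩ := exists_between hlt
  obtain ⟨M, hM, hMb⟩ := hk.exists_toReal_le_rpow hH hr hu (by linarith) h2
  have hpos : 0 < (eLpNorm (k u) 2 volume).toReal :=
    ENNReal.toReal_pos (hk.eLpNorm_ne_zero u hu0) (hk.memLp u).2.ne
  have hlim : Tendsto (fun n : ℕ => M * (n : ℝ) ^ (-(α - 1))) atTop (𝓝 (M * 0)) :=
    ((tendsto_rpow_neg_atTop (sub_pos.2 h1)).comp tendsto_natCast_atTop_atTop).const_mul M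
  rw [mul_zero] at hlim
  obtain ⟨n, hn, hn1⟩ := ((hlim.eventually_lt_const hpos).and (eventually_ge_atTop 1)).exists
  have hn0 : (0 : ℝ) < n := by exact_mod_cast hn1
  have h3 := hk.eLpNorm_nsmul_le n ((n : ℝ)⁻¹ • u)
  rw [smul_smul, mul_inv_cancel₀ hn0.ne', one_smul] at h3
  have h4 := ENNReal.toReal_mono
    (ENNReal.mul_ne_top (ENNReal.natCast_ne_top n) (hk.memLp _).2.ne) h3
  rw [ENNReal.toReal_mul, ENNReal.toReal_natCast] at h4
  have h5 := hMb (n : ℝ)⁻¹ (by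
    rw [abs_of_pos (inv_pos.2 hn0)]
    exact inv_le_one_of_one_le₀ (by exact_mod_cast hn1))
  rw [abs_of_pos (inv_pos.2 hn0), Real.inv_rpow hn0.le, ← Real.rpow_neg hn0.le] at h5
  have h6 : (n : ℝ) * (M * (n : ℝ) ^ (-α)) = M * (n : ℝ) ^ (-(α - 1)) := by
    rw [show -(α - 1) = -α + 1 by ring, Real.rpow_add_one hn0.ne']; ring
  have h7 := mul_le_mul_of_nonneg_left h5 hn0.le
  linarith

end IsScalingKernel

end


/-! ### Conclusion for both fields -/

section

variable {d p : ℕ} {E : Matrix (Fin d) (Fin d) ℝ} {H : ℝ} {𝕜 : Type*} [RCLike 𝕜]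
  [MeasurableSpace 𝕜] [BorelSpace 𝕜]
  {k : EuclideanSpace ℝ (Fin d) → EuclideanSpace ℝ (Fin d) → 𝕜}

theorem ne_zero_of_notMem_spectralFlag {a : Fin p → ℝ} {n : ℕ} {u : EuclideanSpace ℝ (Fin d)}
    (hu : u ∉ spectralFlag E a n) : u ≠ 0 := by
  rintro rfl
  exact hu (zero_mem _)

theorem IsScalingKernel.graphHasDimension (hk : IsScalingKernel E H k) (hH : 0 < H)
    {a : Fin p → ℝ} (ha : StrictMono a) (hr : Set.range a = realSpectrum E)
    {i : Fin p} (hai : 0 < a i) {u : EuclideanSpace ℝ (Fin d)}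
    (hu : u ∈ spectralFlag E a (i + 1)) (hu' : u ∉ spectralFlag E a i)
    {Ω : Type*} [MeasurableSpace Ω] {P : Measure Ω} [IsProbabilityMeasure P] {v : ℝ≥0}
    (hv : v ≠ 0) {Z : Set (EuclideanSpace ℝ (Fin d)) → Ω → 𝕜} (hZ : IsIsonormal P v Z) :
    GraphHasDimension P (fun t ω => RCLike.re (stochasticIntegral P Z (k (t • u)) ω))
      (2 - H / a i) := by
  have hint := fun t : ℝ => hZ.isStochasticIntegral_stochasticIntegral (hk.memLp (t • u))
  have hup := fun δ (hδ : 0 < δ) => exists_norm_powAct_le E ha hu hδ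
  have hlo := fun δ (hδ : 0 < δ) => exists_le_norm_powAct E ha hr hu' hδ
  have habs : ∀ s ∈ Set.Icc (0 : ℝ) 1, ∀ t ∈ Set.Icc (0 : ℝ) 1, |s - t| ≤ 1 :=
    fun s hs t ht => abs_le.2 ⟨by linarith [hs.1, ht.2], by linarith [hs.2, ht.1]⟩
  have hpow : ∀ (x : ℝ) (α : ℝ), (|x| ^ α) ^ 2 = |x| ^ (2 * α) := fun x α => by
    rw [← Real.rpow_natCast, ← Real.rpow_mul (abs_nonneg x), mul_comm, Nat.cast_ofNat]
  have hv0 : (0 : ℝ) < v := by exact_mod_cast pos_iff_ne_zero.2 hv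
  refine graphHasDimension_of_gaussian_increments
    (w := fun s t => v * (eLpNorm (k ((s - t) • u)) 2 volume).toNNReal ^ 2)
    (fun t _ => ?_) (fun s _ t _ => ?_) (div_pos hH hai)
    (hk.div_le_one_of_growth hH (ne_zero_of_notMem_spectralFlag hu') hai hup) ?_ ?_
  · exact RCLike.continuous_re.measurable.comp_aemeasurable (hint t).2.1.aemeasurable
  · have := hZ.hasLaw_sub (hint s) (hint t)
    rwa [hk.eLpNorm_sub, ← sub_smul] at this
  · intro α h0 h1
    obtain ⟨M, hM, hMb⟩ := hk.exists_toReal_le_rpow hH hai hup h0 h1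
    refine ⟨v * M ^ 2, by positivity, fun s hs t ht => ?_⟩
    have h2 := pow_le_pow_left₀ ENNReal.toReal_nonneg (hMb _ (habs s hs t ht)) 2
    rw [mul_pow, hpow] at h2
    rw [mul_assoc]
    push_cast
    exact mul_le_mul_of_nonneg_left h2 hv0.le
  · intro α h1
    obtain ⟨m, hm, hmb⟩ := hk.exists_rpow_le_toReal hH hai hlo h1
    refine ⟨v * m ^ 2, by positivity, fun s hs t ht => ?_⟩
    have h2 := pow_le_pow_left₀ (by positivity) (hmb _ (habs s hs t ht)) 2
    rw [mul_pow, hpow] at h2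
    rw [mul_assoc]
    push_cast
    exact mul_le_mul_of_nonneg_left h2 hv0.le

end

end OSSRF

theorem corollary5p1 {d p : ℕ} (E : Matrix (Fin d) (Fin d) ℝ)
    (a : Fin p → ℝ) (ha_mono : StrictMono a) (ha_range : Set.range a = OSSRF.realSpectrum E)
    (ha_pos : ∀ i, 0 < a i)
    {Ω : Type*} [MeasurableSpace Ω] (P : Measure Ω) [IsProbabilityMeasure P]
    (v : NNReal) (hv : v ≠ 0) :
    -- the moving average field
    (∀ (β H : ℝ) (φ : EuclideanSpace ℝ (Fin d) → ℝ)
        (Z : Set (EuclideanSpace ℝ (Fin d)) → Ω → ℝ),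
      OSSRF.IsHomogeneous E φ → OSSRF.IsAdmissible β E φ →
      0 < H → H < β → H ≠ E.trace / 2 →
      OSSRF.IsGaussianRandomMeasure P v Z →
      ∀ (i : Fin p) (u : EuclideanSpace ℝ (Fin d)),
        u ∈ OSSRF.spectralFlag E a (i + 1) → u ∉ OSSRF.spectralFlag E a i →
        OSSRF.GraphHasDimension P
          (fun t => OSSRF.movingAverageField P Z E φ H (t • u)) (2 - H / a i)) ∧
    -- the harmonizable field
    (∀ (H : ℝ) (ψ : EuclideanSpace ℝ (Fin d) → ℝ)
        (W : Set (EuclideanSpace ℝ (Fin d)) → Ω → ℂ),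
      Continuous ψ → OSSRF.IsHomogeneous E.transpose ψ →
      (∀ ξ, 0 ≤ ψ ξ) → (∀ ξ, ξ ≠ 0 → 0 < ψ ξ) →
      0 < H → (∀ j, H < a j) →
      OSSRF.IsIsotropicGaussianRandomMeasure P v W →
      ∀ (i : Fin p) (u : EuclideanSpace ℝ (Fin d)),
        u ∈ OSSRF.spectralFlag E a (i + 1) → u ∉ OSSRF.spectralFlag E a i →
        OSSRF.GraphHasDimension P
          (fun t => OSSRF.harmonizableField P W E ψ H (t • u)) (2 - H / a i)) := by
  -- The index i only provides p > 0, so that a smallest real part exists. The moving average field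
  -- needs a contraction exponent l > 0; the harmonizable one needs l > H for integrability at low
  -- frequencies.
  have hcontr : ∀ i : Fin p, ∀ b, (∀ j, b < a j) → ∃ l, b < l ∧ OSSRF.IsContractive E l := by
    intro i b hb
    have h0 : ∀ j, a ⟨0, i.pos⟩ ≤ a j := fun j => ha_mono.monotone (Fin.le_def.2 (Nat.zero_le _))
    obtain ⟨l, hbl, hl⟩ := exists_between (hb ⟨0, i.pos⟩)
    refine ⟨l, hbl, OSSRF.isContractive_of_lt E (fun x hx => ?_) hl⟩
    obtain ⟨j, rfl⟩ := ha_range ▸ hx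
    exact h0 j
  refine ⟨fun β H φ Z hhom hadm hH hHβ hHq hZ i u hu hu' => ?_,
    fun H ψ W hc hhom _ hpos hH hHa hW i u hu hu' => ?_⟩
  -- The vector u is nonzero, which rules out dimension 0, where points are not null sets.
  · have : Nontrivial (EuclideanSpace ℝ (Fin d)) :=
      ⟨u, 0, OSSRF.ne_zero_of_notMem_spectralFlag hu'⟩
    obtain ⟨l, hl, hE⟩ := hcontr i 0 ha_pos
    have hφ := OSSRF.isRadial_of_isHomogeneous hE hl hadm.continuous hhom hadm.pos
    exact (OSSRF.isScalingKernel_movingAverageKernel hφ hE hl hadm hH hHβ hHq).graphHasDimension hH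
      ha_mono ha_range (ha_pos i) hu hu' hv hZ.isIsonormal
  · have : Nontrivial (EuclideanSpace ℝ (Fin d)) :=
      ⟨u, 0, OSSRF.ne_zero_of_notMem_spectralFlag hu'⟩
    obtain ⟨l, hHl, hE⟩ := hcontr i H hHa
    have hψ := OSSRF.isRadial_of_isHomogeneous hE.transpose (hH.trans hHl) hc hhom hpos
    exact (OSSRF.isScalingKernel_harmonizableKernel hψ hE.transpose (hH.trans hHl) hH
      hHl).graphHasDimension hH ha_mono ha_range (ha_pos i) hu hu' hv hW.isIsonormal
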